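/- \textbf{Model.} A constant-work-space program is a fixed finite while-program using a fixed number of registers of three kinds: counters (natural numbers), pointers to cells of the read-only input (or null), and real values. In one step it performs one assignment, one arithmetic operation ($+,-,\times,\div$) on counters or on values, one test (a fixed Boolean combination of register comparisons), or one query to the input. It uses $O(1)$ extra-space, in words of $O(\log n)$ bits, on inputs of size $n$: for some constant $K$, every counter is always at most $(n+1)^K$, and, whenever the numbers in the input are at most $B\in\mathbb N$ (natural numbers at most $B$ in the case of a tree; fractions with numerator and denominator at most $B$ in absolute value in the case of a list), every value register always holds a fraction with numerator and denominator at most $(n+B+1)^K$ in absolute value. \textbf{Input.} A tree network is a finite tree $T=(V,E)$, $|V|=n\ge 1$, with edge lengths $l(e)>0$ and vertex weights $w(v)\ge 0$. It is rooted, and given in a read-only memory with unit-time access to the root, $Parent(u)$, $FirstChild(u)$, $NextChild(u,v)$ (the child of $u$ next after $v$), $w(u)$, and the length of the edge from $u$ to its parent. A point of $T$ is a vertex or a point on an edge, and $d$ denotes distance along the tree. A weighted 1-center of $T$ is a point $x$ of $T$ that minimizes $\max_{v\in V} w(v)\,d(x,v)$ over all points of $T$. \textbf{Medians.} Let $M:\mathbb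 N\to\mathbb N$ be such that some constant-work-space program computes, for every $n\ge 1$, the median (the $\lceil n/2\rceil$-th smallest) of any $n$ real numbers in at most $M(n)$ steps using $O(1)$ extra-space, the numbers being given in a sequential-access read-only memory (a list: the program may hold pointers to $O(1)$ cells, go to the first cell, go from a cell to the next one, and read the number in a cell). \textbf{Theorem.} There are a constant-work-space program and a constant $C$ such that, for every tree network $T$ with $n\geq 1$ vertices, the program computes a weighted 1-center of $T$, using $O(1)$ extra-space, in at most $C\,(n+M(n))\log^2(n+1)$ steps; that is, in $O((n+M)\log^2 n)$ time. -/

import Mathlib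

namespace TreeCenter

/-! ## Constant-work-space machines

A machine has three banks of registers: counters (natural numbers), pointers into the read-only
input (or null), and values (reals).  A program is a finite piece of text, so it mentions only
finitely many registers, a number that does not depend on the input.  The input is not part of the
store: it can be inspected only through the queries `Q` and cannot be modified. -/

/-- The contents of the registers.  `P` is the type of cells of the read-only input. -/
structure Store (P : Type*) where
  ctr : ℕ → ℕ
  ptr : ℕ → Option P
  val : ℕ → ℝ

namespace Store

variable {P : Type*}

/-- All counters and values are zero and all pointers are null. -/
def init : Store P := ⟨fun _ => 0, fun _ => none, fun _ => 0⟩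

def setCtr (s : Store P) (i k : ℕ) : Store P := { s with ctr := Function.update s.ctr i k }

def setPtr (s : Store P) (i : ℕ) (p : Option P) : Store P :=
  { s with ptr := Function.update s.ptr i p }

def setVal (s : Store P) (i : ℕ) (x : ℝ) : Store P := { s with val := Function.update s.val i x }

end Store

/-- The four arithmetic operations. -/
inductive ArithOp
  | add | sub | mul | div

/-- On counters: subtraction is truncated, division is rounded down. -/
def ArithOp.onCtr : ArithOp → ℕ → ℕ → ℕ
  | .add => (· + ·)
  | .sub => (· - ·)
  | .mul => (· * ·)
  | .div => (· / ·)

noncomputable def ArithOp.onVal : ArithOp → ℝ → ℝ → ℝ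
  | .add => (· + ·)
  | .sub => (· - ·)
  | .mul => (· * ·)
  | .div => (· / ·)

/-- Elementary instructions; the first argument is always the target register. -/
inductive Instr (Q : Type)
  | ctrConst (i k : ℕ)
  | ctrCopy (i j : ℕ)
  | ctrArith (op : ArithOp) (i j k : ℕ)
  | ptrNull (i : ℕ)
  | ptrCopy (i j : ℕ)
  | valConst (i k : ℕ)
  | valCopy (i j : ℕ)
  | valArith (op : ArithOp) (i j k : ℕ)
  | query (q : Q)

/-- Tests on registers. -/
inductive Test
  | ctrEq (i j : ℕ)
  | ctrLt (i j : ℕ)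
  | ptrIsNull (i : ℕ)
  | ptrEq (i j : ℕ)
  | valEq (i j : ℕ)
  | valLt (i j : ℕ)
  | not (b : Test)
  | and (b c : Test)

/-- Programs. -/
inductive Prog (Q : Type)
  | skip
  | instr (a : Instr Q)
  | seq (c d : Prog Q)
  | ite (b : Test) (c d : Prog Q)
  | loop (b : Test) (c : Prog Q)

section Semantics

variable {P : Type*} {Q : Type}

/-- Effect of an instruction, where `ask q` is the effect of the query `q` to the input. -/
noncomputable def Instr.run (ask : Q → Store P → Store P) : Instr Q → Store P → Store P
  | .ctrConst i k, s => s.setCtr i k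
  | .ctrCopy i j, s => s.setCtr i (s.ctr j)
  | .ctrArith op i j k, s => s.setCtr i (op.onCtr (s.ctr j) (s.ctr k))
  | .ptrNull i, s => s.setPtr i none
  | .ptrCopy i j, s => s.setPtr i (s.ptr j)
  | .valConst i k, s => s.setVal i k
  | .valCopy i j, s => s.setVal i (s.val j)
  | .valArith op i j k, s => s.setVal i (op.onVal (s.val j) (s.val k))
  | .query q, s => ask q s

def Test.Holds (s : Store P) : Test → Prop
  | .ctrEq i j => s.ctr i = s.ctr j
  | .ctrLt i j => s.ctr i < s.ctr j
  | .ptrIsNull i => s.ptr i = none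
  | .ptrEq i j => s.ptr i = s.ptr j
  | .valEq i j => s.val i = s.val j
  | .valLt i j => s.val i < s.val j
  | .not b => ¬ b.Holds s
  | .and b c => b.Holds s ∧ c.Holds s

/-- `Exec ask W c s t s'`: started in the store `s`, the program `c` halts in the store `s'` after
exactly `t` steps (each instruction and each evaluation of a test is one step), and every store
produced on the way satisfies the restriction `W`.  (`loop b c` is "while `b` do `c`".) -/
inductive Exec (ask : Q → Store P → Store P) (W : Store P → Prop) :
    Prog Q → Store P → ℕ → Store P → Prop
  | skip (s : Store P) : Exec ask W .skip s 0 s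
  | instr (a : Instr Q) (s : Store P) : W (a.run ask s) → Exec ask W (.instr a) s 1 (a.run ask s)
  | seq {c d : Prog Q} {s s₁ s₂ : Store P} {t₁ t₂ : ℕ} :
      Exec ask W c s t₁ s₁ → Exec ask W d s₁ t₂ s₂ → Exec ask W (.seq c d) s (t₁ + t₂) s₂
  | iteTrue {b : Test} {c d : Prog Q} {s s' : Store P} {t : ℕ} :
      b.Holds s → Exec ask W c s t s' → Exec ask W (.ite b c d) s (t + 1) s'
  | iteFalse {b : Test} {c d : Prog Q} {s s' : Store P} {t : ℕ} :
      ¬ b.Holds s → Exec ask W d s t s' → Exec ask W (.ite b c d) s (t + 1) s'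
  | loopFalse {b : Test} {c : Prog Q} {s : Store P} :
      ¬ b.Holds s → Exec ask W (.loop b c) s 1 s
  | loopTrue {b : Test} {c : Prog Q} {s s₁ s₂ : Store P} {t₁ t₂ : ℕ} :
      b.Holds s → Exec ask W c s t₁ s₁ → Exec ask W (.loop b c) s₁ t₂ s₂ →
      Exec ask W (.loop b c) s (t₁ + t₂ + 1) s₂

end Semantics

/-- `x` is a fraction whose numerator and denominator are at most `B` in absolute value; so it
occupies `O(log B)` bits. -/
def FitsIn (B : ℕ) (x : ℝ) : Prop :=
  ∃ (a : ℤ) (b : ℕ), 0 < b ∧ b ≤ B ∧ |a| ≤ (B : ℤ) ∧ x = (a : ℝ) / (b : ℝ)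

/-! ## Medians of lists -/

/-- Queries to a read-only list. -/
inductive ListQuery
  | first (i : ℕ)
  | next (i j : ℕ)
  | read (i j : ℕ)

/-- The cell after a given cell of a list of length `n`; null at the end. -/
def nextCell {n : ℕ} (p : Fin n) : Option (Fin n) :=
  if h : p.val + 1 < n then some ⟨p.val + 1, h⟩ else none

/-- Answers to the queries: pointer to the first cell, pointer to the cell after the one that a
pointer register points to, number stored in a cell. -/
def ListQuery.ask {n : ℕ} (a : Fin n → ℝ) : ListQuery → Store (Fin n) → Store (Fin n)
  | .first i, s => s.setPtr i (if h : 0 < n then some ⟨0, h⟩ else none)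
  | .next i j, s => s.setPtr i ((s.ptr j).bind nextCell)
  | .read i j, s => s.setVal i ((s.ptr j).elim 0 a)

/-- Every register is a word of `O(log n)` bits: counters are at most `(n + 1) ^ K`, and if all
the input numbers are fractions of height at most `B`, then the values are fractions of
height at most `(n + B + 1) ^ K`. -/
def ListWords {n : ℕ} (a : Fin n → ℝ) (K : ℕ) (s : Store (Fin n)) : Prop :=
  (∀ i, s.ctr i ≤ (n + 1) ^ K) ∧
    ∀ B : ℕ, (∀ j, FitsIn B (a j)) → ∀ i, FitsIn ((n + B + 1) ^ K) (s.val i)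

/-- `x` is the median of `a₀, …, a_{n-1}`: the `⌈n/2⌉`-th smallest of them. -/
def IsMedian {n : ℕ} (a : Fin n → ℝ) (x : ℝ) : Prop :=
  (∃ j, a j = x) ∧ {j | a j < x}.ncard < (n + 1) / 2 ∧ (n + 1) / 2 ≤ {j | a j ≤ x}.ncard

/-- Some constant-work-space program finds the median of any `n ≥ 1` real numbers, given as a
read-only list, in at most `M n` steps, leaving it in the value register `0`. -/
def MedianComputableIn (M : ℕ → ℕ) : Prop :=
  ∃ (A : Prog ListQuery) (K : ℕ), ∀ (n : ℕ), 1 ≤ n → ∀ a : Fin n → ℝ,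
    ∃ (t : ℕ) (s : Store (Fin n)),
      Exec (ListQuery.ask a) (ListWords a K) A Store.init t s ∧ IsMedian a (s.val 0) ∧ t ≤ M n

/-! ## Tree networks -/

/-- A finite tree with positive edge lengths and nonnegative vertex weights, together with its
rooted representation: the parent of each vertex and the ordered list of its children. -/
structure TreeNetwork (V : Type*) where
  graph : SimpleGraph V
  isTree : graph.IsTree
  length : Sym2 V → ℝ
  length_pos : ∀ e ∈ graph.edgeSet, 0 < length e
  weight : V → ℝ
  weight_nonneg : ∀ v, 0 ≤ weight v
  root : V
  parent : V → Option V
  parent_eq_some_iff : ∀ u v,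
    parent u = some v ↔ graph.Adj u v ∧ graph.dist root u = graph.dist root v + 1
  children : V → List V
  children_nodup : ∀ v, (children v).Nodup
  mem_children_iff : ∀ u v, u ∈ children v ↔ parent u = some v

namespace TreeNetwork

variable {V : Type*} (T : TreeNetwork V)

def firstChild (u : V) : Option V := (T.children u).head?

/-- The child of `u` that comes directly after `v` in the list of the children of `u`. -/
def nextChild [DecidableEq V] (u v : V) : Option V :=
  (T.children u)[(T.children u).idxOf v + 1]?

/-- The length of the edge between `u` and its parent (`0` at the root, which has no parent). -/
noncomputable def parentLength (u : V) : ℝ := (T.parent u).elim 0 fun v => T.length s(u, v)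

/-- The distance between two vertices: the length of the path in the tree that joins them. -/
noncomputable def vdist (u v : V) : ℝ :=
  ((T.isTree.existsUnique_path u v).choose.edges.map T.length).sum

/-- A point of the tree: a vertex, or the point of the edge `uv` at distance `x` from `u`. -/
inductive Point
  | vertex (v : V)
  | onEdge (u v : V) (adj : T.graph.Adj u v) (x : ℝ) (nonneg : 0 ≤ x) (le : x ≤ T.length s(u, v))

variable {T}

/-- The distance from a point of the tree to a vertex. -/
noncomputable def Point.distTo : T.Point → V → ℝ
  | .vertex v, z => T.vdist v z
  | .onEdge u v _ x _ _, z => min (x + T.vdist u z) (T.length s(u, v) - x + T.vdist v z)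

/-- The maximum weighted distance from a point to the vertices. -/
noncomputable def Point.cost (p : T.Point) : ℝ := ⨆ z : V, T.weight z * p.distTo z

/-- The point `p` is a weighted 1-center: no point of the tree has smaller cost. -/
def Point.IsCenter (p : T.Point) : Prop := ∀ q : T.Point, p.cost ≤ q.cost

/-- How a point is reported: pointer registers `0` and `1` hold the ends of an edge and value
register `0` the distance from the first end; a vertex is reported with a null second pointer. -/
def Point.IsReportedBy (s : Store V) : T.Point → Prop
  | .vertex v => s.ptr 0 = some v ∧ s.ptr 1 = none
  | .onEdge u v _ x _ _ => s.ptr 0 = some u ∧ s.ptr 1 = some v ∧ s.val 0 = x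

end TreeNetwork

/-- Queries to a read-only tree. -/
inductive TreeQuery
  | root (i : ℕ)
  | parent (i j : ℕ)
  | firstChild (i j : ℕ)
  | nextChild (i j k : ℕ)
  | weight (i j : ℕ)
  | parentLength (i j : ℕ)

/-- Answers to the queries; a query about a null pointer is answered with null or `0`. -/
noncomputable def TreeQuery.ask {V : Type*} [DecidableEq V] (T : TreeNetwork V) :
    TreeQuery → Store V → Store V
  | .root i, s => s.setPtr i (some T.root)
  | .parent i j, s => s.setPtr i ((s.ptr j).bind T.parent)
  | .firstChild i j, s => s.setPtr i ((s.ptr j).bind T.firstChild)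
  | .nextChild i j k, s =>
      s.setPtr i ((s.ptr j).bind fun u => (s.ptr k).bind fun v => T.nextChild u v)
  | .weight i j, s => s.setVal i ((s.ptr j).elim 0 T.weight)
  | .parentLength i j, s => s.setVal i ((s.ptr j).elim 0 T.parentLength)

/-- Every register is a word of `O(log n)` bits, `n` being the number of vertices: counters
are at most `(n + 1) ^ K`, and if all the weights and lengths are natural numbers `≤ B`, then the
values are fractions of height at most `(n + B + 1) ^ K`. -/
def TreeWords {V : Type*} [Fintype V] (T : TreeNetwork V) (K : ℕ) (s : Store V) : Prop :=
  (∀ i, s.ctr i ≤ (Fintype.card V + 1) ^ K) ∧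
    ∀ B : ℕ, (∀ v, ∃ k : ℕ, k ≤ B ∧ T.weight v = k) →
      (∀ e ∈ T.graph.edgeSet, ∃ k : ℕ, k ≤ B ∧ T.length e = k) →
      ∀ i, FitsIn ((Fintype.card V + B + 1) ^ K) (s.val i)

end TreeCenter

/-! Call `d(x, y) / (1/w(x) + 1/w(y))` the ratio of two vertices of positive weight. By the triangle
inequality no point has cost below any ratio. Let `L` be the largest ratio (`IsValue`), attained by
`u, v`. The point of the path from `u` to `v` at distance `L / w(u)` from `u` is within `L / w(z)`
of every `z` of positive weight, because the ratios of `u, z` and of `v, z` are at most `L`; hence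
it is a center (`Point.isCenter_of_pair`, `min_vdist_le_of_path`, `vdist_le_of_path`).

Tree distances satisfy the four point condition, also after subtracting a correction `c(z)` at each
end. So a double sweep finds a farthest pair: `u` best from any `a`, then `v` best from `u`
(`farthest_pair`). With correction `L / w(z)` it yields a pair of ratio `L` (`IsValue.eq`); with
correction `c / w(z)` it decides whether `c < L`, at the cost of two traversals (`IsValue.lt_iff`).
What remains is to find, seen from a given vertex `v`, a highest line `lam ↦ d(v, z) - lam / w(z)`
at the unknown place `L`.

This is a parametric search in constant space. The lines are enumerated by an Euler tour from `v`,
which can be resumed from a few registers and has exactly `2n` states (`Tour.event_spec`). An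
interval with `lo < L ≤ hi` and a block length `b` are kept such that every block of `b` consecutive
lines contains one that is best on the whole interval (`Resolved`); evaluation at the midpoint
identifies that line (`Dom.eq_of_bestAt`). The best lines of neighbouring blocks intersect, and
comparing the median of the intersections inside the interval with `L` halves their number
(`Blk.median_cases`, `Blk.count_mk'_le`). When none is left, neighbouring blocks merge and `b`
doubles (`Blk.resolved_double`). There are `O(log n)` doublings with `O(log n)` halvings each
(`Blk.Progress`), and each round costs `O(n + M)`.

The intersections are never stored. The median program is given a virtual list of `n` cells, two
lines per cell; a cell in which no intersection arises holds one of the ends of the interval,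
alternately, so that the median is not displaced. A pointer into this list is a snapshot of the tour
and of the scan, kept in a bundle of registers, and each step of the median program is simulated by
boundedly many steps (`Exec.sim`). Numbers stay small because the ends of the interval are the
initial ones or intersections of two input lines; they are never computed from earlier ends. -/

namespace TreeCenter

/-! ## Running programs -/

section Runs

variable {P : Type*} {Q : Type}

/-- From `s` the program `c` halts within `k` steps in a store satisfying `post`. -/
def Runs (ask : Q → Store P → Store P) (W : Store P → Prop) (c : Prog Q) (k : ℕ) (s : Store P)
    (post : Store P → Prop) : Prop :=
  ∃ t s', Exec ask W c s t s' ∧ t ≤ k ∧ post s'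

variable {ask : Q → Store P → Store P} {W : Store P → Prop} {c d : Prog Q} {k l : ℕ}
  {s : Store P} {p q : Store P → Prop}

theorem Exec.words {s s' : Store P} {t : ℕ} (h : Exec ask W c s t s') (hs : W s) : W s' := by
  induction h with
  | skip => exact hs
  | instr _ _ h => exact h
  | seq _ _ ih₁ ih₂ => exact ih₂ (ih₁ hs)
  | iteTrue _ _ ih => exact ih hs
  | iteFalse _ _ ih => exact ih hs
  | loopFalse => exact hs
  | loopTrue _ _ _ ih₁ ih₂ => exact ih₂ (ih₁ hs)

theorem Runs.mono (h : Runs ask W c k s p) (hk : k ≤ l) (hpq : ∀ s', p s' → q s') :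
    Runs ask W c l s q := by
  obtain ⟨t, s', h₁, h₂, h₃⟩ := h
  exact ⟨t, s', h₁, h₂.trans hk, hpq _ h₃⟩

theorem Runs.words (h : Runs ask W c k s p) (hs : W s) :
    Runs ask W c k s fun s' => W s' ∧ p s' := by
  obtain ⟨t, s', h₁, h₂, h₃⟩ := h
  exact ⟨t, s', h₁, h₂, h₁.words hs, h₃⟩

theorem Runs.seq (h : Runs ask W c k s fun s' => Runs ask W d l s' p) :
    Runs ask W (.seq c d) (k + l) s p := by
  obtain ⟨t, s', h₁, h₂, t', s'', h₃, h₄, h₅⟩ := h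
  exact ⟨_, s'', .seq h₁ h₃, by omega, h₅⟩

theorem Runs.ite {b : Test} (h₁ : b.Holds s → Runs ask W c k s p)
    (h₂ : ¬ b.Holds s → Runs ask W d k s p) : Runs ask W (.ite b c d) (k + 1) s p := by
  by_cases hb : b.Holds s
  · obtain ⟨t, s', h₁, h₂, h₃⟩ := h₁ hb
    exact ⟨_, s', .iteTrue hb h₁, by omega, h₃⟩
  · obtain ⟨t, s', h₁, h₂, h₃⟩ := h₂ hb
    exact ⟨_, s', .iteFalse hb h₁, by omega, h₃⟩

/-- A loop with an invariant `inv j`, where `j` bounds the number of iterations to come. -/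
theorem Runs.loop {b : Test} (inv : ℕ → Store P → Prop)
    (h : ∀ j s, inv j s → b.Holds s → Runs ask W c k s fun s' => ∃ i, j = i + 1 ∧ inv i s') :
    ∀ (j : ℕ) (s : Store P), inv j s →
      Runs ask W (.loop b c) (j * (k + 1) + 1) s fun s' => (∃ i, inv i s') ∧ ¬ b.Holds s' := by
  intro j
  induction j with
  | zero =>
    intro s hs
    by_cases hb : b.Holds s
    -- With no iterations left the guard must fail: the body would have to produce `0 = i + 1`.
    · obtain ⟨_, _, _, _, i, hi, -⟩ := h _ _ hs hb
      omega
    · exact ⟨1, s, .loopFalse hb, by omega, ⟨_, hs⟩, hb⟩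
  | succ j ih =>
    intro s hs
    by_cases hb : b.Holds s
    · obtain ⟨t, s', h₁, h₂, i, hi, h₃⟩ := h _ _ hs hb
      obtain rfl : j = i := by omega
      obtain ⟨t', s'', h₄, h₅, h₆⟩ := ih s' h₃
      refine ⟨_, s'', .loopTrue hb h₁ h₄, ?_, h₆⟩
      rw [Nat.succ_mul]
      omega
    · exact ⟨1, s, .loopFalse hb, by omega, ⟨_, hs⟩, hb⟩

end Runs

/-! ## Sizes of numbers -/

theorem FitsIn.mono {B C : ℕ} {x : ℝ} (h : FitsIn B x) (hBC : B ≤ C) : FitsIn C x := by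
  obtain ⟨a, b, h₁, h₂, h₃, h₄⟩ := h
  exact ⟨a, b, h₁, h₂.trans hBC, h₃.trans (by exact_mod_cast hBC), h₄⟩

theorem FitsIn.nat {B k : ℕ} (hB : 0 < B) (h : k ≤ B) : FitsIn B k :=
  ⟨k, 1, one_pos, hB, by simpa using h, by simp⟩

theorem FitsIn.add {B C : ℕ} {x y : ℝ} (hx : FitsIn B x) (hy : FitsIn C y) :
    FitsIn (2 * (B * C)) (x + y) := by
  obtain ⟨a, b, h₁, h₂, h₃, rfl⟩ := hx
  obtain ⟨a', b', h₁', h₂', h₃', rfl⟩ := hy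
  refine ⟨a * b' + a' * b, b * b', Nat.mul_pos h₁ h₁', ?_, ?_, ?_⟩
  · have := Nat.mul_le_mul h₂ h₂'
    omega
  · have e₁ : |a * b'| ≤ (B * C : ℤ) := by
      rw [abs_mul, Nat.abs_cast]
      exact mul_le_mul h₃ (by exact_mod_cast h₂') (by positivity) (by positivity)
    have e₂ : |a' * b| ≤ (B * C : ℤ) := by
      rw [abs_mul, Nat.abs_cast, mul_comm]
      exact mul_le_mul (by exact_mod_cast h₂) h₃' (by positivity) (by positivity)
    have := abs_add_le (a * b') (a' * b)
    push_cast
    linarith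
  · have : (b : ℝ) ≠ 0 := by positivity
    have : (b' : ℝ) ≠ 0 := by positivity
    push_cast
    field_simp

theorem FitsIn.neg {B : ℕ} {x : ℝ} (hx : FitsIn B x) : FitsIn B (-x) := by
  obtain ⟨a, b, h₁, h₂, h₃, rfl⟩ := hx
  exact ⟨-a, b, h₁, h₂, by rwa [abs_neg], by push_cast; ring⟩

theorem FitsIn.mul {B C : ℕ} {x y : ℝ} (hx : FitsIn B x) (hy : FitsIn C y) :
    FitsIn (B * C) (x * y) := by
  obtain ⟨a, b, h₁, h₂, h₃, rfl⟩ := hx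
  obtain ⟨a', b', h₁', h₂', h₃', rfl⟩ := hy
  refine ⟨a * a', b * b', Nat.mul_pos h₁ h₁', Nat.mul_le_mul h₂ h₂', ?_, ?_⟩
  · rw [abs_mul]
    push_cast
    exact mul_le_mul h₃ h₃' (by positivity) (by positivity)
  · push_cast
    rw [div_mul_div_comm]

theorem FitsIn.inv {B : ℕ} {x : ℝ} (hx : FitsIn B x) : FitsIn B x⁻¹ := by
  obtain ⟨a, b, h₁, h₂, h₃, rfl⟩ := hx
  -- Denominators are natural numbers, so the sign of `a` has to move to the new numerator; for `a =
  -- 0` the convention `0⁻¹ = 0` helps.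
  rcases lt_trichotomy a 0 with h | rfl | h
  · rw [abs_of_neg h] at h₃
    refine ⟨-b, a.natAbs, by omega, by omega, by simpa using h₂, ?_⟩
    rw [inv_div, Nat.cast_natAbs, abs_of_neg h]
    push_cast
    rw [neg_div_neg_eq]
  · exact ⟨0, 1, one_pos, h₁.trans_le h₂, by simp, by simp⟩
  · rw [abs_of_pos h] at h₃
    refine ⟨b, a.natAbs, by omega, by omega, by simpa using h₂, ?_⟩
    rw [inv_div, Nat.cast_natAbs, abs_of_pos h]
    push_cast
    rfl

/-! ### Heights as powers of `n + B + 1`, uniformly in the input bound `B` -/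

section Fit

variable {V : Type*} [Fintype V] (T : TreeNetwork V)

/-- Whenever the input numbers are naturals `≤ B`, the number `x` has height at most
`(n + B + 1) ^ k`. -/
def Fit (k : ℕ) (x : ℝ) : Prop :=
  ∀ B : ℕ, (∀ v, ∃ k : ℕ, k ≤ B ∧ T.weight v = k) →
    (∀ e ∈ T.graph.edgeSet, ∃ k : ℕ, k ≤ B ∧ T.length e = k) →
      FitsIn ((Fintype.card V + B + 1) ^ k) x

theorem TreeNetwork.card_pos (T : TreeNetwork V) : 0 < Fintype.card V :=
  Fintype.card_pos_iff.2 ⟨T.root⟩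

variable {T} {k l : ℕ} {x y : ℝ}

theorem Fit.mono (h : Fit T k x) (hkl : k ≤ l) : Fit T l x := fun B h₁ h₂ =>
  (h B h₁ h₂).mono (Nat.pow_le_pow_right (by omega) hkl)

/-- The base `n + B + 1` is only known to be at least `2`, which limits the constants that fit with
exponent `1`. -/
theorem Fit.natCast {m : ℕ} (h : m ≤ 2) (hk : 1 ≤ k) : Fit T k m := by
  intro B _ _
  have := T.card_pos
  have h₂ : Fintype.card V + B + 1 ≤ (Fintype.card V + B + 1) ^ k :=
    Nat.le_self_pow (by omega) _
  exact FitsIn.nat (by positivity) (by omega)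

theorem Fit.zero : Fit T k 0 := fun B _ _ => ⟨0, 1, one_pos, Nat.one_le_pow _ _ (by omega),
  by simpa using pow_nonneg (by positivity) _, by simp⟩

/-- The additional `1` in the exponent pays for the factor `2` of `FitsIn.add`; the base is at least
`2` because the tree has a root. -/
theorem Fit.add (hx : Fit T k x) (hy : Fit T l y) : Fit T (k + l + 1) (x + y) := by
  intro B h₁ h₂
  refine ((hx B h₁ h₂).add (hy B h₁ h₂)).mono ?_
  have := T.card_pos
  rw [pow_succ, pow_add, mul_comm]
  exact Nat.mul_le_mul_left _ (by omega)

theorem Fit.sub (hx : Fit T k x) (hy : Fit T l y) : Fit T (k + l + 1) (x - y) := by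
  rw [sub_eq_add_neg]
  exact hx.add fun B h₁ h₂ => (hy B h₁ h₂).neg

theorem Fit.mul (hx : Fit T k x) (hy : Fit T l y) : Fit T (k + l) (x * y) := by
  intro B h₁ h₂
  rw [pow_add]
  exact (hx B h₁ h₂).mul (hy B h₁ h₂)

theorem Fit.inv (hx : Fit T k x) : Fit T k x⁻¹ := fun B h₁ h₂ => (hx B h₁ h₂).inv

theorem Fit.div (hx : Fit T k x) (hy : Fit T l y) : Fit T (k + l) (x / y) := by
  rw [div_eq_mul_inv]
  exact hx.mul hy.inv

theorem Fit.weight (v : V) (hk : 1 ≤ k) : Fit T k (T.weight v) := by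
  refine Fit.mono (k := 1) (fun B h₁ _ => ?_) hk
  obtain ⟨m, hm, e⟩ := h₁ v
  rw [e]
  exact FitsIn.nat (by positivity) (by rw [pow_one]; omega)

theorem Fit.parentLength (v : V) (hk : 1 ≤ k) : Fit T k (T.parentLength v) := by
  refine Fit.mono (k := 1) (fun B _ h₂ => ?_) hk
  unfold TreeNetwork.parentLength
  cases h : T.parent v with
  | none => exact Fit.zero (T := T) B ‹_› h₂
  | some u =>
    obtain ⟨m, hm, e⟩ := h₂ s(v, u) ((T.parent_eq_some_iff v u).1 h).1
    simp only [Option.elim, e]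
    exact FitsIn.nat (by positivity) (by rw [pow_one]; omega)

/-- Sufficient condition for an instruction to respect the word size `K`. -/
def Instr.Ok (T : TreeNetwork V) (K : ℕ) : Instr TreeQuery → Store V → Prop
  | .ctrConst _ k, _ => k ≤ (Fintype.card V + 1) ^ K
  | .ctrCopy _ _, _ => True
  | .ctrArith op _ j k, s => op.onCtr (s.ctr j) (s.ctr k) ≤ (Fintype.card V + 1) ^ K
  | .ptrNull _, _ => True
  | .ptrCopy _ _, _ => True
  | .valConst _ k, _ => Fit T K k
  | .valCopy _ _, _ => True
  | .valArith op _ j k, s => Fit T K (op.onVal (s.val j) (s.val k))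
  | .query _, _ => True

variable {K : ℕ} {s : Store V}

theorem TreeWords.setCtr (h : TreeWords T K s) {i k : ℕ} (hk : k ≤ (Fintype.card V + 1) ^ K) :
    TreeWords T K (s.setCtr i k) := by
  refine ⟨fun j => ?_, h.2⟩
  by_cases hj : j = i
  · simpa [Store.setCtr, hj] using hk
  · simpa [Store.setCtr, hj] using h.1 j

theorem TreeWords.setPtr (h : TreeWords T K s) (i : ℕ) (q : Option V) :
    TreeWords T K (s.setPtr i q) := h

theorem TreeWords.setVal (h : TreeWords T K s) {i : ℕ} (hk : Fit T K x) :
    TreeWords T K (s.setVal i x) := by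
  refine ⟨h.1, fun B h₁ h₂ j => ?_⟩
  by_cases hj : j = i
  · simpa [Store.setVal, hj] using hk B h₁ h₂
  · simpa [Store.setVal, hj] using h.2 B h₁ h₂ j

theorem TreeWords.fit (h : TreeWords T K s) (i : ℕ) : Fit T K (s.val i) :=
  fun B h₁ h₂ => h.2 B h₁ h₂ i

theorem TreeWords.init : TreeWords T K Store.init :=
  ⟨fun _ => Nat.zero_le _, fun B h₁ h₂ _ => Fit.zero (T := T) B h₁ h₂⟩

theorem Instr.Ok.words [DecidableEq V] (hK : 1 ≤ K) (a : Instr TreeQuery) (s : Store V)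
    (h : TreeWords T K s) (ha : a.Ok T K s) : TreeWords T K (a.run (TreeQuery.ask T) s) := by
  cases a with
  | ctrConst i k => exact h.setCtr ha
  | ctrCopy i j => exact h.setCtr (h.1 j)
  | ctrArith op i j k => exact h.setCtr ha
  | ptrNull i => exact h.setPtr _ _
  | ptrCopy i j => exact h.setPtr _ _
  | valConst i k => exact h.setVal ha
  | valCopy i j => exact h.setVal (h.fit j)
  | valArith op i j k => exact h.setVal ha
  | query q =>
    cases q with
    | root i => exact h.setPtr _ _
    | parent i j => exact h.setPtr _ _
    | firstChild i j => exact h.setPtr _ _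
    | nextChild i j k => exact h.setPtr _ _
    | weight i j =>
      refine h.setVal ?_
      cases s.ptr j with
      | none => exact Fit.zero
      | some v => exact Fit.weight v hK
    | parentLength i j =>
      refine h.setVal ?_
      cases s.ptr j with
      | none => exact Fit.zero
      | some v => exact Fit.parentLength v hK

/-- Access to the meaning of `Fit` once it has been made irreducible. -/
theorem fit_def (x : ℝ) (k : ℕ) : Fit T k x ↔
    ∀ B : ℕ, (∀ v, ∃ k : ℕ, k ≤ B ∧ T.weight v = k) →
      (∀ e ∈ T.graph.edgeSet, ∃ k : ℕ, k ≤ B ∧ T.length e = k) →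
        FitsIn ((Fintype.card V + B + 1) ^ k) x := Iff.rfl

/-! ## Programs without loops -/

/-- A bound for the running time of a program without loops. -/
def Prog.size {Q : Type} : Prog Q → ℕ
  | .skip => 0
  | .instr _ => 1
  | .seq c d => c.size + d.size
  | .ite _ c d => max c.size d.size + 1
  | .loop _ _ => 0

/-- Precondition under which a program without loops respects the word size `K` and establishes
the postcondition `p`. -/
def Prog.wp [DecidableEq V] (T : TreeNetwork V) (K : ℕ) :
    Prog TreeQuery → (Store V → Prop) → Store V → Prop
  | .skip, p, s => p s
  | .instr a, p, s => a.Ok T K s ∧ p (a.run (TreeQuery.ask T) s)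
  | .seq c d, p, s => c.wp T K (d.wp T K p) s
  | .ite b c d, p, s => (b.Holds s → c.wp T K p s) ∧ (¬ b.Holds s → d.wp T K p s)
  | .loop _ _, _, _ => False

theorem Prog.wp_mono [DecidableEq V] {c : Prog TreeQuery} {p q : Store V → Prop}
    (h : c.wp T K p s) (hpq : ∀ s', p s' → q s') : c.wp T K q s := by
  induction c generalizing s p q with
  | skip => exact hpq _ h
  | instr a => exact ⟨h.1, hpq _ h.2⟩
  | seq c d ihc ihd => exact ihc h fun s' h' => ihd h' hpq
  | ite b c d ihc ihd => exact ⟨fun hb => ihc (h.1 hb) hpq, fun hb => ihd (h.2 hb) hpq⟩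
  | loop b c => exact h.elim

/-- Loop-free code is handled by symbolic evaluation: its effect is a condition on the initial store
and its running time is read off from the text. -/
theorem Prog.wp_runs [DecidableEq V] {c : Prog TreeQuery} {p : Store V → Prop} (hK : 1 ≤ K)
    (hs : TreeWords T K s) (h : c.wp T K p s) :
    Runs (TreeQuery.ask T) (TreeWords T K) c c.size s p := by
  induction c generalizing s p with
  | skip => exact ⟨0, s, .skip s, le_rfl, h⟩
  | instr a => exact ⟨1, _, .instr a s (h.1.words hK a s hs), le_rfl, h.2⟩
  | seq c d ihc ihd =>
    exact Runs.seq (((ihc hs h).words hs).mono le_rfl fun s' h' => ihd h'.1 h'.2)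
  | ite b c d ihc ihd =>
    exact Runs.ite (fun hb => (ihc hs (h.1 hb)).mono (le_max_left _ _) fun _ => id)
      fun hb => (ihd hs (h.2 hb)).mono (le_max_right _ _) fun _ => id
  | loop b c => exact h.elim

attribute [irreducible] Fit

end Fit

/-- For similarities satisfying the ultrametric inequality, the two smallest of the three sums of
opposite pairs among four points agree. -/
theorem min_add_le_of_ultrametric {xy zw xz yw xw yz : ℝ}
    (h₁ : xz ≤ xy ∨ yz ≤ xy) (h₂ : xw ≤ xy ∨ yw ≤ xy) (h₃ : xz ≤ zw ∨ xw ≤ zw)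
    (h₄ : yz ≤ zw ∨ yw ≤ zw) :
    min (xz + yw) (xw + yz) ≤ xy + zw := by
  by_contra! h
  obtain ⟨ha, hb⟩ := lt_min_iff.1 h
  -- In most cases two of the chosen inequalities bound one of the two sums; otherwise the four
  -- together bound the total of both sums by `2 * (xy + zw)`.
  rcases h₁ with h₁ | h₁ <;> rcases h₃ with h₃ | h₃ <;> rcases h₄ with h₄ | h₄ <;>
    rcases h₂ with h₂ | h₂ <;> linarith

namespace TreeNetwork

variable {V : Type*} (T : TreeNetwork V)

/-! ## Ancestors -/

theorem adj_of_parent {u v : V} (h : T.parent u = some v) : T.graph.Adj u v :=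
  ((T.parent_eq_some_iff u v).1 h).1

theorem dist_of_parent {u v : V} (h : T.parent u = some v) :
    T.graph.dist T.root u = T.graph.dist T.root v + 1 :=
  ((T.parent_eq_some_iff u v).1 h).2

theorem parent_root : T.parent T.root = none := by
  cases h : T.parent T.root with
  | none => rfl
  | some v => simpa using T.dist_of_parent h

theorem parent_or_parent {u v : V} (h : T.graph.Adj u v) :
    T.parent u = some v ∨ T.parent v = some u := by
  rw [T.parent_eq_some_iff, T.parent_eq_some_iff]
  rcases T.isTree.dist_eq_dist_add_one_of_adj T.root h with h' | h'
  · exact .inl ⟨h, h'⟩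
  · exact .inr ⟨h.symm, h'⟩

/-- The first step of a shortest walk to the root leads to the parent: a step to a child would
increase the distance to the root. -/
theorem exists_parent {u : V} (hu : u ≠ T.root) : ∃ v, T.parent u = some v := by
  obtain ⟨p, hp⟩ := T.isTree.connected.exists_walk_length_eq_dist u T.root
  cases p with
  | nil => exact (hu rfl).elim
  | @cons _ v _ h p =>
    rcases T.parent_or_parent h with h' | h'
    · exact ⟨v, h'⟩
    · have h₁ := T.dist_of_parent h'
      have h₂ := T.graph.dist_le p
      rw [SimpleGraph.Walk.length_cons] at hp
      rw [T.graph.dist_comm (u := T.root), T.graph.dist_comm (u := T.root)] at h₁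
      omega

theorem parent_eq_none {u : V} : T.parent u = none ↔ u = T.root := by
  refine ⟨fun h => ?_, fun h => h ▸ T.parent_root⟩
  by_contra hu
  obtain ⟨v, hv⟩ := T.exists_parent hu
  rw [h] at hv
  cases hv

theorem parentLength_root : T.parentLength T.root = 0 := by
  simp [parentLength, T.parent_root]

theorem parentLength_eq {u v : V} (h : T.parent u = some v) :
    T.parentLength u = T.length s(u, v) := by
  simp [parentLength, h]

theorem parentLength_pos {u v : V} (h : T.parent u = some v) : 0 < T.parentLength u := by
  rw [T.parentLength_eq h]
  exact T.length_pos _ (T.adj_of_parent h)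

theorem parentLength_nonneg (u : V) : 0 ≤ T.parentLength u := by
  cases h : T.parent u with
  | none => simp [parentLength, h]
  | some v => exact (T.parentLength_pos h).le

/-- `c` is `z` or an ancestor of `z`. -/
def Anc (c z : V) : Prop := Relation.ReflTransGen (fun x y => T.parent x = some y) z c

variable {T}

theorem Anc.refl (z : V) : T.Anc z z := Relation.ReflTransGen.refl

theorem Anc.trans {a b c : V} (h₁ : T.Anc a b) (h₂ : T.Anc b c) : T.Anc a c :=
  Relation.ReflTransGen.trans h₂ h₁

theorem Anc.of_parent {u v : V} (h : T.parent u = some v) : T.Anc v u :=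
  Relation.ReflTransGen.single h

theorem anc_iff_of_parent {c x y : V} (h : T.parent x = some y) :
    T.Anc c x ↔ c = x ∨ T.Anc c y := by
  refine ⟨fun hc => ?_, ?_⟩
  · rcases Relation.ReflTransGen.cases_head hc with rfl | ⟨y', h', hc⟩
    · exact .inl rfl
    · rw [h] at h'
      obtain rfl : y = y' := by simpa using h'
      exact .inr hc
  · rintro (rfl | hc)
    · exact Anc.refl _
    · exact hc.trans (Anc.of_parent h)

theorem anc_root_iff {c : V} : T.Anc c T.root ↔ c = T.root := by
  refine ⟨fun hc => ?_, fun h => h ▸ Anc.refl _⟩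
  rcases Relation.ReflTransGen.cases_head hc with h | ⟨y', h', -⟩
  · exact h.symm
  · rw [T.parent_root] at h'
    cases h'

theorem Anc.dist_le {c z : V} (h : T.Anc c z) :
    T.graph.dist T.root c ≤ T.graph.dist T.root z := by
  induction h with
  | refl => exact le_rfl
  | tail _ h ih =>
    have := T.dist_of_parent h
    omega

theorem Anc.eq_or_dist_lt {c z : V} (h : T.Anc c z) :
    c = z ∨ T.graph.dist T.root c < T.graph.dist T.root z := by
  rcases Relation.ReflTransGen.cases_head h with h | ⟨y', h', h⟩
  · exact .inl h.symm
  · have := T.dist_of_parent h'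
    have := Anc.dist_le h
    omega

theorem Anc.antisymm {c z : V} (h : T.Anc c z) (h' : T.Anc z c) : c = z := by
  rcases h.eq_or_dist_lt with h | h
  · exact h
  · have := h'.dist_le
    omega

theorem not_anc_of_parent {u v : V} (h : T.parent u = some v) : ¬ T.Anc u v := by
  intro h'
  have := h'.dist_le
  have := T.dist_of_parent h
  omega

theorem Anc.total {a b z : V} (ha : T.Anc a z) (hb : T.Anc b z) : T.Anc a b ∨ T.Anc b a := by
  have hu : Relator.RightUnique fun x y => T.parent x = some y := fun _ _ _ h₁ h₂ =>
    Option.some_injective _ (h₁.symm.trans h₂)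
  exact (Relation.ReflTransGen.total_of_right_unique hu ha hb).symm

theorem root_anc (z : V) : T.Anc T.root z := by
  induction hk : T.graph.dist T.root z using Nat.strong_induction_on generalizing z with
  | _ k ih =>
    by_cases hz : z = T.root
    · exact hz ▸ Anc.refl _
    · obtain ⟨v, hv⟩ := T.exists_parent hz
      have := T.dist_of_parent hv
      exact (ih _ (by omega) v rfl).trans (Anc.of_parent hv)

/-- The child of `a` on the way to a proper descendant. -/
theorem Anc.exists_child {a z : V} (h : T.Anc a z) (hne : a ≠ z) :
    ∃ c, T.parent c = some a ∧ T.Anc c z := by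
  rcases Relation.ReflTransGen.cases_tail h with h | ⟨c, h₁, h₂⟩
  · exact (hne h).elim
  · exact ⟨c, h₂, h₁⟩

/-- Total length of the edges from the vertices of `S` to their parents. -/
noncomputable def mass (T : TreeNetwork V) (S : Finset V) : ℝ := ∑ c ∈ S, T.parentLength c

theorem mass_mono {S S' : Finset V} (h : S ⊆ S') : T.mass S ≤ T.mass S' :=
  Finset.sum_le_sum_of_subset_of_nonneg h fun c _ _ => T.parentLength_nonneg c

theorem vdist_of_isPath {u v : V} (p : T.graph.Walk u v) (hp : p.IsPath) :
    T.vdist u v = (p.edges.map T.length).sum := by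
  have h := T.isTree.existsUnique_path u v
  rw [vdist, h.unique h.choose_spec.1 hp]

/-- The only edge between the subtree of `x` and its complement is the one above `x`, and it ends in
`x`. -/
theorem anc_of_walk_avoiding {x u v : V} (p : T.graph.Walk u v) (hx : x ∉ p.support) :
    T.Anc x u ↔ T.Anc x v := by
  induction p with
  | nil => exact Iff.rfl
  | @cons u w v h p ih =>
    simp only [SimpleGraph.Walk.support_cons, List.mem_cons, not_or] at hx
    rw [← ih hx.2]
    have hw : x ≠ w := fun e => hx.2 (e ▸ p.start_mem_support)
    rcases T.parent_or_parent h with h | h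
    · simp [anc_iff_of_parent h, hx.1]
    · simp [anc_iff_of_parent h, hw]

/-- The only exit from the subtree of `x` leads to `y`. In `vdist_eq` this shows that a path that
has started with a step down stays below. -/
theorem anc_of_walk_avoiding_parent {x y u v : V} (h : T.parent x = some y)
    (p : T.graph.Walk u v) (hy : y ∉ p.support) (hu : T.Anc x u) : T.Anc x v := by
  induction p with
  | nil => exact hu
  | @cons u w v h' p ih =>
    simp only [SimpleGraph.Walk.support_cons, List.mem_cons, not_or] at hy
    refine ih hy.2 ?_
    rcases T.parent_or_parent h' with h' | h'
    · rcases (anc_iff_of_parent h').1 hu with rfl | h''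
      · rw [h] at h'
        obtain rfl : y = w := by simpa using h'
        exact (hy.2 p.start_mem_support).elim
      · exact h''
    · exact hu.trans (Anc.of_parent h')

theorem Point.isCenter_of_weight_eq_zero (h : ∀ z, T.weight z = 0) (q : T.Point) :
    q.IsCenter := by
  intro q'
  simp [Point.cost, h]

/-! ### Depths, common parts of root paths, and the tree metric -/

section Metric

variable [Fintype V]

open Classical in
/-- The ancestors of `z`, including `z`. -/
noncomputable def ancs (T : TreeNetwork V) (z : V) : Finset V := {c | T.Anc c z}

theorem mem_ancs {c z : V} : c ∈ T.ancs z ↔ T.Anc c z := by simp [ancs]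

open Classical in
theorem ancs_of_parent {x y : V} (h : T.parent x = some y) : T.ancs x = insert x (T.ancs y) := by
  ext c
  simp [mem_ancs, anc_iff_of_parent h]

theorem notMem_ancs_of_parent {x y : V} (h : T.parent x = some y) : x ∉ T.ancs y := by
  rw [mem_ancs]
  exact not_anc_of_parent h

theorem ancs_root : T.ancs T.root = {T.root} := by
  ext c
  simp [mem_ancs, anc_root_iff]

theorem mass_ancs_root : T.mass (T.ancs T.root) = 0 := by
  simp [ancs_root, mass, T.parentLength_root]

theorem mass_ancs_of_parent {x y : V} (h : T.parent x = some y) :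
    T.mass (T.ancs x) = T.parentLength x + T.mass (T.ancs y) := by
  classical
  rw [ancs_of_parent h, mass, Finset.sum_insert (notMem_ancs_of_parent h), mass]

theorem card_ancs_of_parent {x y : V} (h : T.parent x = some y) :
    (T.ancs x).card = (T.ancs y).card + 1 := by
  classical
  rw [ancs_of_parent h, Finset.card_insert_of_notMem (notMem_ancs_of_parent h)]

open Classical in
/-- Total length of the path from the root that is common to the ways to `u` and `v`. -/
noncomputable def common (T : TreeNetwork V) (u v : V) : ℝ := T.mass (T.ancs u ∩ T.ancs v)

theorem common_comm (u v : V) : T.common u v = T.common v u := by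
  classical
  rw [common, common, Finset.inter_comm]

theorem common_self (u : V) : T.common u u = T.mass (T.ancs u) := by
  classical
  rw [common, Finset.inter_self]

theorem common_le_left (u v : V) : T.common u v ≤ T.mass (T.ancs u) := by
  classical
  exact mass_mono Finset.inter_subset_left

theorem mass_ancs_le_common {x u v : V} (hu : T.Anc x u) (hv : T.Anc x v) :
    T.mass (T.ancs x) ≤ T.common u v := by
  classical
  refine mass_mono fun c hc => ?_
  rw [mem_ancs] at hc
  rw [Finset.mem_inter, mem_ancs, mem_ancs]
  exact ⟨hc.trans hu, hc.trans hv⟩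

theorem common_of_anc {x z : V} (h : T.Anc x z) : T.common x z = T.mass (T.ancs x) := by
  classical
  rw [common, Finset.inter_eq_left.2]
  intro c hc
  rw [mem_ancs] at *
  exact hc.trans h

theorem common_of_parent {x y z : V} (h : T.parent x = some y) (hz : ¬ T.Anc x z) :
    T.common x z = T.common y z := by
  classical
  rw [common, ancs_of_parent h, Finset.insert_inter_of_notMem (by rwa [mem_ancs]), common]

/-- An ancestor of `p` is comparable with `y`; if it were below `y` and also above `q`, then `y`
would be above `q`. -/
theorem common_eq_of_separates {p q y : V} (hp : T.Anc y p) (hq : ¬ T.Anc y q) :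
    T.common p q = T.common y q := by
  classical
  rw [common, common]
  congr 1
  ext c
  simp only [Finset.mem_inter, mem_ancs]
  refine ⟨fun ⟨h₁, h₂⟩ => ⟨?_, h₂⟩, fun ⟨h₁, h₂⟩ => ⟨h₁.trans hp, h₂⟩⟩
  rcases h₁.total hp with h | h
  · exact h
  · exact (hq (h.trans h₂)).elim

/-- The ancestors of `z` form a chain. If a common ancestor `c` of `x` and `z` is not above `y`,
then every common ancestor of `y` and `z` is above `c`, hence above `x`. -/
theorem common_ultrametric (x y z : V) :
    T.common x z ≤ T.common x y ∨ T.common y z ≤ T.common x y := by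
  classical
  by_cases h : ∀ c, T.Anc c x → T.Anc c z → T.Anc c y
  · refine .inl (mass_mono fun c => ?_)
    simp only [Finset.mem_inter, mem_ancs]
    exact fun ⟨h₁, h₂⟩ => ⟨h₁, h c h₁ h₂⟩
  · push Not at h
    obtain ⟨c, h₁, h₂, h₃⟩ := h
    refine .inr (mass_mono fun e => ?_)
    simp only [Finset.mem_inter, mem_ancs]
    intro ⟨h₄, h₅⟩
    refine ⟨?_, h₄⟩
    rcases h₂.total h₅ with h | h
    · exact (h₃ (h.trans h₄)).elim
    · exact h.trans h₁

/-! ## Distances -/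

/-- Induction along the path. If the first edge goes up, only the depth of `u` changes; if it goes
down, the rest of the path stays in the subtree entered. The metric facts below are read off from
this formula. -/
theorem vdist_eq (u v : V) :
    T.vdist u v = T.mass (T.ancs u) + T.mass (T.ancs v) - 2 * T.common u v := by
  obtain ⟨p, hp, -⟩ := T.isTree.existsUnique_path u v
  rw [vdist_of_isPath p hp]
  induction p with
  | nil =>
    simp only [SimpleGraph.Walk.edges_nil, List.map_nil, List.sum_nil, common_self]
    ring
  | @cons u w v h p ih =>
    rw [SimpleGraph.Walk.cons_isPath_iff] at hp
    rw [SimpleGraph.Walk.edges_cons, List.map_cons, List.sum_cons, ih hp.1]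
    have hav := T.anc_of_walk_avoiding p hp.2
    rcases T.parent_or_parent h with h | h
    · have hv : ¬ T.Anc u v := by
        rw [← hav]
        exact not_anc_of_parent h
      rw [← T.parentLength_eq h, mass_ancs_of_parent h, common_of_parent h hv]
      ring
    · have hw := anc_of_walk_avoiding_parent h p hp.2 (Anc.refl w)
      rw [Sym2.eq_swap, ← T.parentLength_eq h, common_of_anc hw,
        common_of_anc ((Anc.of_parent h).trans hw), mass_ancs_of_parent h]
      ring

theorem vdist_self (u : V) : T.vdist u u = 0 := by
  rw [vdist_eq, common_self]
  ring

theorem vdist_comm (u v : V) : T.vdist u v = T.vdist v u := by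
  rw [vdist_eq, vdist_eq, common_comm]
  ring

/-- In each of the three sums of opposite distances the depths contribute the same, so the claim is
the ultrametric statement for `common` with the sign reversed. -/
theorem vdist_four_point (x y z w : V) :
    T.vdist x y + T.vdist z w ≤
      max (T.vdist x z + T.vdist y w) (T.vdist x w + T.vdist y z) := by
  have h := min_add_le_of_ultrametric (common_ultrametric (T := T) x y z)
    (by simpa only [common_comm y w] using common_ultrametric (T := T) x y w)
    (by simpa only [common_comm z x, common_comm w x] using common_ultrametric (T := T) z w x)
    (by simpa only [common_comm z y, common_comm w y] using common_ultrametric (T := T) z w y)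
  simp only [vdist_eq]
  rw [common_comm w y] at h
  rcases min_le_iff.1 h with h | h
  · exact le_max_of_le_left (by linarith)
  · exact le_max_of_le_right (by linarith)

theorem vdist_triangle (x y z : V) : T.vdist x y ≤ T.vdist x z + T.vdist z y := by
  have h := vdist_four_point (T := T) x y z z
  rw [vdist_self, max_self, vdist_comm y z] at h
  linarith

theorem vdist_nonneg (u v : V) : 0 ≤ T.vdist u v := by
  have h₁ := common_le_left (T := T) u v
  have h₂ := common_le_left (T := T) v u
  rw [common_comm] at h₂
  rw [vdist_eq]
  linarith

theorem vdist_parent_of_anc {x y z : V} (h : T.parent x = some y) (hz : T.Anc x z) :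
    T.vdist y z = T.parentLength x + T.vdist x z := by
  rw [vdist_eq, vdist_eq, common_of_anc hz, common_of_anc ((Anc.of_parent h).trans hz),
    mass_ancs_of_parent h]
  ring

theorem vdist_of_not_anc {x y z : V} (h : T.parent x = some y) (hz : ¬ T.Anc x z) :
    T.vdist x z = T.parentLength x + T.vdist y z := by
  rw [vdist_eq, vdist_eq, common_of_parent h hz, mass_ancs_of_parent h]
  ring

/-- The subtree of `y` can be left only through `y`. -/
theorem vdist_eq_of_separates {p q y : V} (hp : T.Anc y p) (hq : ¬ T.Anc y q) :
    T.vdist p q = T.vdist p y + T.vdist y q := by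
  rw [vdist_eq p q, vdist_eq p y, vdist_eq y q, common_eq_of_separates hp hq, common_comm p y,
    common_of_anc hp]
  ring

theorem vdist_eq_of_anc {y p : V} (h : T.Anc y p) :
    T.vdist p y = T.mass (T.ancs p) - T.mass (T.ancs y) := by
  rw [vdist_eq, common_comm, common_of_anc h]
  ring

theorem vdist_root (v : V) : T.vdist T.root v = T.mass (T.ancs v) := by
  rw [vdist_eq, common_of_anc (T.root_anc v), mass_ancs_root]
  ring

theorem vdist_of_adj {u v : V} (h : T.graph.Adj u v) : T.vdist u v = T.length s(u, v) := by
  rcases T.parent_or_parent h with h | h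
  · rw [vdist_of_not_anc h (not_anc_of_parent h), vdist_self, T.parentLength_eq h, add_zero]
  · rw [vdist_comm, vdist_of_not_anc h (not_anc_of_parent h), vdist_self, T.parentLength_eq h,
      Sym2.eq_swap, add_zero]

/-- If `u` is farthest from `a` and `v` is farthest from `u`, distances being corrected by
`c`, then `u, v` is a farthest pair. -/
theorem farthest_pair {S : Set V} {c : V → ℝ} {a u v : V} (hv : v ∈ S)
    (h₁ : ∀ z ∈ S, T.vdist a z - c z ≤ T.vdist a u - c u)
    (h₂ : ∀ z ∈ S, T.vdist u z - c z ≤ T.vdist u v - c v) {x y : V} (hx : x ∈ S) (hy : y ∈ S) :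
    T.vdist x y - c x - c y ≤ T.vdist u v - c u - c v := by
  -- The four point condition for `v, z, a, u` shows that, seen from `v`, nothing is farther than
  -- `u`.
  have h₃ : ∀ z ∈ S, T.vdist v z - c z ≤ T.vdist u v - c u := by
    intro z hz
    have e₁ := h₁ z hz
    have e₂ := h₁ v hv
    have e₃ := h₂ z hz
    rcases le_max_iff.1 (vdist_four_point (T := T) v z a u) with h | h
    · rw [vdist_comm v a, vdist_comm z u] at h
      linarith
    · rw [vdist_comm v u, vdist_comm z a] at h
      linarith
  have e₁ := h₂ x hx
  have e₂ := h₂ y hy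
  have e₃ := h₃ x hx
  have e₄ := h₃ y hy
  have e₅ := vdist_comm (T := T) x u
  have e₆ := vdist_comm (T := T) y u
  have e₇ := vdist_comm (T := T) x v
  have e₈ := vdist_comm (T := T) y v
  rcases le_max_iff.1 (vdist_four_point (T := T) x y u v) with h | h <;> linarith

/-! ## Points -/

/-- If `u` and `v` are reached through different ends of the edge, the two pieces add up to its
length; if through the same end, the triangle inequality at that end suffices. -/
theorem Point.vdist_le (q : T.Point) (u v : V) : T.vdist u v ≤ q.distTo u + q.distTo v := by
  cases q with
  | vertex y =>
    have := vdist_triangle (T := T) u v y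
    rwa [vdist_comm u y] at this
  | onEdge a b h x h₀ h₁ =>
    have e := vdist_of_adj h
    have e₁ := vdist_triangle (T := T) u v a
    have e₂ := vdist_triangle (T := T) u v b
    have e₃ := vdist_triangle (T := T) a v b
    have e₄ := vdist_triangle (T := T) a u b
    rw [vdist_comm u a] at *
    rw [vdist_comm u b] at *
    simp only [Point.distTo]
    rcases min_cases (x + T.vdist a u) (T.length s(a, b) - x + T.vdist b u) with h | h <;>
      rcases min_cases (x + T.vdist a v) (T.length s(a, b) - x + T.vdist b v) with h' | h' <;>
      rw [h.1, h'.1] <;> linarith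

theorem Point.le_cost (q : T.Point) (z : V) : T.weight z * q.distTo z ≤ q.cost :=
  le_ciSup (f := fun z => T.weight z * q.distTo z) (Set.finite_range _).bddAbove z

/-- A lower bound for the costs of all points. -/
theorem Point.isCenter_of_pair {q : T.Point} {lam : ℝ} {u v : V} (hu : 0 < T.weight u)
    (hv : 0 < T.weight v) (huv : T.vdist u v = lam * ((T.weight u)⁻¹ + (T.weight v)⁻¹))
    (hq : ∀ z, T.weight z * q.distTo z ≤ lam) : q.IsCenter := by
  intro q'
  have : Nonempty V := ⟨T.root⟩
  refine (ciSup_le hq).trans ?_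
  have h₁ := q'.le_cost u
  have h₂ := q'.le_cost v
  have h₃ : q'.distTo u ≤ q'.cost * (T.weight u)⁻¹ := by
    rw [← div_eq_mul_inv, le_div_iff₀ hu]
    linarith
  have h₄ : q'.distTo v ≤ q'.cost * (T.weight v)⁻¹ := by
    rw [← div_eq_mul_inv, le_div_iff₀ hv]
    linarith
  have h₅ := q'.vdist_le u v
  have h₆ : 0 < (T.weight u)⁻¹ + (T.weight v)⁻¹ := by positivity
  by_contra! h
  have := mul_lt_mul_of_pos_right h h₆
  linarith

/-- The point at distance `x` above `y` on the path from `u` to `v` is close to every `z` that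
is not too far from both `u` and `v`. -/
theorem min_vdist_le_of_path {u v y p z : V} {x b : ℝ} (hp : T.parent y = some p)
    (hu : T.Anc y u) (hv : ¬ T.Anc y v)
    (h₁ : T.vdist u z ≤ b + (T.vdist u y + x))
    (h₂ : T.vdist v z ≤ b + (T.vdist u v - (T.vdist u y + x))) :
    min (x + T.vdist y z) (T.length s(y, p) - x + T.vdist p z) ≤ b := by
  have e := vdist_eq_of_separates hu hv
  by_cases hz : T.Anc y z
  · have e₁ := vdist_eq_of_separates hz hv
    rw [vdist_comm z v, vdist_comm z y] at e₁
    exact min_le_of_left_le (by linarith)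
  · have e₁ := vdist_eq_of_separates hu hz
    have e₂ := vdist_of_not_anc hp hz
    rw [T.parentLength_eq hp] at e₂
    exact min_le_of_right_le (by linarith)

/-- The four point condition for `u, v, y, z`: one of the two alternatives is bounded by `h₁`, the
other by `h₂`. -/
theorem vdist_le_of_path {u v y z : V} {b : ℝ} (hy : T.vdist u v = T.vdist u y + T.vdist y v)
    (h₁ : T.vdist u z ≤ b + T.vdist u y)
    (h₂ : T.vdist v z ≤ b + (T.vdist u v - T.vdist u y)) : T.vdist y z ≤ b := by
  have e := vdist_comm (T := T) v y
  rcases le_max_iff.1 (vdist_four_point (T := T) u v y z) with h | h <;> linarith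

end Metric

end TreeNetwork

/-! ## Tours -/

/-- State of a traversal of the tree that starts at some vertex: the current vertex `x`, the
highest vertex `a` reached so far, the child `b` of `a` whose subtree is finished, a flag that is
`0` when `x` is entered and `1` when `x` is left, and the distance `D` from the start to `x`. -/
@[ext] structure Tour (V : Type*) where
  x : Option V
  a : Option V
  b : Option V
  fl : ℕ
  D : ℝ

namespace TreeNetwork

variable {V : Type*} [DecidableEq V] (T : TreeNetwork V)

/-- Null arguments are treated exactly as in the answers to queries, so that the abstract tour and
its code agree step by step. -/
def nextOf (u v : Option V) : Option V := u.bind fun u => v.bind fun v => T.nextChild u v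

noncomputable def lengthOf (u : Option V) : ℝ := u.elim 0 T.parentLength

end TreeNetwork

namespace Tour

variable {V : Type*}

/-- The start of the tour from `v`. -/
def start (v : Option V) : Tour V := ⟨v, v, none, 0, 0⟩

variable [DecidableEq V] (T : TreeNetwork V)

/-- Enter the child `c` of `q` (the next one if `c` is to be skipped), or leave `q` if there is
none. -/
noncomputable def goTo (t : Tour V) (q c : Option V) : Tour V :=
  let c' := if c = t.b then T.nextOf q t.b else c
  if c' = none then ⟨q, t.a, t.b, 1, t.D⟩ else ⟨c', t.a, t.b, 0, t.D + T.lengthOf c'⟩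

/-- The next state of a tour. -/
noncomputable def adv (t : Tour V) : Tour V :=
  if t.fl = 0 then t.goTo T t.x (t.x.bind T.firstChild)
  else if t.x = t.a then ⟨t.x.bind T.parent, t.x.bind T.parent, t.x, 0, t.D + T.lengthOf t.x⟩
  else goTo T ⟨t.x, t.a, t.b, t.fl, t.D - T.lengthOf t.x⟩ (t.x.bind T.parent)
    (T.nextOf (t.x.bind T.parent) t.x)

end Tour

/-! ### Lists of children -/

namespace TreeNetwork

variable {V : Type*} {T : TreeNetwork V}

theorem children_eq_of_firstChild {u c : V} (h : T.firstChild u = some c) :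
    T.parent c = some u := by
  rw [← T.mem_children_iff]
  exact List.mem_of_mem_head? h

variable [DecidableEq V]

theorem nextChild_eq {u c : V} {l l' : List V} (h : T.children u = l ++ c :: l') :
    T.nextChild u c = l'.head? := by
  have hn := T.children_nodup u
  rw [h] at hn
  have hc : c ∉ l := fun hc => (List.nodup_append.1 hn).2.2 c hc c (by simp) rfl
  rw [nextChild, h, List.idxOf_append_of_notMem hc, List.idxOf_cons_self]
  simp [List.head?_eq_getElem?, List.getElem?_append_right]

theorem parent_of_nextChild {u v c : V} (h : T.nextChild u v = some c) : T.parent c = some u := by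
  rw [← T.mem_children_iff]
  exact List.mem_of_getElem? h

/-- Since children are listed without repetition, one application of `nextChild` is enough to get
past the child that is to be skipped. -/
theorem nextChild_ne {u v : V} : T.nextChild u v ≠ some v := by
  intro h
  have hv : v ∈ T.children u := List.mem_of_getElem? h
  have h' : (T.children u)[(T.children u).idxOf v]? = some v := by
    rw [List.getElem?_eq_getElem (List.idxOf_lt_length_iff.2 hv), List.getElem_idxOf]
  have := List.getElem?_inj (List.idxOf_lt_length_iff.2 hv) (T.children_nodup u) |>.1 (h'.trans h.symm)
  omega

end TreeNetwork

/-! ### The invariant of a tour and the uniqueness of its states -/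

namespace Tour

open TreeNetwork

variable {V : Type*} {T : TreeNetwork V}

/-- The part of the invariant of a tour from `v` that does not involve the flag. -/
structure Valid (T : TreeNetwork V) (v : V) (b : Option V) (a x : V) : Prop where
  anc_start : T.Anc a v
  anc : T.Anc a x
  skip : (b = none ∧ a = v) ∨
    ∃ b', b = some b' ∧ T.parent b' = some a ∧ T.Anc b' v ∧ ¬ T.Anc b' x

/-- The invariant of a tour from `v`. -/
def Inv (T : TreeNetwork V) (v : V) (t : Tour V) : Prop :=
  ∃ x a, t.x = some x ∧ t.a = some a ∧ (t.fl = 0 ∨ t.fl = 1) ∧ t.D = T.vdist v x ∧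
    Valid T v t.b a x

/-- A vertex between `a` and `v` other than `a` lies below the child of `a` towards `v`. That child
is the finished one, `b`; if there is no `b`, then `a = v`. -/
theorem Valid.eq_top {v a x y : V} {b : Option V} (h : Valid T v b a x) (hy : T.Anc y v)
    (hay : T.Anc a y) (hb : ∀ b', b = some b' → ¬ T.Anc b' y) : y = a := by
  by_contra hne
  obtain ⟨e, he, hey⟩ := hay.exists_child (Ne.symm hne)
  rcases h.skip with ⟨-, rfl⟩ | ⟨b', hb', hp, hbv, -⟩
  · exact hne (hy.antisymm hay)
  · have hev := hey.trans hy
    have : e = b' := by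
      rcases hev.total hbv with h' | h'
      · rcases (anc_iff_of_parent hp).1 h' with h'' | h''
        · exact h''
        · exact (not_anc_of_parent he h'').elim
      · rcases (anc_iff_of_parent he).1 h' with h'' | h''
        · exact h''.symm
        · exact (not_anc_of_parent hp h'').elim
    exact hb b' hb' (this ▸ hey)

/-- Two candidates are comparable, both being above `x`. The lower one is above `x` and therefore
not in the finished subtree of the other, so `Valid.eq_top` identifies them. -/
theorem Valid.top_unique {v a a' x : V} {b b' : Option V} (h : Valid T v b a x)
    (h' : Valid T v b' a' x) : a = a' := by
  have key : ∀ {a a' : V} {b b' : Option V}, Valid T v b a x → Valid T v b' a' x →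
      T.Anc a a' → a = a' := by
    intro a a' b b' h h' haa
    refine (h.eq_top h'.anc_start haa fun e he hea => ?_).symm
    rcases h.skip with ⟨hb, -⟩ | ⟨e', he', -, -, hx⟩
    · rw [hb] at he
      cases he
    · obtain rfl : e = e' := by
        rw [he'] at he
        simpa using he.symm
      exact hx (hea.trans h'.anc)
  rcases h.anc.total h'.anc with haa | haa
  · exact key h h' haa
  · exact (key h' h haa).symm

theorem Valid.skip_unique {v a x : V} {b b' : Option V} (h : Valid T v b a x)
    (h' : Valid T v b' a x) : b = b' := by
  rcases h.skip with ⟨hb, rfl⟩ | ⟨e, he, hp, hv, -⟩ <;>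
    rcases h'.skip with ⟨hb', ha'⟩ | ⟨e', he', hp', hv', -⟩
  · rw [hb, hb']
  · exact (not_anc_of_parent hp' hv').elim
  · exact (not_anc_of_parent hp (ha' ▸ hv)).elim
  · rw [he, he']
    congr 1
    rcases hv.total hv' with h' | h'
    · rcases (anc_iff_of_parent hp').1 h' with h'' | h''
      · exact h''
      · exact (not_anc_of_parent hp h'').elim
    · rcases (anc_iff_of_parent hp).1 h' with h'' | h''
      · exact h''.symm
      · exact (not_anc_of_parent hp' h'').elim

/-- Vertex and flag determine the whole state. Hence a state with the same vertex and flag as an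
earlier one would start a cycle, which gives the exact length of a tour. -/
theorem Inv.eq {v : V} {t t' : Tour V} (h : Inv T v t) (h' : Inv T v t') (hx : t.x = t'.x)
    (hf : t.fl = t'.fl) : t = t' := by
  obtain ⟨x, a, h₁, h₂, -, h₃, h₄⟩ := h
  obtain ⟨x', a', h₁', h₂', -, h₃', h₄'⟩ := h'
  obtain rfl : x = x' := by
    rw [h₁, h₁'] at hx
    simpa using hx
  obtain rfl := h₄.top_unique h₄'
  ext1
  · exact hx
  · rw [h₂, h₂']
  · exact h₄.skip_unique h₄'
  · exact hf
  · rw [h₃, h₃']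

variable [Fintype V] [DecidableEq V]

omit [DecidableEq V] in
theorem Inv.start (v : V) : Inv T v (Tour.start (some v)) :=
  ⟨v, v, rfl, rfl, .inl rfl, (vdist_self v).symm, Anc.refl v, Anc.refl v, .inl ⟨rfl, rfl⟩⟩

/-- The child that is entered is not the finished one, so by `Valid.eq_top` it is not above `v`. The
step leads away from `v`, and the length of the edge has to be added. -/
theorem Valid.inv_goTo {v a x : V} {t : Tour V} (h : Valid T v t.b a x) (ha : t.a = some a)
    (hD : t.D = T.vdist v x) {c : Option V} (hc : ∀ c', c = some c' → T.parent c' = some x) :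
    Inv T v (t.goTo T (some x) c) := by
  set c' := if c = t.b then T.nextOf (some x) t.b else c with hc'
  have h₁ : ∀ e, c' = some e → T.parent e = some x := by
    intro e he
    rw [hc'] at he
    split_ifs at he
    · cases hb : t.b with
      | none => simp [hb, nextOf] at he
      | some b =>
        rw [hb] at he
        exact parent_of_nextChild he
    · exact hc e he
  have h₂ : ∀ e, c' = some e → t.b ≠ some e := by
    intro e he hb
    rw [hc'] at he
    split_ifs at he with h'
    · rw [hb] at he
      exact nextChild_ne he
    · rw [he] at h'
      exact h' hb.symm
  have e : t.goTo T (some x) c = if c' = none then ⟨some x, t.a, t.b, 1, t.D⟩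
      else ⟨c', t.a, t.b, 0, t.D + T.lengthOf c'⟩ := rfl
  rw [e]
  cases hcc : c' with
  | none => exact ⟨x, a, rfl, ha, .inr rfl, hD, h⟩
  | some e =>
    have hp := h₁ e hcc
    have hb : ∀ b', t.b = some b' → ¬ T.Anc b' e := by
      intro b' hb' hbe
      rcases (anc_iff_of_parent hp).1 hbe with rfl | hbx
      · exact h₂ _ hcc hb'
      · rcases h.skip with ⟨hb, -⟩ | ⟨b'', hb'', -, -, hx⟩
        · rw [hb] at hb'
          cases hb'
        · rw [hb''] at hb'
          obtain rfl : b'' = b' := by simpa using hb'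
          exact hx hbx
    have hv : ¬ T.Anc e v := fun hev => by
      have := h.eq_top hev (h.anc.trans (Anc.of_parent hp)) hb
      exact not_anc_of_parent hp (this ▸ h.anc)
    refine ⟨e, a, rfl, ha, .inl rfl, ?_, h.anc_start, h.anc.trans (Anc.of_parent hp), ?_⟩
    · simp only [reduceCtorEq, if_false, hD, lengthOf, Option.elim]
      rw [vdist_comm v e, vdist_of_not_anc hp hv, vdist_comm]
      ring
    · rcases h.skip with h' | ⟨b', h₃, h₄, h₅, -⟩
      · exact .inl h'
      · exact .inr ⟨b', h₃, h₄, h₅, hb b' h₃⟩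

/-- Steps to a child and from the top `a` to its parent lead away from `v`. Every other step to a
parent leads back towards `v`, because the vertex left is not above `v`. The null state arises only
above the root. -/
theorem Inv.adv {v : V} {t : Tour V} (h : Inv T v t) :
    Inv T v (t.adv T) ∨ (t.adv T).x = none := by
  obtain ⟨x, a, hx, ha, hf, hD, hV⟩ := h
  by_cases h0 : t.fl = 0
  · left
    rw [Tour.adv, if_pos h0, hx]
    exact hV.inv_goTo ha hD fun c hc => children_eq_of_firstChild hc
  by_cases hxa : x = a
  · subst hxa
    rw [Tour.adv, if_neg h0, hx, ha, if_pos rfl]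
    cases hp : T.parent x with
    | none => exact .inr (by simp [hp])
    | some p =>
      left
      refine ⟨p, p, hp, hp, .inl rfl, ?_, (Anc.of_parent hp).trans hV.anc_start, Anc.refl p,
        .inr ⟨x, rfl, hp, hV.anc_start, not_anc_of_parent hp⟩⟩
      simp only [hD, lengthOf, Option.elim]
      rw [vdist_comm v p, vdist_parent_of_anc hp hV.anc_start, vdist_comm]
      ring
  · left
    have hxr : x ≠ T.root := by
      rintro rfl
      exact hxa (anc_root_iff.1 hV.anc).symm
    obtain ⟨p, hp⟩ := T.exists_parent hxr
    have hb : ∀ b', t.b = some b' → ¬ T.Anc b' x := by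
      intro b' hb'
      rcases hV.skip with ⟨hb, -⟩ | ⟨b'', hb'', -, -, hx⟩
      · rw [hb] at hb'
        cases hb'
      · rw [hb''] at hb'
        obtain rfl : b'' = b' := by simpa using hb'
        exact hx
    have hv : ¬ T.Anc x v := fun hxv => hxa (hV.eq_top hxv hV.anc hb)
    have hap : T.Anc a p := by
      rcases (anc_iff_of_parent hp).1 hV.anc with h | h
      · exact (hxa h.symm).elim
      · exact h
    rw [Tour.adv, if_neg h0, hx, ha, if_neg (by simpa using hxa), Option.bind_some, hp]
    refine Valid.inv_goTo (a := a) ⟨hV.anc_start, hap, ?_⟩ rfl ?_ fun c hc => ?_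
    · rcases hV.skip with h' | ⟨b', h₃, h₄, h₅, h₆⟩
      · exact .inl h'
      · exact .inr ⟨b', h₃, h₄, h₅, fun hh => h₆ (hh.trans (Anc.of_parent hp))⟩
    · simp only [hD, lengthOf, Option.elim]
      rw [vdist_comm v x, vdist_of_not_anc hp hv, vdist_comm]
      ring
    · exact parent_of_nextChild hc

omit [Fintype V] in
theorem x_eq_none_iterate {t : Tour V} (h : t.x = none) (k : ℕ) : ((Tour.adv T)^[k] t).x = none := by
  induction k generalizing t with
  | zero => exact h
  | succ k ih =>
    rw [Function.iterate_succ_apply]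
    apply ih
    simp only [Tour.adv, goTo, h, nextOf, Option.bind_none]
    split_ifs <;> simp_all

omit [Fintype V] in
/-- The tour leads from `t` to `t'`, entering and leaving on the way all vertices in `S`. -/
def Covers (T : TreeNetwork V) (t t' : Tour V) (S : V → Prop) : Prop :=
  ∃ k, (Tour.adv T)^[k] t = t' ∧ ∀ z, S z → ∀ f, f = 0 ∨ f = 1 →
    ∃ i ≤ k, ((Tour.adv T)^[i] t).x = some z ∧ ((Tour.adv T)^[i] t).fl = f

end Tour

/-! ### Every vertex is entered and left exactly once -/

namespace Tour

open TreeNetwork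

variable {V : Type*} {T : TreeNetwork V} [DecidableEq V]

theorem Covers.trans {t t' t'' : Tour V} {S S' : V → Prop} (h : Covers T t t' S)
    (h' : Covers T t' t'' S') : Covers T t t'' fun z => S z ∨ S' z := by
  obtain ⟨k, hk, hS⟩ := h
  obtain ⟨k', hk', hS'⟩ := h'
  refine ⟨k' + k, by rw [Function.iterate_add_apply, hk, hk'], ?_⟩
  rintro z (hz | hz) f hf
  · obtain ⟨i, hi, h⟩ := hS z hz f hf
    exact ⟨i, by omega, h⟩
  · obtain ⟨i, hi, h⟩ := hS' z hz f hf
    exact ⟨i + k, by omega, by rwa [Function.iterate_add_apply, hk]⟩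

theorem Covers.mono {t t' : Tour V} {S S' : V → Prop} (h : Covers T t t' S)
    (hS : ∀ z, S' z → S z) : Covers T t t' S' := by
  obtain ⟨k, hk, h⟩ := h
  exact ⟨k, hk, fun z hz => h z (hS z hz)⟩

theorem Covers.adv (t : Tour V) : Covers T t (t.adv T) fun _ => False :=
  ⟨1, rfl, fun _ h => h.elim⟩

/-- Induction on the children still to be visited. `goTo` serves both for entering the first child
and for passing to the next one, so one statement covers both. The condition `a ≠ some c` ensures
that leaving `c` is not mistaken for leaving the top. -/
theorem covers_goTo {x : V} {a b : Option V}
    (ih : ∀ c, T.parent c = some x → some c ≠ b → a ≠ some c ∧ ∀ D,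
      Covers T ⟨some c, a, b, 0, D⟩ ⟨some c, a, b, 1, D⟩
        fun z => T.Anc c z ∧ ∀ b', b = some b' → ¬ T.Anc b' z) (l : List V) :
    ∀ (l' : List V) (_ : T.children x = l' ++ l) (y : Option V) (f : ℕ) (D : ℝ),
      Covers T (goTo T ⟨y, a, b, f, D⟩ (some x) l.head?) ⟨some x, a, b, 1, D⟩
        fun z => (∃ c ∈ l, T.Anc c z) ∧ ∀ b', b = some b' → ¬ T.Anc b' z := by
  induction l with
  | nil =>
    intro l' _ y f D
    refine ⟨0, ?_, by simp⟩
    cases b <;> simp [goTo, nextOf]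
  | cons c l ihl =>
    intro l' hl y f D
    have hn := nextChild_eq hl
    have hl' : T.children x = (l' ++ [c]) ++ l := by simp [hl]
    by_cases hc : some c = b
    · have hne : l.head? ≠ b := by
        rw [← hc, ← hn]
        exact nextChild_ne
      have e : goTo T ⟨y, a, b, f, D⟩ (some x) (c :: l).head? =
          goTo T ⟨y, a, b, f, D⟩ (some x) l.head? := by
        simp only [goTo, List.head?_cons, if_neg hne]
        simp only [← hc, nextOf, Option.bind_some, hn, if_true]
      rw [e]
      refine (ihl _ hl' y f D).mono ?_
      rintro z ⟨⟨c', hc', hz⟩, hb⟩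
      rcases List.mem_cons.1 hc' with rfl | hc'
      · exact (hb _ hc.symm hz).elim
      · exact ⟨⟨c', hc', hz⟩, hb⟩
    · have hp : T.parent c = some x := by
        rw [← T.mem_children_iff, hl]
        simp
      obtain ⟨ha, hcov⟩ := ih c hp hc
      have e₁ : goTo T ⟨y, a, b, f, D⟩ (some x) (c :: l).head? =
          ⟨some c, a, b, 0, D + T.parentLength c⟩ := by
        simp [goTo, hc, lengthOf]
      have e₂ : Tour.adv T ⟨some c, a, b, 1, D + T.parentLength c⟩ =
          goTo T ⟨some c, a, b, 1, D⟩ (some x) l.head? := by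
        rw [Tour.adv, if_neg (by simp), if_neg (by simpa using Ne.symm ha)]
        simp [hp, nextOf, hn, lengthOf]
      have h₁ := (hcov (D + T.parentLength c)).trans (Covers.adv _)
      rw [e₂] at h₁
      rw [e₁]
      refine (h₁.trans (ihl _ hl' _ _ _)).mono ?_
      rintro z ⟨⟨c', hc', hz⟩, hb⟩
      rcases List.mem_cons.1 hc' with rfl | hc'
      · exact .inl (.inl ⟨hz, hb⟩)
      · exact .inr ⟨⟨c', hc', hz⟩, hb⟩

variable [Fintype V]

/-- Induction on the number of descendants. By `hb` a skipped vertex in this subtree can only be a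
child of `x`, so the subtrees of the children that are entered contain none. -/
theorem covers_subtree (x : V) (a b : Option V) (D : ℝ)
    (ha : ∀ c, T.Anc x c → c ≠ x → a ≠ some c)
    (hb : ∀ c, T.Anc x c → b = some c → T.parent c = some x) :
    Covers T ⟨some x, a, b, 0, D⟩ ⟨some x, a, b, 1, D⟩
      fun z => T.Anc x z ∧ ∀ b', b = some b' → ¬ T.Anc b' z := by
  classical
  induction hk : ({c | T.Anc x c} : Finset V).card using Nat.strong_induction_on
    generalizing x D with
  | _ k ih =>
    have key := covers_goTo (T := T) (x := x) (a := a) (b := b) (fun c hc hcb =>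
      ⟨ha c (Anc.of_parent hc) fun e => not_anc_of_parent hc (e ▸ Anc.refl c), fun D =>
        ih _ ?_ c D (fun e he hec => ha e ((Anc.of_parent hc).trans he) fun hex =>
          not_anc_of_parent hc (hex ▸ he)) (fun e he hbe => ?_) rfl⟩) _ [] rfl (some x) 0 D
    · have e : Tour.adv T ⟨some x, a, b, 0, D⟩ =
          goTo T ⟨some x, a, b, 0, D⟩ (some x) (T.children x).head? := rfl
      rw [← e] at key
      obtain ⟨m, hm, hS⟩ := (Covers.adv _).trans key
      refine ⟨m, hm, ?_⟩
      rintro z ⟨hz, hzb⟩ f hf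
      by_cases hzx : x = z
      · subst hzx
        rcases hf with rfl | rfl
        · exact ⟨0, by omega, rfl, rfl⟩
        · exact ⟨m, le_rfl, by rw [hm], by rw [hm]⟩
      · obtain ⟨c, hc, hcz⟩ := hz.exists_child hzx
        exact hS z (.inr ⟨⟨c, (T.mem_children_iff c x).2 hc, hcz⟩, hzb⟩) f hf
    · rw [← hk]
      refine Finset.card_lt_card (Finset.ssubset_iff_of_subset ?_ |>.2 ⟨x, ?_, ?_⟩)
      · intro e
        simp only [Finset.mem_filter, Finset.mem_univ, true_and]
        exact fun h => (Anc.of_parent hc).trans h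
      · simpa using Anc.refl x
      · simpa using not_anc_of_parent hc
    · have h₁ := hb e ((Anc.of_parent hc).trans he) hbe
      rcases (anc_iff_of_parent h₁).1 he with rfl | h₂
      · exact (hcb hbe.symm).elim
      · exact (not_anc_of_parent hc h₂).elim

/-- Induction along the root path of `v`: the subtree of a parent is the finished subtree together
with what is visited when that child is skipped. -/
theorem covers_start {v a : V} (h : T.Anc a v) :
    ∃ b D, Covers T (Tour.start (some v)) ⟨some a, some a, b, 1, D⟩ (T.Anc a) := by
  induction h with
  | refl =>
    refine ⟨none, 0, (covers_subtree v (some v) none 0 (fun c _ hc => ?_) (by simp)).mono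
      fun z hz => ⟨hz, by simp⟩⟩
    simpa using hc.symm
  | @tail x p _ hp ih =>
    obtain ⟨b, D, h⟩ := ih
    have e : Tour.adv T ⟨some x, some x, b, 1, D⟩ =
        ⟨some p, some p, some x, 0, D + T.lengthOf (some x)⟩ := by
      simp [Tour.adv, hp]
    have h₁ := h.trans (Covers.adv _)
    rw [e] at h₁
    refine ⟨some x, D + T.lengthOf (some x), (h₁.trans (covers_subtree p _ _ _ (fun c _ hc => ?_)
      fun c _ hc => ?_)).mono fun z hz => ?_⟩
    · simpa using hc.symm
    · obtain rfl : x = c := by simpa using hc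
      exact hp
    · by_cases hxz : T.Anc x z
      · exact .inl (.inl hxz)
      · exact .inr ⟨hz, by simpa using hxz⟩

/-- The `i`-th state of the tour from `v`. -/
noncomputable def event (T : TreeNetwork V) (v : V) (i : ℕ) : Tour V :=
  (Tour.adv T)^[i] (Tour.start (some v))

omit [Fintype V] in
theorem event_succ (v : V) (i : ℕ) : event T v (i + 1) = (event T v i).adv T :=
  Function.iterate_succ_apply' _ _ _

/-- By `covers_start` at the root, everything has been visited when the root is left, and the next
state is null. Up to then the pairs of vertex and flag are distinct and exhaust `V × Bool`, which
counts the states. -/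
theorem event_spec (T : TreeNetwork V) (v : V) :
    (∀ i < 2 * Fintype.card V, Inv T v (event T v i)) ∧
      (event T v (2 * Fintype.card V)).x = none ∧
      ∀ z f, f = 0 ∨ f = 1 → ∃ i < 2 * Fintype.card V,
        (event T v i).x = some z ∧ (event T v i).fl = f := by
  obtain ⟨b, D, k, hk, hS⟩ := covers_start (T := T) (T.root_anc v)
  change event T v k = _ at hk
  have hne : ∀ i ≤ k, (event T v i).x ≠ none := by
    intro i hi h
    have h' := x_eq_none_iterate (T := T) h (k - i)
    rw [event, ← Function.iterate_add_apply, Nat.sub_add_cancel hi] at h'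
    change (event T v k).x = none at h'
    rw [hk] at h'
    cases h'
  have hI : ∀ i ≤ k, Inv T v (event T v i) := by
    intro i
    induction i with
    | zero => exact fun _ => Inv.start v
    | succ i ih =>
      intro hi
      have h := (ih (by omega)).adv
      rw [← event_succ] at h
      exact h.resolve_right (hne _ hi)
  have hend : (event T v (k + 1)).x = none := by
    rw [event_succ, hk]
    simp [Tour.adv, T.parent_root]
  have hinj : ∀ i j, i < j → j ≤ k → (event T v i).x = (event T v j).x →
      (event T v i).fl = (event T v j).fl → False := by
    intro i j hij hj hx hf
    have h := (hI i (by omega)).eq (hI j hj) hx hf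
    -- If states `i < j` agreed, then so would their successors, and the null state `k + 1` would
    -- already occur at an index at most `k`.
    have h' : event T v ((k + 1 - j) + i) = event T v ((k + 1 - j) + j) := by
      rw [event, Function.iterate_add_apply, event, Function.iterate_add_apply]
      exact congrArg _ h
    rw [Nat.sub_add_cancel (by omega)] at h'
    exact hne _ (by omega) (h' ▸ hend)
  have hcard : k + 1 = 2 * Fintype.card V := by
    let F : Fin (k + 1) → V × Bool := fun i =>
      ((event T v i).x.getD T.root, decide ((event T v i).fl = 0))
    have hF : Function.Bijective F := by
      constructor
      · intro i j hij
        by_contra hne'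
        have hi := hI i (by omega)
        have hj := hI j (by omega)
        obtain ⟨x, -, h₁, -, h₂, -⟩ := hi
        obtain ⟨y, -, h₃, -, h₄, -⟩ := hj
        simp only [F, Prod.mk.injEq, h₁, h₃, Option.getD_some, decide_eq_decide] at hij
        have hf : (event T v i).fl = (event T v j).fl := by omega
        have hx : (event T v i).x = (event T v j).x := by rw [h₁, h₃, hij.1]
        rcases lt_or_gt_of_ne (fun e => hne' (Fin.ext e)) with h | h
        · exact hinj i j h (by omega) hx hf
        · exact hinj j i h (by omega) hx.symm hf.symm
      · rintro ⟨z, f⟩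
        obtain ⟨i, hi, h₁, h₂⟩ := hS z (T.root_anc z) (if f then 0 else 1) (by cases f <;> simp)
        change (event T v i).x = _ at h₁
        change (event T v i).fl = _ at h₂
        refine ⟨⟨i, by omega⟩, ?_⟩
        simp only [F, h₁, h₂]
        cases f <;> simp
    have := Fintype.card_of_bijective hF
    rw [Fintype.card_fin, Fintype.card_prod, Fintype.card_bool] at this
    omega
  refine ⟨fun i hi => hI i (by omega), hcard ▸ hend, fun z f hf => ?_⟩
  obtain ⟨i, hi, h⟩ := hS z (T.root_anc z) f hf
  exact ⟨i, by omega, h⟩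

end Tour

/-! ## Blocks of lines -/

/-- The line `d - k * lam` as a function of `lam`, with a vertex attached to it. -/
structure Item (V : Type*) where
  d : ℝ
  k : ℝ
  x : Option V

def Item.at {V : Type*} (l : Item V) (lam : ℝ) : ℝ := l.d - lam * l.k

/-- Parameters of the block structure: the number of cells, the size of a block, the place where
lines are compared, and the interval of interest. -/
structure Par where
  N : ℕ
  b : ℕ
  k0 : ℝ
  lam : ℝ
  lo : ℝ
  hi : ℝ

/-- State of the scan of a sequence of lines: position in a pair of blocks, number of cells, best
line of the left block, best line of the current block, the next dummy value, the content of the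
last cell. -/
structure Blk (V : Type*) where
  pos : ℕ
  idx : ℕ
  dl : ℝ
  kl : ℝ
  dc : ℝ
  kc : ℝ
  pc : Option V
  dm : ℝ
  out : ℝ

namespace Blk

variable {V : Type*} (P : Par)

/-- The first dummy is the upper end: the median is the lower of two middle elements, so a surplus
dummy must be large. -/
def start (hi : ℝ) : Blk V := ⟨0, 0, 0, 0, 0, 0, none, hi, 0⟩

open Classical in
/-- Process one line. -/
noncomputable def push (c : Blk V) (l : Item V) : Blk V :=
  let c₁ : Blk V := if c.pos = P.b then { c with dl := c.dc, kl := c.kc } else c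
  if c.pos = 0 ∨ c.pos = P.b ∨ c.dc - P.lam * c.kc < l.at P.lam then
    { c₁ with dc := l.d, kc := l.k, pc := l.x, pos := c.pos + 1 }
  else { c₁ with pos := c.pos + 1 }

/-- The intersection of the best lines of the two blocks. -/
noncomputable def cross (c : Blk V) : ℝ := (c.dl - c.dc) / (c.kl - c.kc)

/-- The pair of blocks is complete. -/
def Full (c : Blk V) : Prop := c.pos = 2 * P.b ∨ (c.idx + 1 = P.N ∧ P.b < c.pos)

open Classical in
/-- Finish a cell. -/
noncomputable def emit (c : Blk V) : Blk V :=
  let c₁ : Blk V := { c with idx := c.idx + 1, pos := if c.pos = 2 * P.b then 0 else c.pos }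
  if c.Full P ∧ P.lo < c.cross ∧ c.cross < P.hi then { c₁ with out := c.cross }
  else { c₁ with out := c.dm, dm := if c.dm = P.lo then P.hi else P.lo }

/-- The state in the middle of cell `j`, before it is finished, from the state before it. -/
noncomputable def push₂ (c : Blk V) (L : ℕ → Item V) (j : ℕ) : Blk V :=
  (c.push P (L (2 * j))).push P (L (2 * j + 1))

/-- The state after `j` cells. -/
noncomputable def run (L : ℕ → Item V) : ℕ → Blk V
  | 0 => start P.hi
  | j + 1 => ((run L j).push₂ P L j).emit P

end Blk

/-! ### Lines that are best on a whole interval -/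

section Lines

variable {V : Type*} (L : ℕ → Item V)

/-- Line `i` is the first among the best of the lines `s, …, e - 1` at `lam`. -/
structure BestAt (lam : ℝ) (s e i : ℕ) : Prop where
  le : s ≤ i
  lt : i < e
  best : ∀ i', s ≤ i' → i' < e → (L i').at lam ≤ (L i).at lam
  first : ∀ i', s ≤ i' → i' < i → (L i').at lam < (L i).at lam

/-- Line `i` is best among the lines `s, …, e - 1` on a whole interval. -/
structure Dom (lo hi : ℝ) (s e i : ℕ) : Prop where
  le : s ≤ i
  lt : i < e
  best : ∀ i', s ≤ i' → i' < e → ∀ lam, lo ≤ lam → lam ≤ hi → (L i').at lam ≤ (L i).at lam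

/-- In every block of `b` consecutive lines there is one that is best on a whole interval. -/
def Resolved (n b : ℕ) (lo hi : ℝ) : Prop :=
  ∀ m, m * b < 2 * n → ∃ i, Dom L lo hi (m * b) (min ((m + 1) * b) (2 * n)) i

variable {L}

theorem Dom.mono {lo hi lo' hi' : ℝ} {s e i : ℕ} (h : Dom L lo hi s e i) (h₁ : lo ≤ lo')
    (h₂ : hi' ≤ hi) : Dom L lo' hi' s e i :=
  ⟨h.le, h.lt, fun i' hs he lam hl hh => h.best i' hs he lam (h₁.trans hl) (hh.trans h₂)⟩

theorem Resolved.mono {n b : ℕ} {lo hi lo' hi' : ℝ} (h : Resolved L n b lo hi) (h₁ : lo ≤ lo')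
    (h₂ : hi' ≤ hi) : Resolved L n b lo' hi' := fun m hm =>
  let ⟨i, hi⟩ := h m hm
  ⟨i, hi.mono h₁ h₂⟩

/-- The difference of the two lines is nonnegative at both ends of the interval and vanishes at an
interior point, so it is zero. Thus a line that is best on the whole interval can be found by
evaluation at one interior point. -/
theorem Dom.eq_of_bestAt {lo hi lam : ℝ} {s e i i' : ℕ} (h : Dom L lo hi s e i)
    (h' : BestAt L lam s e i') (h₁ : lo < lam) (h₂ : lam < hi) :
    (L i').d = (L i).d ∧ (L i').k = (L i).k := by
  have e₁ := h.best i' h'.le h'.lt lam h₁.le h₂.le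
  have e₂ := h'.best i h.le h.lt
  have e₃ := h.best i' h'.le h'.lt lo le_rfl (h₁.trans h₂).le
  have e₄ := h.best i' h'.le h'.lt hi (h₁.trans h₂).le le_rfl
  simp only [Item.at] at *
  have hk : (L i').k = (L i).k := by
    refine le_antisymm ?_ ?_
    · by_contra! hlt
      nlinarith
    · by_contra! hlt
      nlinarith
  refine ⟨?_, hk⟩
  rw [hk] at e₁ e₂
  linarith

theorem Dom.of_bestAt {lo hi lam : ℝ} {s e i i' : ℕ} (h : Dom L lo hi s e i)
    (h' : BestAt L lam s e i') (h₁ : lo < lam) (h₂ : lam < hi) : Dom L lo hi s e i' := by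
  obtain ⟨hd, hk⟩ := h.eq_of_bestAt h' h₁ h₂
  refine ⟨h'.le, h'.lt, fun i'' hs he lam' hl hh => ?_⟩
  have := h.best i'' hs he lam' hl hh
  rwa [Item.at, Item.at, hd, hk]

theorem resolved_one (n : ℕ) (lo hi : ℝ) : Resolved L n 1 lo hi := fun m hm =>
  ⟨m, by omega, by omega, fun i' h₁ h₂ lam _ _ => by
    obtain rfl : i' = m := by omega
    exact le_rfl⟩

/-- Two lines that do not cross inside of an interval are comparable on it. -/
theorem comparable_of_cross {d k d' k' lo hi : ℝ}
    (h : ¬ (lo < (d - d') / (k - k') ∧ (d - d') / (k - k') < hi)) :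
    (∀ lam, lo ≤ lam → lam ≤ hi → d' - lam * k' ≤ d - lam * k) ∨
      ∀ lam, lo ≤ lam → lam ≤ hi → d - lam * k ≤ d' - lam * k' := by
  by_cases hk : k - k' = 0
  · obtain rfl : k = k' := by linarith
    rcases le_total d d' with hd | hd
    · exact .inr fun lam _ _ => by linarith
    · exact .inl fun lam _ _ => by linarith
  · set c := (d - d') / (k - k') with hc
    have e : d - d' = c * (k - k') := by
      rw [hc]
      field_simp
    rcases lt_or_gt_of_ne hk with hk | hk <;> rcases le_or_gt c lo with h' | h'
    · exact .inl fun lam h₁ h₂ => by nlinarith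
    · have : hi ≤ c := by
        by_contra! h''
        exact h ⟨h', h''⟩
      exact .inr fun lam h₁ h₂ => by nlinarith
    · exact .inr fun lam h₁ h₂ => by nlinarith
    · have : hi ≤ c := by
        by_contra! h''
        exact h ⟨h', h''⟩
      exact .inl fun lam h₁ h₂ => by nlinarith

end Lines

/-! ### Correctness of the scan -/

namespace Blk

variable {V : Type*} {P : Par} {L : ℕ → Item V}

/-- The invariant inside of a pair of blocks that starts with line `t`. -/
structure Inv (P : Par) (L : ℕ → Item V) (t : ℕ) (c : Blk V) : Prop where
  left : P.b < c.pos → ∃ i, BestAt L P.lam t (t + P.b) i ∧ c.dl = (L i).d ∧ c.kl = (L i).k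
  cur : 0 < c.pos → ∃ i, BestAt L P.lam (if c.pos ≤ P.b then t else t + P.b) (t + c.pos) i ∧
    c.dc = (L i).d ∧ c.kc = (L i).k ∧ c.pc = (L i).x

theorem push_pos (c : Blk V) (l : Item V) : (c.push P l).pos = c.pos + 1 := by
  unfold push
  split_ifs <;> rfl

theorem push_idx (c : Blk V) (l : Item V) : (c.push P l).idx = c.idx := by
  unfold push
  split_ifs <;> rfl

theorem push_dm (c : Blk V) (l : Item V) : (c.push P l).dm = c.dm := by
  unfold push
  split_ifs <;> rfl

theorem push_left (c : Blk V) (l : Item V) :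
    ((c.push P l).dl = if c.pos = P.b then c.dc else c.dl) ∧
      ((c.push P l).kl = if c.pos = P.b then c.kc else c.kl) := by
  unfold push
  split_ifs <;> exact ⟨rfl, rfl⟩

/-- The stored line is replaced at the start of a block or by a strictly better line, so it is
always the first of the best ones. -/
theorem Inv.push {t : ℕ} {c : Blk V} (h : Inv P L t c) (hb : 0 < P.b) :
    Inv P L t (c.push P (L (t + c.pos))) := by
  constructor
  · intro hp
    rw [push_pos] at hp
    rw [(push_left c _).1, (push_left c _).2]
    by_cases hc : c.pos = P.b
    · simp only [if_pos hc]
      obtain ⟨i, hi, h₁, h₂, -⟩ := h.cur (by omega)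
      rw [if_pos hc.le, hc] at hi
      exact ⟨i, hi, h₁, h₂⟩
    · simp only [if_neg hc]
      exact h.left (by omega)
  · intro _
    rw [push_pos]
    by_cases hr : c.pos = 0 ∨ c.pos = P.b ∨ c.dc - P.lam * c.kc < (L (t + c.pos)).at P.lam
    · refine ⟨t + c.pos, ⟨by split_ifs <;> omega, by omega, fun i' h₁ h₂ => ?_,
        fun i' h₁ h₂ => ?_⟩, ?_⟩
      rotate_left 2
      · simp only [Blk.push, if_pos hr]
        exact ⟨by trivial, by trivial, by trivial⟩
      all_goals
        by_cases hi' : i' = t + c.pos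
        · first
          | omega
          | exact hi' ▸ le_rfl
        have hlt : i' < t + c.pos := by omega
        rcases hr with hr | hr | hr
        · split_ifs at h₁ <;> omega
        · rw [if_neg (by omega)] at h₁
          omega
        · by_cases h0 : c.pos = 0
          · split_ifs at h₁ <;> omega
          by_cases hcb : c.pos = P.b
          · rw [if_neg (by omega)] at h₁
            omega
          obtain ⟨i, hi, e₁, e₂, -⟩ := h.cur (by omega)
          have := hi.best i' (by split_ifs at h₁ ⊢ <;> omega) hlt
          rw [e₁, e₂] at hr
          first
          | exact (this.trans_lt hr).le
          | exact this.trans_lt hr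
    · push Not at hr
      obtain ⟨h0, hcb, hle⟩ := hr
      obtain ⟨i, hi, e₁, e₂, e₃⟩ := h.cur (by omega)
      have hs : (if c.pos + 1 ≤ P.b then t else t + P.b) =
          if c.pos ≤ P.b then t else t + P.b := by
        split_ifs <;> omega
      rw [hs]
      refine ⟨i, ⟨hi.le, by have := hi.lt; omega, fun i' h₁ h₂ => ?_, hi.first⟩, ?_⟩
      · by_cases hi' : i' = t + c.pos
        · rw [hi']
          rw [e₁, e₂] at hle
          exact hle
        · exact hi.best i' h₁ (by omega)
      · simp only [Blk.push, h0, hcb, not_lt.2 hle, or_self, if_false]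
        exact ⟨e₁, e₂, e₃⟩

/-- The invariant after `j` cells. -/
structure CellInv (P : Par) (L : ℕ → Item V) (j t : ℕ) (c : Blk V) : Prop extends
    Inv P L t c where
  idx : c.idx = j
  sum : t + c.pos = 2 * j
  lt : c.pos < 2 * P.b
  dvd : 2 * P.b ∣ t

theorem CellInv.push₂ {j t : ℕ} {c : Blk V} (h : CellInv P L j t c) :
    Inv P L t (c.push₂ P L j) := by
  have hb : 0 < P.b := by
    have := h.lt
    omega
  have h₁ := h.toInv.push hb
  rw [h.sum] at h₁
  have h₂ := h₁.push hb
  rwa [push_pos, ← add_assoc, h.sum] at h₂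

theorem push₂_pos (c : Blk V) (j : ℕ) : (c.push₂ P L j).pos = c.pos + 2 := by
  rw [push₂, push_pos, push_pos]

theorem push₂_idx (c : Blk V) (j : ℕ) : (c.push₂ P L j).idx = c.idx := by
  rw [push₂, push_idx, push_idx]

theorem push₂_dm (c : Blk V) (j : ℕ) : (c.push₂ P L j).dm = c.dm := by
  rw [push₂, push_dm, push_dm]

theorem emit_idx (c : Blk V) : (c.emit P).idx = c.idx + 1 := by
  unfold emit
  split_ifs <;> rfl

theorem emit_pos (c : Blk V) : (c.emit P).pos = if c.pos = 2 * P.b then 0 else c.pos := by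
  unfold emit
  split_ifs <;> rfl

theorem emit_lines (c : Blk V) : (c.emit P).dl = c.dl ∧ (c.emit P).kl = c.kl ∧
    (c.emit P).dc = c.dc ∧ (c.emit P).kc = c.kc ∧ (c.emit P).pc = c.pc := by
  unfold emit
  split_ifs <;> exact ⟨rfl, rfl, rfl, rfl, rfl⟩

theorem emit_inside {c : Blk V} (h : c.Full P ∧ P.lo < c.cross ∧ c.cross < P.hi) :
    (c.emit P).out = c.cross ∧ (c.emit P).dm = c.dm := by
  simp only [emit, if_pos h]
  exact ⟨by trivial, by trivial⟩

open Classical in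
theorem emit_outside {c : Blk V} (h : ¬ (c.Full P ∧ P.lo < c.cross ∧ c.cross < P.hi)) :
    (c.emit P).out = c.dm ∧ (c.emit P).dm = if c.dm = P.lo then P.hi else P.lo := by
  simp only [emit, if_neg h]
  exact ⟨by trivial, by trivial⟩

/-- A pair of blocks has `2 * b` lines and a cell takes two, so a complete pair ends at the end of a
cell. No cell has to hold more than one intersection. -/
theorem exists_cellInv (hb : 0 < P.b) (j : ℕ) : ∃ t, CellInv P L j t (run P L j) := by
  induction j with
  | zero =>
    refine ⟨0, ⟨⟨?_, ?_⟩, rfl, rfl, ?_, dvd_zero _⟩⟩ <;> simp [run, start, hb]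
  | succ j ih =>
    obtain ⟨t, h⟩ := ih
    have h₁ := h.push₂
    have hs := h.sum
    have hl := h.lt
    obtain ⟨q, hq⟩ := h.dvd
    have hp := push₂_pos (P := P) (L := L) (run P L j) j
    have hi := push₂_idx (P := P) (L := L) (run P L j) j
    rw [h.idx] at hi
    -- The position is even, as `t` is a multiple of `2 * b` and `t + pos = 2 * j`.
    have hpar : (run P L j).pos + 2 ≤ 2 * P.b := by
      have : 2 * P.b * q = 2 * (P.b * q) := by ring
      omega
    obtain ⟨e₁, e₂, e₃, e₄, e₅⟩ := emit_lines (P := P) ((run P L j).push₂ P L j)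
    by_cases hf : (run P L j).pos + 2 = 2 * P.b
    · have hpos : (run P L (j + 1)).pos = 0 := by
        rw [run, emit_pos, hp, if_pos hf]
      refine ⟨t + 2 * P.b, ⟨⟨?_, ?_⟩, by rw [run, emit_idx, hi], ?_, ?_, ?_⟩⟩
      · omega
      · omega
      · omega
      · omega
      · exact h.dvd.add dvd_rfl
    · have hpos : (run P L (j + 1)).pos = (run P L j).pos + 2 := by
        rw [run, emit_pos, hp, if_neg hf]
      refine ⟨t, ⟨⟨?_, ?_⟩, by rw [run, emit_idx, hi], ?_, ?_, h.dvd⟩⟩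
      · rw [hpos, run, e₁, e₂, ← hp]
        exact h₁.left
      · rw [hpos, run, e₃, e₄, e₅, ← hp]
        exact h₁.cur
      · omega
      · omega

/-- With blocks that are long enough, the scan finds the best line. -/
theorem run_best {n : ℕ} (hn : 0 < n) (hb : P.b = 2 * n) :
    ∃ i, BestAt L P.lam 0 (2 * n) i ∧ (run P L n).dc = (L i).d ∧ (run P L n).kc = (L i).k ∧
      (run P L n).pc = (L i).x := by
  obtain ⟨t, h⟩ := exists_cellInv (P := P) (L := L) (by omega) n
  have hs := h.sum
  obtain rfl : t = 0 := Nat.eq_zero_of_dvd_of_lt h.dvd (by omega)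
  have := h.cur (by omega)
  rwa [if_pos (by omega), hs] at this

theorem run_idx (hb : 0 < P.b) (j : ℕ) : (run P L j).idx = j :=
  let ⟨_, h⟩ := exists_cellInv (P := P) (L := L) hb j
  h.idx

/-! ### The numbers in the cells -/

theorem dm_mem (j : ℕ) : (run P L j).dm = P.lo ∨ (run P L j).dm = P.hi := by
  induction j with
  | zero => exact .inr rfl
  | succ j ih =>
    rw [run]
    by_cases h : ((run P L j).push₂ P L j).Full P ∧ P.lo < ((run P L j).push₂ P L j).cross ∧
        ((run P L j).push₂ P L j).cross < P.hi
    · rwa [(emit_inside h).2, push₂_dm]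
    · rw [(emit_outside h).2]
      split_ifs <;> simp

/-- The content of cell `j` is either the intersection of the best lines of two blocks, inside of
the interval, or an end of the interval. -/
theorem out_cases (j : ℕ) :
    (((run P L j).push₂ P L j).Full P ∧ P.lo < ((run P L j).push₂ P L j).cross ∧
      ((run P L j).push₂ P L j).cross < P.hi ∧
      (run P L (j + 1)).out = ((run P L j).push₂ P L j).cross) ∨
    ¬ (((run P L j).push₂ P L j).Full P ∧ P.lo < ((run P L j).push₂ P L j).cross ∧
      ((run P L j).push₂ P L j).cross < P.hi) ∧
      ((run P L (j + 1)).out = P.lo ∨ (run P L (j + 1)).out = P.hi) := by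
  by_cases h : ((run P L j).push₂ P L j).Full P ∧ P.lo < ((run P L j).push₂ P L j).cross ∧
      ((run P L j).push₂ P L j).cross < P.hi
  · exact .inl ⟨h.1, h.2.1, h.2.2, (emit_inside h).1⟩
  · refine .inr ⟨h, ?_⟩
    rw [run, (emit_outside h).1, push₂_dm]
    exact dm_mem j

/-- The dummies alternate between the ends of the interval. -/
theorem dummies (hlt : P.lo < P.hi) (j : ℕ) :
    (run P L j).dm = P.hi ∧ ((Finset.range j).filter fun i => (run P L (i + 1)).out ≤ P.lo).card =
        ((Finset.range j).filter fun i => P.hi ≤ (run P L (i + 1)).out).card ∨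
      (run P L j).dm = P.lo ∧
        ((Finset.range j).filter fun i => (run P L (i + 1)).out ≤ P.lo).card + 1 =
        ((Finset.range j).filter fun i => P.hi ≤ (run P L (i + 1)).out).card := by
  induction j with
  | zero => exact .inl ⟨rfl, rfl⟩
  | succ j ih =>
    simp only [Finset.range_add_one, Finset.filter_insert]
    by_cases h : ((run P L j).push₂ P L j).Full P ∧ P.lo < ((run P L j).push₂ P L j).cross ∧
        ((run P L j).push₂ P L j).cross < P.hi
    · have h₁ := (emit_inside h).1
      rw [← run] at h₁
      have h₂ := (emit_inside h).2
      rw [← run, push₂_dm] at h₂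
      rwa [h₂, if_neg (by rw [h₁]; exact not_le.2 h.2.1), if_neg (by rw [h₁]; exact not_le.2 h.2.2)]
    · have h₁ := (emit_outside h).1
      rw [← run, push₂_dm] at h₁
      have h₂ := (emit_outside h).2
      rw [← run, push₂_dm] at h₂
      rcases ih with ⟨hd, hc⟩ | ⟨hd, hc⟩
      · rw [hd] at h₁
        rw [hd, if_neg hlt.ne'] at h₂
        rw [h₁, if_neg (not_le.2 hlt), if_pos le_rfl, Finset.card_insert_of_notMem (by simp)]
        exact .inr ⟨h₂, by omega⟩
      · rw [hd] at h₁
        rw [hd, if_pos rfl] at h₂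
        rw [h₁, if_neg (not_le.2 hlt), if_pos le_rfl, Finset.card_insert_of_notMem (by simp)]
        exact .inl ⟨h₂, by omega⟩

/-- There is only one multiple of `b` among the `b` numbers before `e`. This identifies the pair of
blocks that a cell belongs to. -/
theorem eq_of_dvd_of_window {b t t' e : ℕ} (h : b ∣ t) (h' : b ∣ t') (h₁ : t < e)
    (h₂ : e ≤ t + b) (h₁' : t' < e) (h₂' : e ≤ t' + b) : t = t' := by
  obtain ⟨q, rfl⟩ := h
  obtain ⟨q', rfl⟩ := h'
  rcases lt_trichotomy q q' with hlt | rfl | hlt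
  · have := Nat.mul_le_mul_left b (Nat.succ_le_of_lt hlt)
    rw [Nat.mul_succ] at this
    omega
  · rfl
  · have := Nat.mul_le_mul_left b (Nat.succ_le_of_lt hlt)
    rw [Nat.mul_succ] at this
    omega

/-- The blocks that are compared when the pair of blocks is complete in cell `j`. -/
theorem full_blocks {lo hi : ℝ} {j n : ℕ} (hb : 0 < P.b) (hj : j < n) (hN : P.N = n)
    (hres : Resolved L n P.b lo hi) (hfull : ((run P L j).push₂ P L j).Full P)
    (h₁ : lo < P.lam) (h₂ : P.lam < hi) :
    ∃ t i i', 2 * P.b ∣ t ∧ t + P.b < 2 * j + 2 ∧ 2 * j + 2 ≤ t + 2 * P.b ∧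
      Dom L lo hi t (t + P.b) i ∧ Dom L lo hi (t + P.b) (2 * j + 2) i' ∧
      ((run P L j).push₂ P L j).cross = ((L i).d - (L i').d) / ((L i).k - (L i').k) := by
  obtain ⟨t, h⟩ := exists_cellInv (P := P) (L := L) hb j
  have hI := h.push₂
  have hp := push₂_pos (P := P) (L := L) (run P L j) j
  have hs := h.sum
  have hl := h.lt
  obtain ⟨q, hq⟩ := h.dvd
  have e : 2 * P.b * q = 2 * (P.b * q) := by ring
  have hpb : P.b < ((run P L j).push₂ P L j).pos := by
    rcases hfull with h | h <;> omega
  obtain ⟨i, hi, hd, hk⟩ := hI.left hpb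
  obtain ⟨i', hi', hd', hk', -⟩ := hI.cur (by omega)
  rw [if_neg (by omega), hp, ← add_assoc, hs] at hi'
  obtain ⟨m, hm⟩ := hres (2 * q) (by
    have : 2 * q * P.b = 2 * (P.b * q) := by ring
    omega)
  obtain ⟨m', hm'⟩ := hres (2 * q + 1) (by
    have : (2 * q + 1) * P.b = 2 * (P.b * q) + P.b := by ring
    omega)
  have e₁ : 2 * q * P.b = t := by rw [hq]; ring
  have e₂ : (2 * q + 1) * P.b = t + P.b := by rw [hq]; ring
  have e₃ : (2 * q + 1 + 1) * P.b = t + 2 * P.b := by rw [hq]; ring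
  rw [e₁, e₂, min_eq_left (by omega)] at hm
  rw [e₂, e₃] at hm'
  -- Either the pair is complete, or this is the last cell and the second block is cut off at `2 *
  -- n`.
  have e₄ : min (t + 2 * P.b) (2 * n) = 2 * j + 2 := by
    rcases hfull with hfull | ⟨hfull, -⟩
    · omega
    · rw [push₂_idx, h.idx] at hfull
      omega
  rw [e₄] at hm'
  refine ⟨t, m, m', h.dvd, by omega, by omega, hm, hm', ?_⟩
  obtain ⟨f₁, f₂⟩ := hm.eq_of_bestAt hi h₁ h₂
  obtain ⟨f₃, f₄⟩ := hm'.eq_of_bestAt hi' h₁ h₂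
  rw [cross, hd, hk, hd', hk', f₁, f₂, f₃, f₄]

/-- If no intersection is inside of the interval, pairs of blocks can be merged. -/
theorem resolved_double {n : ℕ} (hb : 0 < P.b) (hN : P.N = n)
    (hres : Resolved L n P.b P.lo P.hi) (h₁ : P.lo < P.lam) (h₂ : P.lam < P.hi)
    (hout : ∀ j < n, ¬ (P.lo < (run P L (j + 1)).out ∧ (run P L (j + 1)).out < P.hi)) :
    Resolved L n (2 * P.b) P.lo P.hi := by
  intro m hm
  have e₀ : m * (2 * P.b) = 2 * (m * P.b) := by ring
  have e₁ : (m + 1) * (2 * P.b) = 2 * (m * P.b) + 2 * P.b := by ring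
  have e₂ : (2 * m) * P.b = 2 * (m * P.b) := by ring
  have e₃ : (2 * m + 1) * P.b = 2 * (m * P.b) + P.b := by ring
  rw [e₀] at hm
  rw [e₀, e₁]
  generalize m * P.b = s at *
  -- If the second block of the pair is empty, the merged block is the first one.
  by_cases hs : 2 * n ≤ 2 * s + P.b
  · obtain ⟨i, hi⟩ := hres (2 * m) (by omega)
    rw [e₂, e₃, min_eq_right (by omega)] at hi
    rw [min_eq_right (by omega)]
    exact ⟨i, hi⟩
  -- `j` is the cell in which the pair ends and its intersection is examined.
  · obtain ⟨j, hj⟩ : ∃ j, min (2 * s + 2 * P.b) (2 * n) = 2 * j + 2 := by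
      rcases le_total (2 * s + 2 * P.b) (2 * n) with h | h
      · exact ⟨s + P.b - 1, by omega⟩
      · exact ⟨n - 1, by omega⟩
    rw [hj]
    have hjn : j < n := by omega
    have hfull : ((run P L j).push₂ P L j).Full P := by
      obtain ⟨t, h⟩ := exists_cellInv (P := P) (L := L) hb j
      have hp := push₂_pos (P := P) (L := L) (run P L j) j
      have hs' := h.sum
      have hl := h.lt
      obtain ⟨q, hq⟩ := h.dvd
      have e : 2 * P.b * q = 2 * (P.b * q) := by ring
      have hqm : t = 2 * s := eq_of_dvd_of_window h.dvd ⟨m, by rw [← e₀, mul_comm]⟩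
        (e := 2 * j + 2) (by omega) (by omega) (by omega) (by omega)
      rw [Full, push₂_idx, h.idx, hp]
      omega
    obtain ⟨t, i, i', hdvd, ht₁, ht₂, hi, hi', hc⟩ :=
      full_blocks hb hjn hN hres hfull h₁ h₂
    obtain rfl : t = 2 * s := eq_of_dvd_of_window hdvd ⟨m, by rw [← e₀, mul_comm]⟩ (by omega) ht₂
      (by omega) (by omega)
    have hout' : ¬ (P.lo < ((run P L j).push₂ P L j).cross ∧
        ((run P L j).push₂ P L j).cross < P.hi) := by
      intro h
      have := hout j hjn
      rw [run, (emit_inside ⟨hfull, h⟩).1] at this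
      exact this h
    rw [hc] at hout'
    rcases comparable_of_cross hout' with h | h
    · refine ⟨i, hi.le, by have := hi.lt; omega, fun l h₃ h₄ lam h₅ h₆ => ?_⟩
      by_cases hl : l < 2 * s + P.b
      · exact hi.best l h₃ hl lam h₅ h₆
      · exact (hi'.best l (by omega) h₄ lam h₅ h₆).trans (h lam h₅ h₆)
    · refine ⟨i', by have := hi'.le; omega, hi'.lt, fun l h₃ h₄ lam h₅ h₆ => ?_⟩
      by_cases hl : l < 2 * s + P.b
      · exact (hi.best l h₃ hl lam h₅ h₆).trans (h lam h₅ h₆)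
      · exact hi'.best l (by omega) h₄ lam h₅ h₆

/-- The division into blocks depends neither on the interval nor on the place of comparison. -/
theorem run_pos_congr {P' : Par} (hb : P.b = P'.b) (j : ℕ) :
    (run P L j).pos = (run P' L j).pos := by
  induction j with
  | zero => rfl
  | succ j ih => rw [run, run, emit_pos, emit_pos, push₂_pos, push₂_pos, ih, hb]

/-- The intersections inside of a smaller interval were already present before. -/
theorem out_eq_of_subinterval {P' : Par} {n j : ℕ} (hb : 0 < P.b) (hbb : P'.b = P.b)
    (hj : j < n) (hN : P.N = n) (hN' : P'.N = n) (hres : Resolved L n P.b P.lo P.hi)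
    (h₁ : P.lo < P.lam) (h₂ : P.lam < P.hi) (h₁' : P'.lo < P'.lam) (h₂' : P'.lam < P'.hi)
    (hlo : P.lo ≤ P'.lo) (hhi : P'.hi ≤ P.hi)
    (hin : P'.lo < (run P' L (j + 1)).out ∧ (run P' L (j + 1)).out < P'.hi) :
    (run P L (j + 1)).out = (run P' L (j + 1)).out := by
  rcases out_cases (P := P') (L := L) j with ⟨hf', h₃, h₄, ho'⟩ | ⟨-, h | h⟩
  · have hf : ((run P L j).push₂ P L j).Full P := by
      have e₁ := push₂_pos (P := P) (L := L) (run P L j) j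
      have e₂ := push₂_pos (P := P') (L := L) (run P' L j) j
      have e₃ := run_pos_congr (L := L) hbb.symm j
      rw [Full, push₂_idx, run_idx (by omega), e₂, ← e₃, hbb, hN'] at hf'
      rw [Full, push₂_idx, run_idx hb, e₁, hN]
      exact hf'
    obtain ⟨t, i, i', hdvd, ht₁, ht₂, hi, hi', hc⟩ := full_blocks hb hj hN hres hf h₁ h₂
    obtain ⟨t', l, l', hdvd', ht₁', ht₂', hl, hl', hc'⟩ := full_blocks (by omega) hj hN'
      ((hbb ▸ hres).mono hlo hhi) hf' h₁' h₂'
    rw [hbb] at *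
    obtain rfl : t = t' := eq_of_dvd_of_window hdvd hdvd' (by omega) ht₂
      (by omega) ht₂'
    -- Two lines that are both best on the smaller interval agree at its two distinct ends, so they
    -- coincide even if their indices differ.
    have key : ∀ {s e a a' : ℕ}, Dom L P.lo P.hi s e a → Dom L P'.lo P'.hi s e a' →
        (L a).d = (L a').d ∧ (L a).k = (L a').k := by
      intro s e a a' ha ha'
      have hp := h₁'.trans h₂'
      have f₁ := ha.best a' ha'.le ha'.lt P'.lo hlo (hp.le.trans hhi)
      have f₂ := ha'.best a ha.le ha.lt P'.lo le_rfl hp.le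
      have f₃ := ha.best a' ha'.le ha'.lt P'.hi (hlo.trans hp.le) hhi
      have f₄ := ha'.best a ha.le ha.lt P'.hi hp.le le_rfl
      have f₅ := le_antisymm f₁ f₂
      have f₆ := le_antisymm f₃ f₄
      simp only [Item.at] at f₅ f₆
      have hk : (P'.hi - P'.lo) * ((L a).k - (L a').k) = 0 := by linarith
      rcases mul_eq_zero.1 hk with h | h
      · linarith
      · have hk : (L a).k = (L a').k := by linarith
        rw [hk] at f₅
        exact ⟨by linarith, hk⟩
    obtain ⟨g₁, g₂⟩ := key hi hl
    obtain ⟨g₃, g₄⟩ := key hi' hl'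
    have hcc : ((run P L j).push₂ P L j).cross = ((run P' L j).push₂ P' L j).cross := by
      rw [hc, hc', g₁, g₂, g₃, g₄]
    rw [ho', ← hcc, run]
    rw [← hcc] at h₃ h₄
    exact (emit_inside ⟨hf, hlo.trans_lt h₃, h₄.trans_le hhi⟩).1
  · exact (hin.1.ne' h).elim
  · exact (hin.2.ne h).elim

end Blk

/-! ## Medians of the cells -/

theorem ncard_fin_eq {n : ℕ} (p : ℕ → Prop) [DecidablePred p] :
    {j : Fin n | p j}.ncard = ((Finset.range n).filter p).card := by
  rw [← Set.ncard_image_of_injective _ Fin.val_injective, ← Set.ncard_coe_finset]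
  congr 1
  ext j
  simp only [Set.mem_image, Set.mem_ofPred_eq, Finset.coe_filter, Finset.mem_range]
  exact ⟨fun ⟨i, hi, e⟩ => e ▸ ⟨i.2, hi⟩, fun ⟨h₁, h₂⟩ => ⟨⟨j, h₁⟩, h₂, rfl⟩⟩

namespace Blk

variable {V : Type*} {L : ℕ → Item V}

/-- Number of intersections inside of the interval. -/
noncomputable def count (P : Par) (L : ℕ → Item V) : ℕ :=
  ((Finset.range P.N).filter fun j =>
    P.lo < (run P L (j + 1)).out ∧ (run P L (j + 1)).out < P.hi).card

/-- Of the dummies, as many are large as small, or one more is large. So the `⌈N/2⌉`-th smallest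
entry is an intersection whenever there is one, and then it splits the intersections in half. If it
is a dummy, no intersection is left. -/
theorem median_cases {P : Par} (hlt : P.lo < P.hi) {x : ℝ}
    (hx : IsMedian (fun j : Fin P.N => (run P L (j + 1)).out) x) :
    (count P L = 0 ∧ ¬ (P.lo < x ∧ x < P.hi)) ∨ 0 < count P L ∧ P.lo < x ∧ x < P.hi ∧
      ((Finset.range P.N).filter fun j =>
        P.lo < (run P L (j + 1)).out ∧ (run P L (j + 1)).out < x).card ≤ count P L / 2 ∧
      ((Finset.range P.N).filter fun j =>
        x < (run P L (j + 1)).out ∧ (run P L (j + 1)).out < P.hi).card ≤ count P L / 2 := by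
  obtain ⟨⟨j₀, hj₀⟩, hmed₁, hmed₂⟩ := hx
  set a : ℕ → ℝ := fun j => (run P L (j + 1)).out with ha
  replace hj₀ : a j₀ = x := hj₀
  rw [ncard_fin_eq (fun j => a j < x)] at hmed₁
  rw [ncard_fin_eq (fun j => a j ≤ x)] at hmed₂
  have hd := dummies (L := L) hlt P.N
  set low := ((Finset.range P.N).filter fun j => a j ≤ P.lo).card with hlow
  set high := ((Finset.range P.N).filter fun j => P.hi ≤ a j).card with hhigh
  have hlh : low = high ∨ low + 1 = high := hd.imp And.right And.right
  have hsplit : ∀ p q r : ℕ → Prop, ∀ [DecidablePred p] [DecidablePred q] [DecidablePred r],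
      (∀ j, r j ↔ p j ∨ q j) → (∀ j, p j → ¬ q j) →
      ((Finset.range P.N).filter r).card =
        ((Finset.range P.N).filter p).card + ((Finset.range P.N).filter q).card := by
    intro p q r _ _ _ h₁ h₂
    rw [← Finset.card_union_of_disjoint, ← Finset.filter_or]
    · congr 1
      exact Finset.filter_congr fun j _ => h₁ j
    · rw [Finset.disjoint_filter]
      exact fun j _ => h₂ j
  have hle : ((Finset.range P.N).filter fun j => a j < P.hi).card = low + count P L :=
    hsplit (fun j => a j ≤ P.lo) (fun j => P.lo < a j ∧ a j < P.hi) (fun j => a j < P.hi)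
      (fun j => ⟨fun h => (le_or_gt (a j) P.lo).imp id fun h' => ⟨h', h⟩,
        fun h => h.elim (fun h => h.trans_lt hlt) And.right⟩)
      (fun j h h' => absurd h'.1 (not_lt.2 h))
  have hn : P.N = low + count P L + high := by
    rw [← hle]
    have := hsplit (fun j => a j < P.hi) (fun j => P.hi ≤ a j) (fun _ => True)
      (fun j => by simp [lt_or_ge]) (fun j h => not_le.2 h)
    rwa [Finset.filter_true, Finset.card_range] at this
  by_cases hin : P.lo < x ∧ x < P.hi
  · right
    have e₁ := hsplit (fun j => a j ≤ P.lo) (fun j => P.lo < a j ∧ a j < x) (fun j => a j < x)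
      (fun j => ⟨fun h => (le_or_gt (a j) P.lo).imp id fun h' => ⟨h', h⟩,
        fun h => h.elim (fun h => h.trans_lt hin.1) And.right⟩)
      (fun j h h' => absurd h'.1 (not_lt.2 h))
    have e₂ := hsplit (fun j => a j ≤ x) (fun j => x < a j ∧ a j < P.hi) (fun j => a j < P.hi)
      (fun j => ⟨fun h => (le_or_gt (a j) x).imp id fun h' => ⟨h', h⟩,
        fun h => h.elim (fun h => h.trans_lt hin.2) And.right⟩)
      (fun j h h' => absurd h'.1 (not_lt.2 h))
    have e₃ : 0 < count P L := by
      refine Finset.card_pos.2 ⟨j₀, ?_⟩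
      rw [Finset.mem_filter, Finset.mem_range]
      exact ⟨j₀.2, hin.1.trans_eq hj₀.symm, hj₀.trans_lt hin.2⟩
    refine ⟨e₃, hin.1, hin.2, ?_, ?_⟩
    · change ((Finset.range P.N).filter fun j => P.lo < a j ∧ a j < x).card ≤ _
      omega
    · change ((Finset.range P.N).filter fun j => x < a j ∧ a j < P.hi).card ≤ _
      omega
  · left
    refine ⟨?_, hin⟩
    rcases le_or_gt x P.lo with h | h
    · have : ((Finset.range P.N).filter fun j => a j ≤ x).card ≤ low :=
        Finset.card_le_card (Finset.monotone_filter_right _ fun j _ h' => h'.trans h)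
      omega
    · have hx : P.hi ≤ x := by
        by_contra! h'
        exact hin ⟨h, h'⟩
      have : ((Finset.range P.N).filter fun j => a j < P.hi).card ≤
          ((Finset.range P.N).filter fun j => a j < x).card :=
        Finset.card_le_card (Finset.monotone_filter_right _ fun j _ h' => lt_of_lt_of_le h' hx)
      omega

end Blk

/-- The parameters of a search: lines are compared in the middle of the interval. -/
noncomputable def Par.mk' (n b : ℕ) (k0 lo hi : ℝ) : Par := ⟨n, b, k0, (lo + hi) / 2, lo, hi⟩

/-! ### Progress of the search -/

namespace Blk

variable {V : Type*} {L : ℕ → Item V}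

/-- A new interval changes the midpoint and the dummies, but by `out_eq_of_subinterval` it creates
no intersection that was not there before. -/
theorem count_mk'_le {n b : ℕ} {k0 lo hi lo' hi' : ℝ} (hb : 0 < b)
    (hres : Resolved L n b lo hi) (h₁ : lo ≤ lo') (h₂ : lo' < hi') (h₃ : hi' ≤ hi) :
    count (Par.mk' n b k0 lo' hi') L ≤ ((Finset.range n).filter fun j =>
      lo' < (run (Par.mk' n b k0 lo hi) L (j + 1)).out ∧
        (run (Par.mk' n b k0 lo hi) L (j + 1)).out < hi').card := by
  refine Finset.card_le_card fun j hj => ?_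
  rw [Finset.mem_filter, Finset.mem_range] at hj ⊢
  refine ⟨hj.1, ?_⟩
  have := out_eq_of_subinterval (P := Par.mk' n b k0 lo hi) (P' := Par.mk' n b k0 lo' hi')
    hb rfl hj.1 rfl rfl hres (by simp only [Par.mk']; linarith) (by simp only [Par.mk']; linarith)
    (by simp only [Par.mk']; linarith) (by simp only [Par.mk']; linarith) h₁ h₃ hj.2
  rw [this]
  exact hj.2

theorem count_le (P : Par) (L : ℕ → Item V) : count P L ≤ P.N := by
  have := Finset.card_filter_le (Finset.range P.N) fun j =>
    P.lo < (run P L (j + 1)).out ∧ (run P L (j + 1)).out < P.hi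
  rwa [Finset.card_range] at this

/-- Progress of the search: `j` bounds the number of iterations to come. -/
def Progress (L : ℕ → Item V) (n b : ℕ) (k0 lo hi : ℝ) (j : ℕ) : Prop :=
  0 < b ∧ Resolved L n b lo hi ∧ ∃ r s, 2 * n ≤ b * 2 ^ r ∧
    count (Par.mk' n b k0 lo hi) L < 2 ^ s ∧ j = r * (Nat.log 2 n + 2) + s

/-- Since `n < 2 ^ (log n + 1)`, one may take `r = log n + 2` and `s = log n + 1`. -/
theorem Progress.start (n : ℕ) (k0 lo hi : ℝ) : Progress L n 1 k0 lo hi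
    ((Nat.log 2 n + 2) * (Nat.log 2 n + 2) + (Nat.log 2 n + 1)) := by
  have h := Nat.lt_pow_succ_log_self one_lt_two n
  refine ⟨one_pos, resolved_one n lo hi, _, _, ?_, (count_le _ _).trans_lt h, rfl⟩
  rw [one_mul, pow_succ, mul_comm]
  exact Nat.mul_le_mul_right _ h.le

theorem Progress.pos_and_double {n b j : ℕ} {k0 lo hi x : ℝ} (h : Progress L n b k0 lo hi j)
    (hlt : lo < hi) (hbn : b < 2 * n)
    (hx : IsMedian (fun j : Fin n => (run (Par.mk' n b k0 lo hi) L (j + 1)).out) x)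
    (hout : ¬ (lo < x ∧ x < hi)) :
    ∃ i, j = i + 1 ∧ Progress L n (2 * b) k0 lo hi i := by
  obtain ⟨hb, hres, r, s, hr, hs, rfl⟩ := h
  have hc : count (Par.mk' n b k0 lo hi) L = 0 := by
    rcases median_cases (P := Par.mk' n b k0 lo hi) (L := L) hlt hx with h | h
    · exact h.1
    · exact (hout ⟨h.2.1, h.2.2.1⟩).elim
  have hn := Nat.lt_pow_succ_log_self one_lt_two n
  obtain ⟨r, rfl⟩ : ∃ r', r = r' + 1 := by
    cases r with
    | zero => omega
    | succ r => exact ⟨r, rfl⟩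
  refine ⟨r * (Nat.log 2 n + 2) + (Nat.log 2 n + 1) + s, by ring, by omega, ?_, r,
    Nat.log 2 n + 1 + s, ?_, ?_, by ring⟩
  · refine resolved_double (P := Par.mk' n b k0 lo hi) hb rfl hres
      (by simp only [Par.mk']; linarith) (by simp only [Par.mk']; linarith) fun j hj hin => ?_
    rw [count, Finset.card_eq_zero] at hc
    have : j ∈ (∅ : Finset ℕ) := by
      rw [← hc, Finset.mem_filter, Finset.mem_range]
      exact ⟨hj, hin⟩
    simp at this
  · rw [pow_succ] at hr
    calc 2 * n ≤ b * (2 ^ r * 2) := hr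
      _ = 2 * b * 2 ^ r := by ring
  · refine (count_le _ _).trans_lt (hn.trans_le ?_)
    exact Nat.pow_le_pow_right two_pos (by omega)

/-- At most half of the intersections, rounded down, survive on either side of the median, so `s`
decreases by one whichever side is kept. -/
theorem Progress.shrink {n b j : ℕ} {k0 lo hi x : ℝ} (h : Progress L n b k0 lo hi j)
    (hx : IsMedian (fun j : Fin n => (run (Par.mk' n b k0 lo hi) L (j + 1)).out) x)
    (h₁ : lo < x) (h₂ : x < hi) :
    ∃ i, j = i + 1 ∧ Progress L n b k0 lo x i ∧ Progress L n b k0 x hi i := by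
  obtain ⟨hb, hres, r, s, hr, hs, rfl⟩ := h
  rcases median_cases (P := Par.mk' n b k0 lo hi) (L := L) (h₁.trans h₂) hx with
    h | ⟨hc, -, -, hl, hh⟩
  · exact (h.2 ⟨h₁, h₂⟩).elim
  obtain ⟨s, rfl⟩ : ∃ s', s = s' + 1 := by
    cases s with
    | zero =>
      rw [pow_zero] at hs
      omega
    | succ s => exact ⟨s, rfl⟩
  rw [pow_succ] at hs
  have e₁ := count_mk'_le (k0 := k0) hb hres le_rfl h₁ h₂.le
  have e₂ := count_mk'_le (k0 := k0) hb hres h₁.le h₂ le_rfl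
  refine ⟨r * (Nat.log 2 n + 2) + s, by ring, ⟨hb, hres.mono le_rfl h₂.le, r, s, hr, ?_, rfl⟩,
    hb, hres.mono h₁.le le_rfl, r, s, hr, ?_, rfl⟩
  · have := e₁.trans hl
    omega
  · have := e₂.trans hh
    omega

theorem Progress.dom {n b j : ℕ} {k0 lo hi : ℝ} (h : Progress L n b k0 lo hi j) (hn : 0 < n)
    (hb : 2 * n ≤ b) : ∃ i, Dom L lo hi 0 (2 * n) i := by
  obtain ⟨i, hi⟩ := h.2.1 0 (by omega)
  rw [zero_mul, zero_add, one_mul, min_eq_right hb] at hi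
  exact ⟨i, hi⟩

end Blk

/-! ## Lines of a tour -/

namespace TreeNetwork

variable {V : Type*} (T : TreeNetwork V)

noncomputable def weightOf (u : Option V) : ℝ := u.elim 0 T.weight

open Classical in
/-- The line given by a state of a tour. -/
noncomputable def item (k0 : ℝ) (t : Tour V) : Item V :=
  if t.fl = 0 ∧ 0 < T.weightOf t.x then ⟨t.D, 1 / T.weightOf t.x, t.x⟩ else ⟨0, k0, t.x⟩

variable [DecidableEq V]

/-- The lines of the tour from `v`. -/
noncomputable def items (v : V) (i : ℕ) : Item V :=
  T.item (1 / T.weight v) (Tour.event T v i)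

variable {T} [Fintype V]

theorem items_zero {v : V} (hv : 0 < T.weight v) :
    T.items v 0 = ⟨T.vdist v v, 1 / T.weight v, some v⟩ := by
  rw [vdist_self]
  exact if_pos ⟨rfl, hv⟩

theorem items_cases {v : V} {i : ℕ} (hi : i < 2 * Fintype.card V) :
    (∃ z, 0 < T.weight z ∧ T.items v i = ⟨T.vdist v z, 1 / T.weight z, some z⟩) ∨
      (T.items v i).d = T.vdist v v ∧ (T.items v i).k = 1 / T.weight v := by
  obtain ⟨x, a, hx, -, -, hD, -⟩ := (Tour.event_spec T v).1 i hi
  unfold items item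
  rw [hx]
  split_ifs with h
  · exact .inl ⟨x, h.2, by rw [hD]; rfl⟩
  · exact .inr ⟨by rw [vdist_self], rfl⟩

theorem exists_items {v z : V} (hz : 0 < T.weight z) :
    ∃ i < 2 * Fintype.card V, T.items v i = ⟨T.vdist v z, 1 / T.weight z, some z⟩ := by
  obtain ⟨i, hi, hx, hf⟩ := (Tour.event_spec T v).2.2 z 0 (.inl rfl)
  refine ⟨i, hi, ?_⟩
  obtain ⟨x, a, hx', -, -, hD, -⟩ := (Tour.event_spec T v).1 i hi
  rw [hx] at hx'
  obtain rfl : z = x := by simpa using hx'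
  unfold items item
  rw [hx, if_pos ⟨hf, hz⟩, hD]
  rfl

/-- The filler lines, for leaving a vertex or for weight `0`, coincide with the line of the start
`v`, which has index `0`. So a filler at a positive index is never the first best line. -/
theorem bestAt_items {v : V} (hv : 0 < T.weight v) {lam : ℝ} {i : ℕ}
    (hi : BestAt (T.items v) lam 0 (2 * Fintype.card V) i) :
    ∃ z, 0 < T.weight z ∧ T.items v i = ⟨T.vdist v z, 1 / T.weight z, some z⟩ := by
  rcases items_cases hi.lt with h | ⟨h₁, h₂⟩
  · exact h
  · by_cases h0 : i = 0
    · exact ⟨v, hv, h0 ▸ items_zero hv⟩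
    · have := hi.first 0 le_rfl (by omega)
      rw [Item.at, Item.at, h₁, h₂, items_zero hv] at this
      exact (lt_irrefl _ this).elim

/-- The result of a complete scan of the lines of the tour from `v`. -/
theorem run_items {v : V} (hv : 0 < T.weight v) {P : Par} (hb : P.b = 2 * Fintype.card V) :
    ∃ z, 0 < T.weight z ∧
      (Blk.run P (T.items v) (Fintype.card V)).pc = some z ∧
      (Blk.run P (T.items v) (Fintype.card V)).dc = T.vdist v z ∧
      (Blk.run P (T.items v) (Fintype.card V)).kc = 1 / T.weight z ∧
      (∀ y, 0 < T.weight y →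
        T.vdist v y - P.lam * (1 / T.weight y) ≤ T.vdist v z - P.lam * (1 / T.weight z)) ∧
      ∀ lo hi i, Dom (T.items v) lo hi 0 (2 * Fintype.card V) i → lo < P.lam → P.lam < hi →
        ∀ lam, lo ≤ lam → lam ≤ hi → ∀ y, 0 < T.weight y →
          T.vdist v y - lam * (1 / T.weight y) ≤ T.vdist v z - lam * (1 / T.weight z) := by
  obtain ⟨i, hi, h₁, h₂, h₃⟩ := Blk.run_best (L := T.items v) T.card_pos hb
  obtain ⟨z, hz, e⟩ := bestAt_items hv hi
  rw [e] at h₁ h₂ h₃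
  refine ⟨z, hz, h₃, h₁, h₂, fun y hy => ?_, fun lo hi' j hj hlo hhi lam hl hh y hy => ?_⟩
  · obtain ⟨i', hi', e'⟩ := exists_items (v := v) hy
    have := hi.best i' (Nat.zero_le _) hi'
    rwa [e, e'] at this
  · obtain ⟨i', hi', e'⟩ := exists_items (v := v) hy
    have := (hj.of_bestAt hi hlo hhi).best i' (Nat.zero_le _) hi' lam hl hh
    rwa [e, e'] at this

/-! ## The optimal value -/

/-- `lam` is the optimal value: the largest ratio given by a pair of vertices. -/
structure IsValue (T : TreeNetwork V) (lam : ℝ) : Prop where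
  exists_pair : ∃ x y, 0 < T.weight x ∧ 0 < T.weight y ∧
    T.vdist x y = lam * (1 / T.weight x + 1 / T.weight y)
  le : ∀ x y, 0 < T.weight x → 0 < T.weight y →
    T.vdist x y ≤ lam * (1 / T.weight x + 1 / T.weight y)

omit [DecidableEq V] in
theorem exists_isValue {v : V} (hv : 0 < T.weight v) : ∃ lam, T.IsValue lam := by
  classical
  obtain ⟨⟨x, y⟩, hxy, hmax⟩ := Finset.exists_max_image
    (Finset.univ.filter fun p : V × V => 0 < T.weight p.1 ∧ 0 < T.weight p.2)
    (fun p => T.vdist p.1 p.2 / (1 / T.weight p.1 + 1 / T.weight p.2)) ⟨(v, v), by simp [hv]⟩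
  simp only [Finset.mem_filter, Finset.mem_univ, true_and] at hxy hmax
  obtain ⟨hx, hy⟩ := hxy
  refine ⟨T.vdist x y / (1 / T.weight x + 1 / T.weight y), ⟨x, y, hx, hy, ?_⟩, fun x' y' hx' hy' => ?_⟩
  · rw [div_mul_cancel₀]
    positivity
  · rw [← div_le_iff₀ (by positivity)]
    exact hmax (x', y') ⟨hx', hy'⟩

variable {lam : ℝ}

omit [DecidableEq V]

theorem IsValue.nonneg (h : T.IsValue lam) : 0 ≤ lam := by
  obtain ⟨x, -, hx, -, -⟩ := h.exists_pair
  have := h.le x x hx hx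
  rw [vdist_self] at this
  by_contra! hlt
  have : 0 < 1 / T.weight x + 1 / T.weight x := by positivity
  nlinarith

/-- Bounds the optimal value by any bound on the weighted distances to one vertex; this justifies
the initial upper end of the search interval. -/
theorem IsValue.le_of_forall (h : T.IsValue lam) {v : V} {c : ℝ}
    (hc : ∀ z, T.weight z * T.vdist v z ≤ c) : lam ≤ c := by
  obtain ⟨x, y, hx, hy, e⟩ := h.exists_pair
  have hx' : T.vdist v x ≤ c * (1 / T.weight x) := by
    rw [mul_one_div, le_div_iff₀ hx, mul_comm]
    exact hc x
  have hy' : T.vdist v y ≤ c * (1 / T.weight y) := by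
    rw [mul_one_div, le_div_iff₀ hy, mul_comm]
    exact hc y
  have := vdist_triangle (T := T) x y v
  rw [vdist_comm x v] at this
  have : 0 < 1 / T.weight x + 1 / T.weight y := by positivity
  by_contra! hlt
  nlinarith

/-- Comparison of a number with the optimal value. -/
theorem IsValue.lt_iff (h : T.IsValue lam) {a u v : V} {c : ℝ} (hu : 0 < T.weight u)
    (hv : 0 < T.weight v)
    (h₁ : ∀ z, 0 < T.weight z →
      T.vdist a z - c * (1 / T.weight z) ≤ T.vdist a u - c * (1 / T.weight u))
    (h₂ : ∀ z, 0 < T.weight z →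
      T.vdist u z - c * (1 / T.weight z) ≤ T.vdist u v - c * (1 / T.weight v)) :
    c < lam ↔ c * (1 / T.weight u + 1 / T.weight v) < T.vdist u v := by
  constructor
  · intro hlt
    obtain ⟨x, y, hx, hy, e⟩ := h.exists_pair
    have := farthest_pair (S := {z | 0 < T.weight z}) (c := fun z => c * (1 / T.weight z))
      hv h₁ h₂ hx hy
    have hk : 0 < 1 / T.weight x + 1 / T.weight y := by positivity
    have := mul_lt_mul_of_pos_right hlt hk
    linarith
  · intro hlt
    have := h.le u v hu hv
    have hk : 0 < 1 / T.weight u + 1 / T.weight v := by positivity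
    exact lt_of_mul_lt_mul_right (hlt.trans_le this) hk.le

/-- The corrected distance of a pair attaining `lam` is `0`, and by `farthest_pair` that of `u, v`
is at least as large; it is at most `0` for every pair. -/
theorem IsValue.eq (h : T.IsValue lam) {a u v : V} (hu : 0 < T.weight u)
    (hv : 0 < T.weight v)
    (h₁ : ∀ z, 0 < T.weight z →
      T.vdist a z - lam * (1 / T.weight z) ≤ T.vdist a u - lam * (1 / T.weight u))
    (h₂ : ∀ z, 0 < T.weight z →
      T.vdist u z - lam * (1 / T.weight z) ≤ T.vdist u v - lam * (1 / T.weight v)) :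
    T.vdist u v = lam * (1 / T.weight u + 1 / T.weight v) := by
  refine le_antisymm (h.le u v hu hv) ?_
  obtain ⟨x, y, hx, hy, e⟩ := h.exists_pair
  have := farthest_pair (S := {z | 0 < T.weight z}) (c := fun z => lam * (1 / T.weight z))
    hv h₁ h₂ hx hy
  linarith

/-! ## Sizes -/

theorem exists_nat_vdist {B : ℕ}
    (hB : ∀ e ∈ T.graph.edgeSet, ∃ k : ℕ, k ≤ B ∧ T.length e = k) (u v : V) :
    ∃ k : ℕ, k ≤ Fintype.card V * B ∧ T.vdist u v = k := by
  obtain ⟨p, hp, -⟩ := T.isTree.existsUnique_path u v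
  rw [vdist_of_isPath p hp]
  have key : ∀ l : List (Sym2 V), (∀ e ∈ l, e ∈ T.graph.edgeSet) →
      ∃ k : ℕ, k ≤ l.length * B ∧ (l.map T.length).sum = k := by
    intro l
    induction l with
    | nil => exact fun _ => ⟨0, by simp, by simp⟩
    | cons e l ih =>
      intro hl
      obtain ⟨k, hk, ek⟩ := ih fun e he => hl e (List.mem_cons_of_mem _ he)
      obtain ⟨m, hm, em⟩ := hB e (hl e List.mem_cons_self)
      refine ⟨m + k, ?_, ?_⟩
      · rw [List.length_cons, Nat.succ_mul]
        omega
      · rw [List.map_cons, List.sum_cons, ek, em]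
        push_cast
        rfl
  obtain ⟨k, hk, e⟩ := key p.edges fun e he => p.edges_subset_edgeSet he
  refine ⟨k, hk.trans (Nat.mul_le_mul_right _ ?_), e⟩
  rw [SimpleGraph.Walk.length_edges]
  exact hp.length_lt.le

theorem fit_vdist (u v : V) : Fit T 2 (T.vdist u v) := by
  rw [fit_def]
  intro B _ hB
  obtain ⟨k, hk, e⟩ := exists_nat_vdist hB u v
  rw [e, pow_two]
  exact FitsIn.nat (by positivity) (hk.trans (Nat.mul_le_mul (by omega) (by omega)))

theorem fit_items [DecidableEq V] {v : V} {i : ℕ} (hi : i < 2 * Fintype.card V) :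
    Fit T 2 (T.items v i).d ∧ Fit T 2 (T.items v i).k := by
  have hw : ∀ z, Fit T 2 (1 / T.weight z) := fun z => by
    rw [one_div]
    exact (Fit.weight z (by omega)).inv
  rcases items_cases (v := v) hi with ⟨z, -, e⟩ | ⟨h₁, h₂⟩
  · rw [e]
    exact ⟨fit_vdist _ _, hw z⟩
  · rw [h₁, h₂]
    exact ⟨fit_vdist _ _, hw v⟩

end TreeNetwork

/-- All numbers in the state of a scan are small. -/
structure Blk.Fits {V : Type*} [Fintype V] (T : TreeNetwork V) (c : Blk V) : Prop where
  dl : Fit T 2 c.dl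
  kl : Fit T 2 c.kl
  dc : Fit T 2 c.dc
  kc : Fit T 2 c.kc
  dm : Fit T 10 c.dm
  out : Fit T 10 c.out

namespace Blk

variable {V : Type*} [Fintype V] {T : TreeNetwork V} {P : Par} {c : Blk V}

theorem Fits.push {l : Item V} (h : c.Fits T) (hd : Fit T 2 l.d) (hk : Fit T 2 l.k) :
    (c.push P l).Fits T := by
  obtain ⟨h₁, h₂, h₃, h₄, h₅, h₆⟩ := h
  unfold Blk.push
  split_ifs <;> constructor <;> assumption

/-- The exponent is `10 = 5 + 5`, as an intersection is a quotient of differences of numbers with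
exponent `2`. It does not grow during the search, since the cell contents become the new ends of the
interval. -/
theorem Fits.emit (h : c.Fits T) (hlo : Fit T 10 P.lo) (hhi : Fit T 10 P.hi) :
    (c.emit P).Fits T := by
  have hc : Fit T 10 c.cross := ((h.dl.sub h.dc).div (h.kl.sub h.kc)).mono le_rfl
  obtain ⟨h₁, h₂, h₃, h₄, h₅, h₆⟩ := h
  unfold Blk.emit
  split_ifs <;> constructor <;> assumption

open TreeNetwork in
theorem fits_run [DecidableEq V] {v : V} (hlo : Fit T 10 P.lo) (hhi : Fit T 10 P.hi) {j : ℕ}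
    (hj : j ≤ Fintype.card V) : (run P (T.items v) j).Fits T := by
  have hit := fun i => fit_items (T := T) (v := v) (i := i)
  induction j with
  | zero => constructor <;> first | exact Fit.zero | exact hhi
  | succ j ih =>
    have h₁ := hit (2 * j) (by omega)
    have h₂ := hit (2 * j + 1) (by omega)
    exact (((ih (by omega)).push h₁.1 h₁.2).push h₂.1 h₂.2).emit hlo hhi

end Blk

/-! ## Registers -/

infixr:60 " ;; " => Prog.seq

def TreeQuery.target : TreeQuery → ℕ
  | .root i => i
  | .parent i _ => i
  | .firstChild i _ => i
  | .nextChild i _ _ => i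
  | .weight i _ => i
  | .parentLength i _ => i

def Instr.target : Instr TreeQuery → ℕ
  | .ctrConst i _ => i
  | .ctrCopy i _ => i
  | .ctrArith _ i _ _ => i
  | .ptrNull i => i
  | .ptrCopy i _ => i
  | .valConst i _ => i
  | .valCopy i _ => i
  | .valArith _ i _ _ => i
  | .query q => q.target

/-- All registers modified by a program have numbers in `S`. -/
def Prog.Targets (S : ℕ → Prop) : Prog TreeQuery → Prop
  | .skip => True
  | .instr a => S a.target
  | .seq c d => c.Targets S ∧ d.Targets S
  | .ite _ c d => c.Targets S ∧ d.Targets S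
  | .loop _ c => c.Targets S

/-- Two stores agree on all registers with numbers not in `S`. -/
def Agree {V : Type*} (S : ℕ → Prop) (s s' : Store V) : Prop :=
  ∀ i, ¬ S i → s'.ctr i = s.ctr i ∧ s'.ptr i = s.ptr i ∧ s'.val i = s.val i

section Agree

variable {V : Type*} {S : ℕ → Prop}

theorem Agree.refl (s : Store V) : Agree S s s := fun _ _ => ⟨rfl, rfl, rfl⟩

theorem Agree.trans {s s' s'' : Store V} (h : Agree S s s') (h' : Agree S s' s'') :
    Agree S s s'' := fun i hi =>
  ⟨(h' i hi).1.trans (h i hi).1, (h' i hi).2.1.trans (h i hi).2.1,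
    (h' i hi).2.2.trans (h i hi).2.2⟩

theorem Agree.mono {S' : ℕ → Prop} {s s' : Store V} (h : Agree S s s')
    (hS : ∀ i, S i → S' i) : Agree S' s s' := fun i hi => h i fun h' => hi (hS i h')

variable [DecidableEq V] {T : TreeNetwork V}

theorem Instr.agree (a : Instr TreeQuery) (ha : S a.target) (s : Store V) :
    Agree S s (a.run (TreeQuery.ask T) s) := by
  intro i hi
  have hne : i ≠ a.target := fun h => hi (h ▸ ha)
  cases a with
  | query q =>
    cases q <;> simp_all [Instr.run, TreeQuery.ask, Store.setPtr, Store.setVal, Instr.target,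
      TreeQuery.target]
  | _ => simp_all [Instr.run, Store.setCtr, Store.setPtr, Store.setVal, Instr.target]

theorem Exec.agree {W : Store V → Prop} {c : Prog TreeQuery} {s s' : Store V} {t : ℕ}
    (h : Exec (TreeQuery.ask T) W c s t s') (hc : c.Targets S) : Agree S s s' := by
  induction h with
  | skip s => exact Agree.refl s
  | instr a s _ => exact a.agree hc s
  | seq _ _ ih₁ ih₂ => exact (ih₁ hc.1).trans (ih₂ hc.2)
  | iteTrue _ _ ih => exact ih hc.1
  | iteFalse _ _ ih => exact ih hc.2
  | loopFalse => exact Agree.refl _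
  | loopTrue _ _ _ ih₁ ih₂ => exact (ih₁ hc).trans (ih₂ hc)

theorem Runs.agree {W : Store V → Prop} {c : Prog TreeQuery} {s : Store V} {k : ℕ}
    {p : Store V → Prop} (h : Runs (TreeQuery.ask T) W c k s p) (hc : c.Targets S) :
    Runs (TreeQuery.ask T) W c k s fun s' => Agree S s s' ∧ p s' := by
  obtain ⟨t, s', h₁, h₂, h₃⟩ := h
  exact ⟨t, s', h₁, h₂, h₁.agree hc, h₃⟩

end Agree

namespace TreeNetwork

variable {V : Type*} (T : TreeNetwork V)

def parentOf (u : Option V) : Option V := u.bind T.parent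

def firstOf (u : Option V) : Option V := u.bind T.firstChild

end TreeNetwork

/-! ### Preconditions of single instructions -/

section Simp

variable {V : Type*} (s : Store V) (i j k : ℕ)

@[simp] theorem Store.setCtr_ctr : (s.setCtr i k).ctr j = if j = i then k else s.ctr j := by
  simp [Store.setCtr, Function.update_apply]

@[simp] theorem Store.setCtr_ptr : (s.setCtr i k).ptr = s.ptr := rfl

@[simp] theorem Store.setCtr_val : (s.setCtr i k).val = s.val := rfl

@[simp] theorem Store.setPtr_ptr (x : Option V) :
    (s.setPtr i x).ptr j = if j = i then x else s.ptr j := by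
  simp [Store.setPtr, Function.update_apply]

@[simp] theorem Store.setPtr_ctr (x : Option V) : (s.setPtr i x).ctr = s.ctr := rfl

@[simp] theorem Store.setPtr_val (x : Option V) : (s.setPtr i x).val = s.val := rfl

@[simp] theorem Store.setVal_val (x : ℝ) :
    (s.setVal i x).val j = if j = i then x else s.val j := by
  simp [Store.setVal, Function.update_apply]

@[simp] theorem Store.setVal_ctr (x : ℝ) : (s.setVal i x).ctr = s.ctr := rfl

@[simp] theorem Store.setVal_ptr (x : ℝ) : (s.setVal i x).ptr = s.ptr := rfl

variable [DecidableEq V] [Fintype V] {T : TreeNetwork V} {K : ℕ} {q : Store V → Prop} {s}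

@[simp] theorem Prog.wp_skip : Prog.skip.wp T K q s ↔ q s := Iff.rfl

@[simp] theorem Prog.wp_seq {c d : Prog TreeQuery} :
    (c ;; d).wp T K q s ↔ c.wp T K (d.wp T K q) s := Iff.rfl

@[simp] theorem Prog.wp_ite {b : Test} {c d : Prog TreeQuery} :
    (Prog.ite b c d).wp T K q s ↔
      (b.Holds s → c.wp T K q s) ∧ (¬ b.Holds s → d.wp T K q s) := Iff.rfl

@[simp] theorem Prog.wp_ctrConst : (Prog.instr (.ctrConst i k)).wp T K q s ↔
    k ≤ (Fintype.card V + 1) ^ K ∧ q (s.setCtr i k) := Iff.rfl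

@[simp] theorem Prog.wp_ctrCopy : (Prog.instr (.ctrCopy i j)).wp T K q s ↔
    q (s.setCtr i (s.ctr j)) := Iff.of_eq (true_and _)

@[simp] theorem Prog.wp_ctrArith {op : ArithOp} : (Prog.instr (.ctrArith op i j k)).wp T K q s ↔
    op.onCtr (s.ctr j) (s.ctr k) ≤ (Fintype.card V + 1) ^ K ∧
      q (s.setCtr i (op.onCtr (s.ctr j) (s.ctr k))) := Iff.rfl

@[simp] theorem Prog.wp_ptrNull : (Prog.instr (.ptrNull i)).wp T K q s ↔
    q (s.setPtr i none) := Iff.of_eq (true_and _)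

@[simp] theorem Prog.wp_ptrCopy : (Prog.instr (.ptrCopy i j)).wp T K q s ↔
    q (s.setPtr i (s.ptr j)) := Iff.of_eq (true_and _)

@[simp] theorem Prog.wp_valConst : (Prog.instr (.valConst i k)).wp T K q s ↔
    Fit T K k ∧ q (s.setVal i k) := Iff.rfl

@[simp] theorem Prog.wp_valCopy : (Prog.instr (.valCopy i j)).wp T K q s ↔
    q (s.setVal i (s.val j)) := Iff.of_eq (true_and _)

@[simp] theorem Prog.wp_valArith {op : ArithOp} : (Prog.instr (.valArith op i j k)).wp T K q s ↔
    Fit T K (op.onVal (s.val j) (s.val k)) ∧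
      q (s.setVal i (op.onVal (s.val j) (s.val k))) := Iff.rfl

@[simp] theorem Prog.wp_root : (Prog.instr (.query (.root i))).wp T K q s ↔
    q (s.setPtr i (some T.root)) := Iff.of_eq (true_and _)

@[simp] theorem Prog.wp_parent : (Prog.instr (.query (.parent i j))).wp T K q s ↔
    q (s.setPtr i (T.parentOf (s.ptr j))) := Iff.of_eq (true_and _)

@[simp] theorem Prog.wp_firstChild : (Prog.instr (.query (.firstChild i j))).wp T K q s ↔
    q (s.setPtr i (T.firstOf (s.ptr j))) := Iff.of_eq (true_and _)

@[simp] theorem Prog.wp_nextChild : (Prog.instr (.query (.nextChild i j k))).wp T K q s ↔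
    q (s.setPtr i (T.nextOf (s.ptr j) (s.ptr k))) := Iff.of_eq (true_and _)

@[simp] theorem Prog.wp_weight : (Prog.instr (.query (.weight i j))).wp T K q s ↔
    q (s.setVal i (T.weightOf (s.ptr j))) := Iff.of_eq (true_and _)

@[simp] theorem Prog.wp_parentLength : (Prog.instr (.query (.parentLength i j))).wp T K q s ↔
    q (s.setVal i (T.lengthOf (s.ptr j))) := Iff.of_eq (true_and _)

attribute [simp] Test.Holds ArithOp.onCtr ArithOp.onVal

end Simp

/-- The registers used by the code for the list cell in bundle `p`. -/
def Local (p i : ℕ) : Prop := (1 ≤ i ∧ i < 8) ∨ (p + 64 ≤ i ∧ i < p + 71)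

section Code

variable {V : Type*}

/-- The bundle of `p` ends with register `p + 70`; number `p + 71` is left free for a simulated
counter and a simulated value. -/
def getTour (p : ℕ) (s : Store V) : Tour V :=
  ⟨s.ptr (p + 64), s.ptr (p + 65), s.ptr (p + 66), s.ctr (p + 64), s.val (p + 64)⟩

def getBlk (p : ℕ) (s : Store V) : Blk V :=
  ⟨s.ctr (p + 65), s.ctr (p + 66), s.val (p + 65), s.val (p + 66), s.val (p + 67),
    s.val (p + 68), s.ptr (p + 67), s.val (p + 69), s.val (p + 70)⟩

def getPar (s : Store V) : Par :=
  ⟨s.ctr 8, s.ctr 9, s.val 8, s.val 9, s.val 10, s.val 11⟩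

/-- On entry pointer register `1` holds the vertex whose children are visited, register `2` the next
candidate. -/
def goToCode (p : ℕ) : Prog TreeQuery :=
  .ite (.ptrEq 2 (p + 66)) (.instr (.query (.nextChild 2 1 (p + 66)))) .skip ;;
  .ite (.ptrIsNull 2)
    (.instr (.ptrCopy (p + 64) 1) ;; .instr (.ctrConst (p + 64) 1))
    (.instr (.ptrCopy (p + 64) 2) ;; .instr (.query (.parentLength 1 2)) ;;
      .instr (.valArith .add (p + 64) (p + 64) 1) ;; .instr (.ctrConst (p + 64) 0))

/-- Counter `0` is never written and serves as the constant zero in tests. -/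
def advCode (p : ℕ) : Prog TreeQuery :=
  .ite (.ctrEq (p + 64) 0)
    (.instr (.ptrCopy 1 (p + 64)) ;; .instr (.query (.firstChild 2 1)) ;; goToCode p)
    (.ite (.ptrEq (p + 64) (p + 65))
      (.instr (.ptrCopy (p + 66) (p + 64)) ;; .instr (.query (.parentLength 1 (p + 64))) ;;
        .instr (.valArith .add (p + 64) (p + 64) 1) ;;
        .instr (.query (.parent (p + 64) (p + 64))) ;; .instr (.ptrCopy (p + 65) (p + 64)) ;;
        .instr (.ctrConst (p + 64) 0))
      (.instr (.query (.parentLength 1 (p + 64))) ;;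
        .instr (.valArith .sub (p + 64) (p + 64) 1) ;; .instr (.query (.parent 1 (p + 64))) ;;
        .instr (.query (.nextChild 2 1 (p + 64))) ;; goToCode p))

/-- Put the line of the current state of the tour into the registers `1` and `2`. -/
def itemCode (p : ℕ) : Prog TreeQuery :=
  .instr (.valConst 1 0) ;; .instr (.valCopy 2 8) ;; .instr (.query (.weight 3 (p + 64))) ;;
  .instr (.valConst 4 0) ;; .instr (.valConst 5 1) ;;
  .ite (.and (.ctrEq (p + 64) 0) (.valLt 4 3))
    (.instr (.valCopy 1 (p + 64)) ;; .instr (.valArith .div 2 5 3)) .skip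

def pushCode (p : ℕ) : Prog TreeQuery :=
  .ite (.ctrEq (p + 65) 9)
    (.instr (.valCopy (p + 65) (p + 67)) ;; .instr (.valCopy (p + 66) (p + 68))) .skip ;;
  .instr (.valArith .mul 3 9 (p + 68)) ;; .instr (.valArith .sub 3 (p + 67) 3) ;;
  .instr (.valArith .mul 4 9 2) ;; .instr (.valArith .sub 4 1 4) ;;
  .ite (.and (.not (.ctrEq (p + 65) 0)) (.and (.not (.ctrEq (p + 65) 9)) (.not (.valLt 3 4))))
    .skip
    (.instr (.valCopy (p + 67) 1) ;; .instr (.valCopy (p + 68) 2) ;;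
      .instr (.ptrCopy (p + 67) (p + 64))) ;;
  .instr (.ctrConst 1 1) ;; .instr (.ctrArith .add (p + 65) (p + 65) 1)

/-- The number of cells is increased before the test, so it is compared with `N` directly; the
position is reset at the end, since the test needs the old one. Tests have no disjunction, hence the
negations. -/
def emitCode (p : ℕ) : Prog TreeQuery :=
  .instr (.ctrConst 1 1) ;; .instr (.ctrArith .add (p + 66) (p + 66) 1) ;;
  .instr (.ctrArith .add 2 9 9) ;;
  .instr (.valArith .sub 1 (p + 65) (p + 67)) ;; .instr (.valArith .sub 2 (p + 66) (p + 68)) ;;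
  .instr (.valArith .div 1 1 2) ;;
  .ite (.and (.not (.and (.not (.ctrEq (p + 65) 2))
      (.not (.and (.ctrEq (p + 66) 8) (.ctrLt 9 (p + 65))))))
      (.and (.valLt 10 1) (.valLt 1 11)))
    (.instr (.valCopy (p + 70) 1))
    (.instr (.valCopy (p + 70) (p + 69)) ;;
      .ite (.valEq (p + 69) 10) (.instr (.valCopy (p + 69) 11)) (.instr (.valCopy (p + 69) 10))) ;;
  .ite (.ctrEq (p + 65) 2) (.instr (.ctrConst (p + 65) 0)) .skip

theorem goToCode_targets (p : ℕ) : (goToCode p).Targets (Local p) := by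
  simp [goToCode, Prog.Targets, Instr.target, TreeQuery.target, Local]

theorem advCode_targets (p : ℕ) : (advCode p).Targets (Local p) := by
  simp [advCode, Prog.Targets, Instr.target, TreeQuery.target, goToCode_targets, Local]

theorem itemCode_targets (p : ℕ) : (itemCode p).Targets (Local p) := by
  simp [itemCode, Prog.Targets, Instr.target, TreeQuery.target, Local]

theorem pushCode_targets (p : ℕ) : (pushCode p).Targets (Local p) := by
  simp [pushCode, Prog.Targets, Instr.target, Local]

theorem emitCode_targets (p : ℕ) : (emitCode p).Targets (Local p) := by
  simp [emitCode, Prog.Targets, Instr.target, Local]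

end Code

section Agree

variable {V : Type*} [DecidableEq V] [Fintype V] {T : TreeNetwork V} {K : ℕ} {S : ℕ → Prop}
  {s : Store V} {q : Store V → Prop}

theorem Prog.wp_agree {c : Prog TreeQuery} (hc : c.Targets S) (h : c.wp T K q s) :
    c.wp T K (fun s' => Agree S s s' ∧ q s') s := by
  induction c generalizing s q with
  | skip => exact ⟨Agree.refl s, h⟩
  | instr a => exact ⟨h.1, a.agree hc s, h.2⟩
  | seq c d ihc ihd =>
    exact Prog.wp_seq.2 (Prog.wp_mono (ihc hc.1 h) fun s' h' =>
      Prog.wp_mono (ihd hc.2 h'.2) fun s'' h'' => ⟨h'.1.trans h''.1, h''.2⟩)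
  | ite b c d ihc ihd => exact ⟨fun hb => ihc hc.1 (h.1 hb), fun hb => ihd hc.2 (h.2 hb)⟩
  | loop b c => exact h.elim

omit [DecidableEq V]

theorem TreeNetwork.fit_lengthOf (u : Option V) : Fit T 1 (T.lengthOf u) := by
  cases u with
  | none => exact Fit.zero
  | some u => exact Fit.parentLength u le_rfl

theorem TreeNetwork.fit_weightOf (u : Option V) : Fit T 1 (T.weightOf u) := by
  cases u with
  | none => exact Fit.zero
  | some u => exact Fit.weight u le_rfl

omit T in
@[simp] theorem one_le_words (V : Type*) [Fintype V] (K : ℕ) : 1 ≤ (Fintype.card V + 1) ^ K :=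
  Nat.one_le_pow _ _ (Nat.succ_pos _)

variable [DecidableEq V]

theorem goToCode_wp {p : ℕ} (hK : 50 ≤ K) (hD : Fit T 20 (s.val (p + 64))) :
    (goToCode p).wp T K (fun s' => getTour p s' = (getTour p s).goTo T (s.ptr 1) (s.ptr 2) ∧
      getBlk p s' = getBlk p s) s := by
  have hfit : ∀ u : Option V, Fit T K (s.val (p + 64) + T.lengthOf u) := fun u =>
    (hD.add (T.fit_lengthOf u)).mono (by omega)
  by_cases h : s.ptr 2 = s.ptr (p + 66)
  · by_cases h' : T.nextOf (s.ptr 1) (s.ptr (p + 66)) = none <;>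
    simp [goToCode, Tour.goTo, getTour, getBlk, h, h', hfit]
  · by_cases h' : s.ptr 2 = none <;>
    simp_all [goToCode, Tour.goTo, getTour, getBlk]

theorem advCode_wp {p : ℕ} (hK : 50 ≤ K) (h0 : s.ctr 0 = 0) (hD : Fit T 10 (s.val (p + 64))) :
    (advCode p).wp T K (fun s' => getTour p s' = (getTour p s).adv T ∧
      getBlk p s' = getBlk p s) s := by
  have hfit : ∀ u : Option V, Fit T K (s.val (p + 64) + T.lengthOf u) := fun u =>
    (hD.add (T.fit_lengthOf u)).mono (by omega)
  have hfit' : ∀ u : Option V, Fit T 12 (s.val (p + 64) - T.lengthOf u) := fun u =>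
    (hD.sub (T.fit_lengthOf u)).mono (by omega)
  by_cases h : s.ctr (p + 64) = 0
  · simp only [advCode, Prog.wp_ite, Test.Holds, h, h0, Prog.wp_seq, Prog.wp_ptrCopy,
      Prog.wp_firstChild, forall_const, not_true, false_imp_iff, and_true]
    refine Prog.wp_mono (goToCode_wp hK (by simpa using hD.mono (by omega))) ?_
    simp [getTour, getBlk, Tour.adv, h, TreeNetwork.firstOf]
  · by_cases h' : s.ptr (p + 64) = s.ptr (p + 65)
    · simp [advCode, Tour.adv, getTour, getBlk, h, h', h0, hfit, TreeNetwork.parentOf]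
    · simp only [advCode, Prog.wp_ite, Test.Holds, h, h', h0, Prog.wp_seq, Prog.wp_parent,
        Prog.wp_nextChild, Prog.wp_parentLength, Prog.wp_valArith,
        not_false_iff, false_imp_iff, true_and, forall_const]
      refine ⟨by simpa using (hfit' _).mono (by omega), ?_⟩
      refine Prog.wp_mono (goToCode_wp hK (by simpa using (hfit' _).mono (by omega))) ?_
      simp [getTour, getBlk, Tour.adv, h, h', TreeNetwork.parentOf]

theorem itemCode_wp {p : ℕ} (hK : 50 ≤ K) (h0 : s.ctr 0 = 0) :
    (itemCode p).wp T K (fun s' => (⟨s'.val 1, s'.val 2, s'.ptr (p + 64)⟩ : Item V) =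
        T.item (s.val 8) (getTour p s) ∧
      getTour p s' = getTour p s ∧ getBlk p s' = getBlk p s) s := by
  have h1 : Fit T K 0 := Fit.zero
  have h2 : Fit T 1 1 := by simpa using Fit.natCast (T := T) (m := 1) (by omega) le_rfl
  have h3 : ∀ u : Option V, Fit T K (T.weightOf u)⁻¹ := fun u =>
    (T.fit_weightOf u).inv.mono (by omega)
  by_cases h : s.ctr (p + 64) = 0 ∧ 0 < T.weightOf (s.ptr (p + 64))
  · simp [itemCode, TreeNetwork.item, getTour, getBlk, h, h0, h1, h2.mono (by omega : 1 ≤ K), h3]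
  · simp [itemCode, TreeNetwork.item, getTour, getBlk, h, h0, h1, h2.mono (by omega : 1 ≤ K)]

theorem pushCode_wp {p : ℕ} {P : Par} (hK : 50 ≤ K) (h0 : s.ctr 0 = 0) (hP : getPar s = P)
    (hlam : Fit T 22 P.lam) (hc : (getBlk p s).Fits T) (h1 : Fit T 2 (s.val 1))
    (h2 : Fit T 2 (s.val 2)) (hpos : (getBlk p s).pos + 1 ≤ (Fintype.card V + 1) ^ K) :
    (pushCode p).wp T K (fun s' => getTour p s' = getTour p s ∧
      getBlk p s' = (getBlk p s).push P ⟨s.val 1, s.val 2, s.ptr (p + 64)⟩) s := by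
  subst hP
  obtain ⟨-, -, hdc, hkc, -, -⟩ := hc
  simp only [getBlk, getPar] at hlam hdc hkc hpos
  have e1 : Fit T K (s.val 9 * s.val (p + 68)) := (hlam.mul hkc).mono (by omega)
  have e2 : Fit T K (s.val 9 * s.val 2) := (hlam.mul h2).mono (by omega)
  have e3 : Fit T K (s.val (p + 67) - s.val 9 * s.val (p + 68)) :=
    (hdc.sub (hlam.mul hkc)).mono (by omega)
  have e4 : Fit T K (s.val 1 - s.val 9 * s.val 2) := (h1.sub (hlam.mul h2)).mono (by omega)
  by_cases hb : s.ctr (p + 65) = s.ctr 9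
  · simp [pushCode, getTour, getBlk, getPar, Blk.push, Item.at, h0, hb, e1, e2, e3, e4, hb ▸ hpos]
  · by_cases ht : s.ctr (p + 65) = 0 ∨
      s.val (p + 67) - s.val 9 * s.val (p + 68) < s.val 1 - s.val 9 * s.val 2
    · simp [pushCode, getTour, getBlk, getPar, Blk.push, Item.at, h0, hb, e1, e2, e3, e4, hpos, ht]
      grind
    · simp [pushCode, getTour, getBlk, getPar, Blk.push, Item.at, h0, hb, e1, e2, e3, e4, hpos, ht]
      grind

theorem emitCode_wp {p : ℕ} {P : Par} (hK : 50 ≤ K) (hP : getPar s = P)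
    (hc : (getBlk p s).Fits T) (hidx : (getBlk p s).idx + 1 ≤ (Fintype.card V + 1) ^ K)
    (hb : 2 * P.b ≤ (Fintype.card V + 1) ^ K) :
    (emitCode p).wp T K (fun s' => getTour p s' = getTour p s ∧
      getBlk p s' = (getBlk p s).emit P) s := by
  subst hP
  obtain ⟨hdl, hkl, hdc, hkc, -, -⟩ := hc
  simp only [getBlk, getPar] at hdl hkl hdc hkc hidx hb
  have e1 : Fit T K (s.val (p + 65) - s.val (p + 67)) := (hdl.sub hdc).mono (by omega)
  have e2 : Fit T K (s.val (p + 66) - s.val (p + 68)) := (hkl.sub hkc).mono (by omega)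
  have e3 : Fit T K ((s.val (p + 65) - s.val (p + 67)) / (s.val (p + 66) - s.val (p + 68))) :=
    ((hdl.sub hdc).div (hkl.sub hkc)).mono (by omega)
  rw [two_mul] at hb
  set x := (s.val (p + 65) - s.val (p + 67)) / (s.val (p + 66) - s.val (p + 68)) with hx
  have hF : (getBlk p s).Full (getPar s) ↔
      s.ctr (p + 65) = s.ctr 9 + s.ctr 9 ∨ s.ctr (p + 66) + 1 = s.ctr 8 ∧ s.ctr 9 < s.ctr (p + 65) := by
    rw [Blk.Full, two_mul]
    rfl
  by_cases hf : (getBlk p s).Full (getPar s) ∧ s.val 10 < x ∧ x < s.val 11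
  · have hf' : (getBlk p s).Full (getPar s) ∧ (getPar s).lo < (getBlk p s).cross ∧
        (getBlk p s).cross < (getPar s).hi := hf
    rw [Blk.emit, if_pos hf']
    obtain ⟨hf1, hf2, hf3⟩ := hf
    rw [hF] at hf1
    by_cases hpos : s.ctr (p + 65) = s.ctr 9 + s.ctr 9
    · simp [emitCode, e1, e2, e3, hidx, hb, ← hx, hf2, hf3, hpos, getTour, getBlk, getPar,
        Blk.cross, two_mul]
    · simp [emitCode, e1, e2, e3, hb, ← hx, hf2, hf3, hpos, getTour, getBlk, getPar,
        Blk.cross, two_mul, hf1.resolve_left hpos, (hf1.resolve_left hpos).1 ▸ hidx]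
  · have hf' : ¬ ((getBlk p s).Full (getPar s) ∧ (getPar s).lo < (getBlk p s).cross ∧
        (getBlk p s).cross < (getPar s).hi) := hf
    rw [Blk.emit, if_neg hf']
    rw [hF] at hf
    by_cases hpos : s.ctr (p + 65) = s.ctr 9 + s.ctr 9 <;>
      by_cases hdm : s.val (p + 69) = s.val 10 <;>
      simp [emitCode, e1, e2, e3, hidx, hb, ← hx, getTour, getBlk, getPar, two_mul, hpos, hdm] <;>
      grind

end Agree

/-! ## Cells -/

/-- Move to the next cell of the list, that is, by two states of the tour. -/
def cellCode (p : ℕ) : Prog TreeQuery :=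
  itemCode p ;; pushCode p ;; advCode p ;; itemCode p ;; pushCode p ;; advCode p ;; emitCode p

/-- Move in front of the first cell of the list. -/
def startCode (p : ℕ) : Prog TreeQuery :=
  .instr (.ptrCopy (p + 64) 8) ;; .instr (.ptrCopy (p + 65) 8) ;; .instr (.ptrNull (p + 66)) ;;
  .instr (.ptrNull (p + 67)) ;; .instr (.ctrConst (p + 64) 0) ;; .instr (.ctrConst (p + 65) 0) ;;
  .instr (.ctrConst (p + 66) 0) ;; .instr (.valConst (p + 64) 0) ;;
  .instr (.valConst (p + 65) 0) ;; .instr (.valConst (p + 66) 0) ;;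
  .instr (.valConst (p + 67) 0) ;; .instr (.valConst (p + 68) 0) ;;
  .instr (.valCopy (p + 69) 11) ;; .instr (.valConst (p + 70) 0)

theorem cellCode_targets (p : ℕ) : (cellCode p).Targets (Local p) :=
  ⟨itemCode_targets p, pushCode_targets p, advCode_targets p, itemCode_targets p,
    pushCode_targets p, advCode_targets p, emitCode_targets p⟩

theorem startCode_targets (p : ℕ) : (startCode p).Targets (Local p) := by
  simp [startCode, Prog.Targets, Instr.target, Local]

/-- Admissible parameters. -/
structure Par.Good {V : Type*} [Fintype V] (T : TreeNetwork V) (P : Par) : Prop where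
  N : P.N = Fintype.card V
  b_pos : 0 < P.b
  b_le : P.b ≤ 4 * Fintype.card V
  lam : Fit T 22 P.lam
  lo : Fit T 10 P.lo
  hi : Fit T 10 P.hi

/-- The parameters and the start of the tour are stored in the registers for them. -/
structure Env {V : Type*} (T : TreeNetwork V) (v : V) (P : Par) (s : Store V) : Prop where
  zero : s.ctr 0 = 0
  par : getPar s = P
  start : s.ptr 8 = some v
  k0 : P.k0 = 1 / T.weight v

/-- The bundle of registers `p` describes cell `j` of the list, `0` meaning that we are in front
of the list. -/
def AtCell {V : Type*} [DecidableEq V] (T : TreeNetwork V) (v : V) (P : Par) (p j : ℕ)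
    (s : Store V) : Prop :=
  getTour p s = Tour.event T v (2 * j) ∧ getBlk p s = Blk.run P (T.items v) j

section Cells

variable {V : Type*} {T : TreeNetwork V} {v : V} {P : Par} {p j : ℕ} {s s' : Store V}

theorem Env.agree {S : ℕ → Prop} (h : Env T v P s) (hs : Agree S s s') (h0 : ¬ S 0)
    (hS : ∀ i, 8 ≤ i → i < 12 → ¬ S i) : Env T v P s' := by
  obtain ⟨h₁, h₂, h₃, h₄⟩ := h
  refine ⟨(hs 0 h0).1.trans h₁, ?_, (hs 8 (hS 8 le_rfl (by omega))).2.1.trans h₃, h₄⟩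
  have a8 := hs 8 (hS 8 le_rfl (by omega))
  have a9 := hs 9 (hS 9 (by omega) (by omega))
  have a10 := hs 10 (hS 10 (by omega) (by omega))
  have a11 := hs 11 (hS 11 (by omega) (by omega))
  rw [← h₂, getPar, getPar, a8.1, a9.1, a8.2.2, a9.2.2, a10.2.2, a11.2.2]

theorem Env.agree_local (h : Env T v P s) (hs : Agree (Local p) s s') : Env T v P s' :=
  h.agree hs (by simp [Local]) fun i h₁ h₂ => by simp only [Local]; omega

theorem Blk.run_pos_le (P : Par) (L : ℕ → Item V) (j : ℕ) : (Blk.run P L j).pos ≤ 2 * j := by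
  induction j with
  | zero => simp [Blk.run, Blk.start]
  | succ j ih =>
    rw [Blk.run, Blk.emit_pos, Blk.push₂_pos]
    split_ifs <;> omega

variable [Fintype V] {K : ℕ}

theorem lt_words (hK : 10 ≤ K) {m : ℕ} (hm : m ≤ 8 * Fintype.card V) :
    m ≤ (Fintype.card V + 1) ^ K := by
  rcases Nat.eq_zero_or_pos (Fintype.card V) with h | h
  · omega
  calc m ≤ 2 ^ 3 * (Fintype.card V + 1) := by omega
    _ ≤ (Fintype.card V + 1) ^ 3 * (Fintype.card V + 1) :=
      Nat.mul_le_mul_right _ (Nat.pow_le_pow_left (by omega) _)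
    _ = (Fintype.card V + 1) ^ 4 := by ring
    _ ≤ _ := Nat.pow_le_pow_right (by omega) (by omega)

variable [DecidableEq V]

theorem startCode_wp (hE : Env T v P s) : (startCode p).wp T K
    (fun s' => Agree (Local p) s s' ∧ AtCell T v P p 0 s') s := by
  refine Prog.wp_agree (startCode_targets p) ?_
  have h1 : Fit T K 0 := Fit.zero
  have h2 := hE.start
  have h3 : s.val 11 = P.hi := by rw [← hE.par]; rfl
  simp [startCode, AtCell, getTour, getBlk, h1, h2, h3, Tour.event, Tour.start, Blk.run, Blk.start]

/-- The effect of processing one state of the tour. -/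
theorem eventCode_wp (hK : 50 ≤ K) (hP : P.Good T) (hE : Env T v P s) {i : ℕ} {c : Blk V}
    (hi : i < 2 * Fintype.card V)
    (ht : getTour p s = Tour.event T v i) (hc : getBlk p s = c) (hfit : c.Fits T)
    (hpos : c.pos < 2 * Fintype.card V) {d : Prog TreeQuery} {q : Store V → Prop}
    (h : ∀ s', Env T v P s' → getTour p s' = Tour.event T v (i + 1) →
      getBlk p s' = c.push P (T.items v i) → d.wp T K q s') :
    (itemCode p ;; pushCode p ;; advCode p ;; d).wp T K q s := by
  refine Prog.wp_seq.2 (Prog.wp_mono (Prog.wp_agree (itemCode_targets p) (itemCode_wp hK hE.zero)) ?_)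
  rintro s₁ ⟨hA₁, hI, hT₁, hB₁⟩
  have hE₁ := hE.agree_local hA₁
  have hval : s.val 8 = 1 / T.weight v := by
    rw [← hE.k0, ← hE.par]
    rfl
  rw [ht, hval] at hI
  change _ = T.items v i at hI
  have hd := TreeNetwork.fit_items (T := T) (v := v) hi
  have e1 : s₁.val 1 = (T.items v i).d := by rw [← hI]
  have e2 : s₁.val 2 = (T.items v i).k := by rw [← hI]
  rw [hc] at hB₁
  refine Prog.wp_seq.2 (Prog.wp_mono (Prog.wp_agree (pushCode_targets p) (pushCode_wp hK hE₁.zero hE₁.par hP.lam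
    (hB₁ ▸ hfit) (e1 ▸ hd.1) (e2 ▸ hd.2) (hB₁ ▸ lt_words (by omega) (by omega)))) ?_)
  rintro s₂ ⟨hA₂, hT₂, hB₂⟩
  have hE₂ := hE₁.agree_local hA₂
  rw [hI, hB₁] at hB₂
  rw [hT₁, ht] at hT₂
  obtain ⟨x, a, -, -, -, hD, -⟩ := (Tour.event_spec T v).1 i hi
  have hD' : Fit T 10 (s₂.val (p + 64)) := by
    have : s₂.val (p + 64) = (Tour.event T v i).D := by rw [← hT₂]; rfl
    rw [this, hD]
    exact (TreeNetwork.fit_vdist _ _).mono (by omega)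
  refine Prog.wp_seq.2 (Prog.wp_mono (Prog.wp_agree (advCode_targets p) (advCode_wp hK hE₂.zero hD')) ?_)
  rintro s₃ ⟨hA₃, hT₃, hB₃⟩
  rw [hT₂, ← Tour.event_succ] at hT₃
  exact h s₃ (hE₂.agree_local hA₃) hT₃ (hB₃.trans hB₂)

theorem cellCode_wp (hK : 50 ≤ K) (hP : P.Good T) (hE : Env T v P s)
    (hj : j < Fintype.card V) (hc : AtCell T v P p j s) : (cellCode p).wp T K
    (fun s' => Agree (Local p) s s' ∧ AtCell T v P p (j + 1) s') s := by
  refine Prog.wp_agree (cellCode_targets p) ?_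
  have hf := Blk.fits_run (T := T) (v := v) hP.lo hP.hi hj.le
  have hpos := Blk.run_pos_le P (T.items v) j
  have hfi := fun i => TreeNetwork.fit_items (T := T) (v := v) (i := i)
  refine eventCode_wp hK hP hE (i := 2 * j) (by omega) hc.1 hc.2 hf (by omega) ?_
  intro s₁ hE₁ hT₁ hB₁
  have hf₁ := hf.push (P := P) (hfi (2 * j) (by omega)).1 (hfi (2 * j) (by omega)).2
  refine eventCode_wp hK hP hE₁ (by omega) hT₁ hB₁ hf₁ (by rw [Blk.push_pos]; omega) ?_
  intro s₂ hE₂ hT₂ hB₂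
  have hf₂ := hf₁.push (P := P) (hfi (2 * j + 1) (by omega)).1 (hfi (2 * j + 1) (by omega)).2
  have hidx := Blk.run_idx (L := T.items v) hP.b_pos j
  refine Prog.wp_mono (emitCode_wp hK hE₂.par (hB₂ ▸ hf₂) ?_ ?_) ?_
  · rw [hB₂, Blk.push_idx, Blk.push_idx, hidx]
    exact lt_words (by omega) (by omega)
  · exact lt_words (by omega) (by have := hP.b_le; omega)
  · rintro s₃ ⟨hT₃, hB₃⟩
    exact ⟨hT₃.trans hT₂, by rw [hB₃, hB₂]; rfl⟩

end Cells

/-! ## Simulation of programs for lists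

Register `i` of a program for lists is stored in the bundle of registers `8 * i`, a pointer being
represented by a state of the enumeration of the cells. -/

def copyCode (p q : ℕ) : Prog TreeQuery :=
  .instr (.ctrCopy (p + 64) (q + 64)) ;; .instr (.ctrCopy (p + 65) (q + 65)) ;;
  .instr (.ctrCopy (p + 66) (q + 66)) ;; .instr (.ptrCopy (p + 64) (q + 64)) ;;
  .instr (.ptrCopy (p + 65) (q + 65)) ;; .instr (.ptrCopy (p + 66) (q + 66)) ;;
  .instr (.ptrCopy (p + 67) (q + 67)) ;; .instr (.valCopy (p + 64) (q + 64)) ;;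
  .instr (.valCopy (p + 65) (q + 65)) ;; .instr (.valCopy (p + 66) (q + 66)) ;;
  .instr (.valCopy (p + 67) (q + 67)) ;; .instr (.valCopy (p + 68) (q + 68)) ;;
  .instr (.valCopy (p + 69) (q + 69)) ;; .instr (.valCopy (p + 70) (q + 70))

/-- Cells are numbered from `1` in the counter of the bundle, so `0` there encodes the null pointer
whatever the other registers contain. Reading a cell costs nothing extra, as the scan has already
computed its content. -/
def Instr.sim : Instr ListQuery → Prog TreeQuery
  | .ctrConst i k => .instr (.ctrConst (8 * i + 71) k)
  | .ctrCopy i j => .instr (.ctrCopy (8 * i + 71) (8 * j + 71))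
  | .ctrArith op i j k => .instr (.ctrArith op (8 * i + 71) (8 * j + 71) (8 * k + 71))
  | .ptrNull i => .instr (.ctrConst (8 * i + 66) 0)
  | .ptrCopy i j => copyCode (8 * i) (8 * j)
  | .valConst i k => .instr (.valConst (8 * i + 71) k)
  | .valCopy i j => .instr (.valCopy (8 * i + 71) (8 * j + 71))
  | .valArith op i j k => .instr (.valArith op (8 * i + 71) (8 * j + 71) (8 * k + 71))
  | .query (.first i) => startCode (8 * i) ;; cellCode (8 * i)
  | .query (.next i j) => copyCode (8 * i) (8 * j) ;;
      .ite (.ctrEq (8 * i + 66) 0) .skip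
        (.ite (.ctrEq (8 * i + 66) 8) (.instr (.ctrConst (8 * i + 66) 0)) (cellCode (8 * i)))
  | .query (.read i j) => .ite (.ctrEq (8 * j + 66) 0) (.instr (.valConst (8 * i + 71) 0))
      (.instr (.valCopy (8 * i + 71) (8 * j + 70)))

def Test.sim : Test → Test
  | .ctrEq i j => .ctrEq (8 * i + 71) (8 * j + 71)
  | .ctrLt i j => .ctrLt (8 * i + 71) (8 * j + 71)
  | .ptrIsNull i => .ctrEq (8 * i + 66) 0
  | .ptrEq i j => .ctrEq (8 * i + 66) (8 * j + 66)
  | .valEq i j => .valEq (8 * i + 71) (8 * j + 71)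
  | .valLt i j => .valLt (8 * i + 71) (8 * j + 71)
  | .not b => .not b.sim
  | .and b c => .and b.sim c.sim

def Prog.sim : Prog ListQuery → Prog TreeQuery
  | .skip => .skip
  | .instr a => a.sim
  | .seq c d => .seq c.sim d.sim
  | .ite b c d => .ite b.sim c.sim d.sim
  | .loop b c => .loop b.sim c.sim

/-- The registers that occur in an instruction, the target being the first. -/
def Instr.regs : Instr ListQuery → List ℕ
  | .ctrConst i _ => [i]
  | .ctrCopy i j => [i, j]
  | .ctrArith _ i j k => [i, j, k]
  | .ptrNull i => [i]
  | .ptrCopy i j => [i, j]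
  | .valConst i _ => [i]
  | .valCopy i j => [i, j]
  | .valArith _ i j k => [i, j, k]
  | .query (.first i) => [i]
  | .query (.next i j) => [i, j]
  | .query (.read i j) => [i, j]

def Test.regs : Test → List ℕ
  | .ctrEq i j => [i, j]
  | .ctrLt i j => [i, j]
  | .ptrIsNull i => [i]
  | .ptrEq i j => [i, j]
  | .valEq i j => [i, j]
  | .valLt i j => [i, j]
  | .not b => b.regs
  | .and b c => b.regs ++ c.regs

def Prog.regs : Prog ListQuery → List ℕ
  | .skip => []
  | .instr a => a.regs
  | .seq c d => c.regs ++ d.regs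
  | .ite b c d => b.regs ++ c.regs ++ d.regs
  | .loop b c => b.regs ++ c.regs

/-- Registers in the bundle that belongs to the register `i` of the simulated program. -/
def Bundle (i r : ℕ) : Prop := (1 ≤ r ∧ r < 8) ∨ (8 * i + 64 ≤ r ∧ r < 8 * i + 72)

/-- Registers used for the simulation of a program with registers below `m`. -/
def SimReg (m r : ℕ) : Prop := (1 ≤ r ∧ r < 8) ∨ (64 ≤ r ∧ r < 8 * m + 64)

theorem Prog.Targets.mono {S S' : ℕ → Prop} {c : Prog TreeQuery} (h : c.Targets S)
    (hS : ∀ i, S i → S' i) : c.Targets S' := by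
  induction c with
  | skip => trivial
  | instr a => exact hS _ h
  | seq c d ihc ihd => exact ⟨ihc h.1, ihd h.2⟩
  | ite b c d ihc ihd => exact ⟨ihc h.1, ihd h.2⟩
  | loop b c ih => exact ih h

theorem Local.bundle {i r : ℕ} (h : Local (8 * i) r) : Bundle i r := by
  simp only [Local, Bundle] at *
  omega

theorem Bundle.simReg {m i r : ℕ} (h : Bundle i r) (hi : i < m) : SimReg m r := by
  simp only [SimReg, Bundle] at *
  omega

theorem copyCode_targets (p q : ℕ) : (copyCode p q).Targets (Local p) := by
  simp [copyCode, Prog.Targets, Instr.target, Local]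

/-- The register that is modified by an instruction. -/
def Instr.dest (a : Instr ListQuery) : ℕ := a.regs.headD 0

theorem Instr.dest_mem (a : Instr ListQuery) : a.dest ∈ a.regs := by
  cases a with
  | query q => cases q <;> simp [Instr.dest, Instr.regs]
  | _ => simp [Instr.dest, Instr.regs]

theorem Instr.sim_targets (a : Instr ListQuery) : a.sim.Targets (Bundle a.dest) := by
  have h₁ := fun i => (cellCode_targets (8 * i)).mono fun _ => Local.bundle
  have h₂ := fun i => (startCode_targets (8 * i)).mono fun _ => Local.bundle
  have h₃ := fun i q => (copyCode_targets (8 * i) q).mono fun _ => Local.bundle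
  have h₄ : ∀ i, Bundle i (8 * i + 66) ∧ Bundle i (8 * i + 71) := by
    simp [Bundle]
  cases a with
  | query q =>
    cases q <;> simp [Instr.sim, Instr.dest, Instr.regs, Prog.Targets, Instr.target, h₁, h₂, h₃, h₄]
  | _ => simp [Instr.sim, Instr.dest, Instr.regs, Prog.Targets, Instr.target, h₃, h₄]

theorem Prog.sim_targets {m : ℕ} {A : Prog ListQuery} (h : ∀ i ∈ A.regs, i < m) :
    A.sim.Targets (SimReg m) := by
  induction A with
  | skip => trivial
  | instr a => exact a.sim_targets.mono fun r hr => hr.simReg (h _ a.dest_mem)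
  | seq c d ihc ihd =>
    simp only [Prog.regs, List.mem_append] at h
    exact ⟨ihc fun i hi => h i (.inl hi), ihd fun i hi => h i (.inr hi)⟩
  | ite b c d ihc ihd =>
    simp only [Prog.regs, List.mem_append] at h
    exact ⟨ihc fun i hi => h i (.inl (.inr hi)), ihd fun i hi => h i (.inr hi)⟩
  | loop b c ih =>
    simp only [Prog.regs, List.mem_append] at h
    exact ih fun i hi => h i (.inr hi)

theorem Instr.sim_size (a : Instr ListQuery) : a.sim.size ≤ 200 := by
  cases a with
  | query q =>
    cases q <;> simp [Instr.sim, Prog.size, copyCode, startCode, cellCode, itemCode, pushCode,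
      advCode, goToCode, emitCode]
  | _ => simp [Instr.sim, Prog.size, copyCode]

/-! ### Correctness of the simulation -/

section Sim

variable {V : Type*}

theorem getTour_agree {S : ℕ → Prop} {p : ℕ} {s s' : Store V} (h : Agree S s s')
    (hS : ∀ r, p + 64 ≤ r → r < p + 71 → ¬ S r) :
    getTour p s' = getTour p s ∧ getBlk p s' = getBlk p s := by
  have a4 := h (p + 64) (hS _ (by omega) (by omega))
  have a5 := h (p + 65) (hS _ (by omega) (by omega))
  have a6 := h (p + 66) (hS _ (by omega) (by omega))
  have a7 := h (p + 67) (hS _ (by omega) (by omega))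
  have a8 := h (p + 68) (hS _ (by omega) (by omega))
  have a9 := h (p + 69) (hS _ (by omega) (by omega))
  have a10 := h (p + 70) (hS _ (by omega) (by omega))
  simp [getTour, getBlk, a4, a5, a6, a7, a8, a9, a10]

variable [DecidableEq V] [Fintype V] {T : TreeNetwork V} {v : V} {P : Par}

/-- The bundle `p` represents the pointer `o`. -/
def PtrRel (T : TreeNetwork V) (v : V) (P : Par) (p : ℕ) (s : Store V) :
    Option (Fin (Fintype.card V)) → Prop
  | none => s.ctr (p + 66) = 0
  | some c => AtCell T v P p (c + 1) s

/-- Register `i` of the store `σ` is represented in the store `s`. -/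
structure RegRel (T : TreeNetwork V) (v : V) (P : Par) (σ : Store (Fin (Fintype.card V)))
    (s : Store V) (i : ℕ) : Prop where
  ctr : s.ctr (8 * i + 71) = σ.ctr i
  val : s.val (8 * i + 71) = σ.val i
  ptr : PtrRel T v P (8 * i) s (σ.ptr i)

/-- The store `s` represents the first `m` registers of the store `σ` of a list program. -/
structure SimRel (T : TreeNetwork V) (v : V) (P : Par) (m : ℕ)
    (σ : Store (Fin (Fintype.card V))) (s : Store V) : Prop where
  env : Env T v P s
  reg : ∀ i < m, RegRel T v P σ s i

/-- The list that is given to the simulated program. -/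
noncomputable def cells (T : TreeNetwork V) (v : V) (P : Par) (j : Fin (Fintype.card V)) : ℝ :=
  (Blk.run P (T.items v) (j + 1)).out

variable {p q : ℕ} {s s' : Store V} {o : Option (Fin (Fintype.card V))}

theorem PtrRel.of_eq (h : PtrRel T v P q s o) (h₁ : getTour p s' = getTour q s)
    (h₂ : getBlk p s' = getBlk q s) : PtrRel T v P p s' o := by
  cases o with
  | none => exact (congrArg Blk.idx h₂).trans h
  | some c => exact ⟨h₁.trans h.1, h₂.trans h.2⟩

theorem PtrRel.agree {S : ℕ → Prop} (h : PtrRel T v P p s o) (hs : Agree S s s')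
    (hS : ∀ r, p + 64 ≤ r → r < p + 71 → ¬ S r) : PtrRel T v P p s' o :=
  let ⟨h₁, h₂⟩ := getTour_agree hs hS
  h.of_eq h₁ h₂

/-- One counter identifies the cell, which is why equality of simulated pointers can be tested on
it. -/
theorem PtrRel.idx (hP : P.Good T) (h : PtrRel T v P p s o) :
    s.ctr (p + 66) = (o.elim 0 fun c => (c : ℕ) + 1 : ℕ) := by
  cases o with
  | none => exact h
  | some c => exact (congrArg Blk.idx h.2).trans (Blk.run_idx hP.b_pos _)

variable {m K : ℕ} {σ σ' : Store (Fin (Fintype.card V))}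

/-- Bundles are disjoint, so only the bundle of the destination has to be examined after an
instruction. -/
theorem SimRel.of_target {i : ℕ} (h : SimRel T v P m σ s) (hs : Agree (Bundle i) s s')
    (hi : RegRel T v P σ' s' i) (hσ : Agree (· = i) σ σ') : SimRel T v P m σ' s' := by
  refine ⟨h.env.agree hs (by simp [Bundle]) fun r h₁ h₂ => by simp only [Bundle]; omega,
    fun k hk => ?_⟩
  by_cases hki : k = i
  · exact hki ▸ hi
  · obtain ⟨h₁, h₂, h₃⟩ := h.reg k hk
    obtain ⟨e₁, e₂, e₃⟩ := hσ k hki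
    have := hs (8 * k + 71) (by simp only [Bundle]; omega)
    exact ⟨by rw [this.1, h₁, e₁], by rw [this.2.2, h₂, e₃],
      e₂ ▸ h₃.agree hs fun r h₁ h₂ => by simp only [Bundle]; omega⟩

theorem Test.sim_holds (hP : P.Good T) (h : SimRel T v P m σ s) {b : Test}
    (hb : ∀ i ∈ b.regs, i < m) : b.sim.Holds s ↔ b.Holds σ := by
  induction b with
  | ctrEq i j =>
    simp only [Test.regs, List.mem_cons, List.not_mem_nil, or_false, forall_eq_or_imp, forall_eq] at hb
    simp [Test.sim, (h.reg i hb.1).ctr, (h.reg j hb.2).ctr]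
  | ctrLt i j =>
    simp only [Test.regs, List.mem_cons, List.not_mem_nil, or_false, forall_eq_or_imp, forall_eq] at hb
    simp [Test.sim, (h.reg i hb.1).ctr, (h.reg j hb.2).ctr]
  | ptrIsNull i =>
    have := (h.reg i (hb i (by simp [Test.regs]))).ptr.idx hP
    simp only [Test.sim, Test.Holds, this, h.env.zero]
    cases σ.ptr i <;> simp
  | ptrEq i j =>
    simp only [Test.regs, List.mem_cons, List.not_mem_nil, or_false, forall_eq_or_imp, forall_eq] at hb
    simp only [Test.sim, Test.Holds, (h.reg i hb.1).ptr.idx hP, (h.reg j hb.2).ptr.idx hP]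
    cases σ.ptr i <;> cases σ.ptr j <;> simp [Fin.ext_iff]
  | valEq i j =>
    simp only [Test.regs, List.mem_cons, List.not_mem_nil, or_false, forall_eq_or_imp, forall_eq] at hb
    simp [Test.sim, (h.reg i hb.1).val, (h.reg j hb.2).val]
  | valLt i j =>
    simp only [Test.regs, List.mem_cons, List.not_mem_nil, or_false, forall_eq_or_imp, forall_eq] at hb
    simp [Test.sim, (h.reg i hb.1).val, (h.reg j hb.2).val]
  | not b ih => exact not_congr (ih hb)
  | and b c ihb ihc =>
    simp only [Test.regs, List.mem_append] at hb
    exact and_congr (ihb fun i hi => hb i (.inl hi)) (ihc fun i hi => hb i (.inr hi))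

theorem copyCode_wp (i j : ℕ) : (copyCode (8 * i) (8 * j)).wp T K
    (fun s' => getTour (8 * i) s' = getTour (8 * j) s ∧ getBlk (8 * i) s' = getBlk (8 * j) s ∧
      Agree (Local (8 * i)) s s') s := by
  refine Prog.wp_mono (Prog.wp_agree (copyCode_targets (8 * i) (8 * j))
    (q := fun s' => getTour (8 * i) s' = getTour (8 * j) s ∧ getBlk (8 * i) s' = getBlk (8 * j) s)
    ?_) fun s' h => ⟨h.2.1, h.2.2, h.1⟩
  by_cases hij : i = j
  · subst hij
    simp [copyCode, getTour, getBlk]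
  · have h₁ : 8 * j + 1 ≠ 8 * i := by omega
    simp (disch := omega) [copyCode, getTour, getBlk, if_neg, h₁]

theorem fit_cells (hP : P.Good T) (j : Fin (Fintype.card V)) : Fit T 10 (cells T v P j) :=
  (Blk.fits_run hP.lo hP.hi j.2).out

/-- With `X = n + B + 1` the cells have height at most `X ^ 10`, so the list program stays below `(n
+ X ^ 10 + 1) ^ k ≤ X ^ (11 * k)`. -/
theorem ListWords.fit {k : ℕ} (hP : P.Good T) (h : ListWords (cells T v P) k σ) (i : ℕ) :
    Fit T (11 * k) (σ.val i) := by
  rw [fit_def]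
  intro B h₁ h₂
  have hc := fun j => (fit_def _ _).1 (fit_cells (v := v) hP j) B h₁ h₂
  refine (h.2 _ hc i).mono ?_
  have := T.card_pos
  rw [pow_mul]
  refine Nat.pow_le_pow_left ?_ k
  have e : Fintype.card V + B + 1 ≤ (Fintype.card V + B + 1) ^ 10 := Nat.le_self_pow (by omega) _
  have e' := Nat.mul_le_mul_left ((Fintype.card V + B + 1) ^ 10)
    (show 2 ≤ Fintype.card V + B + 1 by omega)
  rw [pow_succ _ 10]
  omega

/-- The word bound for a simulated result is inherited from `hW`; only the scanning code for the
list queries needs the bounds proved above. -/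
theorem Instr.sim_wp {k : ℕ} (hK : 50 + 11 * k ≤ K) (hP : P.Good T) (h : SimRel T v P m σ s)
    {a : Instr ListQuery} (ha : ∀ i ∈ a.regs, i < m)
    (hW : ListWords (cells T v P) k (a.run (ListQuery.ask (cells T v P)) σ)) :
    a.sim.wp T K
      (fun s' => RegRel T v P (a.run (ListQuery.ask (cells T v P)) σ) s' a.dest) s := by
  have hctr : ∀ i, (a.run (ListQuery.ask (cells T v P)) σ).ctr i ≤ (Fintype.card V + 1) ^ K :=
    fun i => (hW.1 i).trans (Nat.pow_le_pow_right (by omega) (by omega))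
  have hval : ∀ i, Fit T K ((a.run (ListQuery.ask (cells T v P)) σ).val i) :=
    fun i => (ListWords.fit hP hW i).mono (by omega)
  have h71 : ∀ i s', Agree (· = 8 * i + 71) s s' → i < m → PtrRel T v P (8 * i) s' (σ.ptr i) :=
    fun i s' hs hi => (h.reg i hi).ptr.agree hs fun r _ _ => by omega
  have hset : ∀ i j x, Agree (· = i) s (s.setCtr i j) ∧ Agree (· = i) s (s.setVal i x) :=
    fun i j x => ⟨fun r hr => by simp [hr], fun r hr => by simp [hr]⟩
  cases a with
  | ctrConst i j =>
    simp only [Instr.regs, List.mem_cons, List.not_mem_nil, or_false, forall_eq] at ha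
    refine ⟨by simpa [Instr.run, Instr.Ok] using hctr i, ?_, ?_, h71 i _ (hset _ _ 0).1 ha⟩
    · simp [Instr.run, Instr.dest, Instr.regs]
    · simpa [Instr.run, Instr.dest, Instr.regs] using (h.reg i ha).val
  | ctrCopy i j =>
    simp only [Instr.regs, List.mem_cons, List.not_mem_nil, or_false, forall_eq_or_imp,
      forall_eq] at ha
    refine ⟨trivial, ?_, ?_, h71 i _ (hset _ _ 0).1 ha.1⟩
    · simpa [Instr.run, Instr.dest, Instr.regs] using (h.reg j ha.2).ctr
    · simpa [Instr.run, Instr.dest, Instr.regs] using (h.reg i ha.1).val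
  | ctrArith op i j l =>
    simp only [Instr.regs, List.mem_cons, List.not_mem_nil, or_false, forall_eq_or_imp,
      forall_eq] at ha
    have e : op.onCtr (s.ctr (8 * j + 71)) (s.ctr (8 * l + 71)) =
        op.onCtr (σ.ctr j) (σ.ctr l) := by rw [(h.reg j ha.2.1).ctr, (h.reg l ha.2.2).ctr]
    refine ⟨?_, ?_, ?_, h71 i _ (hset _ _ 0).1 ha.1⟩
    · have := hctr i
      simp only [Instr.run, Store.setCtr_ctr, if_true, ← e] at this
      exact this
    · simp only [Instr.run, Instr.dest, Instr.regs, Store.setCtr_ctr, if_true, List.headD_cons, e]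
    · simpa [Instr.run, Instr.dest, Instr.regs] using (h.reg i ha.1).val
  | ptrNull i =>
    simp only [Instr.regs, List.mem_cons, List.not_mem_nil, or_false, forall_eq] at ha
    refine ⟨Nat.zero_le _, ?_, ?_, ?_⟩
    · simpa [Instr.run, Instr.dest, Instr.regs] using (h.reg i ha).ctr
    · simpa [Instr.run, Instr.dest, Instr.regs] using (h.reg i ha).val
    · simp [Instr.run, Instr.dest, Instr.regs, PtrRel]
  | ptrCopy i j =>
    simp only [Instr.regs, List.mem_cons, List.not_mem_nil, or_false, forall_eq_or_imp,
      forall_eq] at ha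
    refine Prog.wp_mono (copyCode_wp i j) ?_
    rintro s' ⟨h₁, h₂, h₃⟩
    have := h₃ (8 * i + 71) (by simp only [Local]; omega)
    refine ⟨this.1.trans (h.reg i ha.1).ctr, this.2.2.trans (h.reg i ha.1).val, ?_⟩
    simpa [Instr.run, Instr.dest, Instr.regs] using (h.reg j ha.2).ptr.of_eq h₁ h₂
  | valConst i j =>
    simp only [Instr.regs, List.mem_cons, List.not_mem_nil, or_false, forall_eq] at ha
    refine ⟨by simpa [Instr.run, Instr.Ok] using hval i, ?_, ?_, h71 i _ (hset _ 0 _).2 ha⟩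
    · simpa [Instr.run, Instr.dest, Instr.regs] using (h.reg i ha).ctr
    · simp [Instr.run, Instr.dest, Instr.regs]
  | valCopy i j =>
    simp only [Instr.regs, List.mem_cons, List.not_mem_nil, or_false, forall_eq_or_imp,
      forall_eq] at ha
    refine ⟨trivial, ?_, ?_, h71 i _ (hset _ 0 _).2 ha.1⟩
    · simpa [Instr.run, Instr.dest, Instr.regs] using (h.reg i ha.1).ctr
    · simpa [Instr.run, Instr.dest, Instr.regs] using (h.reg j ha.2).val
  | valArith op i j l =>
    simp only [Instr.regs, List.mem_cons, List.not_mem_nil, or_false, forall_eq_or_imp,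
      forall_eq] at ha
    have e : op.onVal (s.val (8 * j + 71)) (s.val (8 * l + 71)) =
        op.onVal (σ.val j) (σ.val l) := by rw [(h.reg j ha.2.1).val, (h.reg l ha.2.2).val]
    refine ⟨?_, ?_, ?_, h71 i _ (hset _ 0 _).2 ha.1⟩
    · have := hval i
      simp only [Instr.run, Store.setVal_val, if_true, ← e] at this
      exact this
    · simpa [Instr.run, Instr.dest, Instr.regs] using (h.reg i ha.1).ctr
    · simp only [Instr.run, Instr.dest, Instr.regs, Store.setVal_val, if_true, List.headD_cons, e]
  | query q =>
    have hn := T.card_pos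
    cases q with
    | first i =>
      simp only [Instr.regs, List.mem_cons, List.not_mem_nil, or_false, forall_eq] at ha
      refine Prog.wp_seq.2 (Prog.wp_mono (startCode_wp h.env) ?_)
      rintro s₁ ⟨hA₁, h₁⟩
      refine Prog.wp_mono (cellCode_wp (by omega) hP (h.env.agree_local hA₁) hn h₁) ?_
      rintro s₂ ⟨hA₂, h₂⟩
      have := (hA₁.trans hA₂) (8 * i + 71) (by simp only [Local]; omega)
      refine ⟨this.1.trans (h.reg i ha).ctr, this.2.2.trans (h.reg i ha).val, ?_⟩
      simpa [Instr.run, Instr.dest, Instr.regs, ListQuery.ask, hn, PtrRel] using h₂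
    | next i j =>
      simp only [Instr.regs, List.mem_cons, List.not_mem_nil, or_false, forall_eq_or_imp,
        forall_eq] at ha
      refine Prog.wp_seq.2 (Prog.wp_mono (copyCode_wp i j) ?_)
      rintro s₁ ⟨h₁, h₂, hA₁⟩
      have h71 := hA₁ (8 * i + 71) (by simp only [Local]; omega)
      have hc := h71.1.trans (h.reg i ha.1).ctr
      have hv := h71.2.2.trans (h.reg i ha.1).val
      have hE := h.env.agree_local hA₁
      have hp := (h.reg j ha.2).ptr.of_eq h₁ h₂
      have hidx := hp.idx hP
      have hN : s₁.ctr 8 = Fintype.card V := by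
        rw [← hP.N, ← hE.par]
        rfl
      cases hσ : σ.ptr j with
      | none =>
        rw [hσ] at hp hidx
        simp only [Option.elim] at hidx
        simp only [Prog.wp_ite, Test.Holds, hE.zero, hidx, forall_const, not_true, false_imp_iff,
          and_true, Prog.wp_skip]
        exact ⟨hc, hv, by simpa [Instr.run, Instr.dest, Instr.regs, ListQuery.ask, hσ] using hp⟩
      | some c =>
        rw [hσ] at hp hidx
        simp only [Option.elim] at hidx
        simp only [Prog.wp_ite, Test.Holds, hE.zero, hidx, Nat.succ_ne_zero, not_false_iff,
          false_imp_iff, true_and, forall_const, hN]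
        refine ⟨fun e => ⟨Nat.zero_le _, ?_, ?_, ?_⟩, fun e => ?_⟩
        · simpa [Instr.run, Instr.dest, Instr.regs, ListQuery.ask] using hc
        · simpa [Instr.run, Instr.dest, Instr.regs, ListQuery.ask] using hv
        · have : nextCell c = none := dif_neg (by omega)
          simp [Instr.run, Instr.dest, Instr.regs, ListQuery.ask, hσ, this, PtrRel]
        · have hlt : (c : ℕ) + 1 < Fintype.card V := by omega
          have : nextCell c = some ⟨c + 1, hlt⟩ := dif_pos hlt
          refine Prog.wp_mono (cellCode_wp (by omega) hP hE hlt hp) ?_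
          rintro s₂ ⟨hA₂, h₂⟩
          have h71' := hA₂ (8 * i + 71) (by simp only [Local]; omega)
          refine ⟨h71'.1.trans hc, h71'.2.2.trans hv, ?_⟩
          simpa [Instr.run, Instr.dest, Instr.regs, ListQuery.ask, hσ, this, PtrRel] using h₂
    | read i j =>
      simp only [Instr.regs, List.mem_cons, List.not_mem_nil, or_false, forall_eq_or_imp,
        forall_eq] at ha
      have hp := (h.reg j ha.2).ptr
      have hidx := hp.idx hP
      have hc := (h.reg i ha.1).ctr
      cases hσ : σ.ptr j with
      | none =>
        rw [hσ] at hp hidx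
        simp only [Option.elim] at hidx
        simp only [Instr.sim, Prog.wp_ite, Test.Holds, h.env.zero, hidx, forall_const, not_true,
          false_imp_iff, and_true, Prog.wp_valConst]
        refine ⟨by simpa using Fit.zero, ?_, ?_, h71 i _ (hset _ 0 _).2 ha.1⟩
        · simpa [Instr.run, Instr.dest, Instr.regs, ListQuery.ask] using hc
        · simp [Instr.run, Instr.dest, Instr.regs, ListQuery.ask, hσ]
      | some c =>
        rw [hσ] at hp hidx
        simp only [Option.elim] at hidx
        simp only [Instr.sim, Prog.wp_ite, Test.Holds, h.env.zero, hidx, Nat.succ_ne_zero,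
          not_false_iff, false_imp_iff, true_and, forall_const, Prog.wp_valCopy]
        refine ⟨?_, ?_, h71 i _ (hset _ 0 _).2 ha.1⟩
        · simpa [Instr.run, Instr.dest, Instr.regs, ListQuery.ask] using hc
        · have := congrArg Blk.out hp.2
          simpa [Instr.run, Instr.dest, Instr.regs, ListQuery.ask, hσ, cells, getBlk] using this

omit [DecidableEq V] in
theorem Instr.agree_dest {a : Fin (Fintype.card V) → ℝ} (c : Instr ListQuery) :
    Agree (· = c.dest) σ (c.run (ListQuery.ask a) σ) := by
  intro r hr
  cases c with
  | query q =>
    cases q <;> simp_all [Instr.run, ListQuery.ask, Instr.dest, Instr.regs]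
  | _ => simp_all [Instr.run, Instr.dest, Instr.regs]

/-- Control flow is copied literally and tests are equivalent in related stores, so only
instructions cost more: at most `200` steps each, by `Instr.sim_size`. -/
theorem Exec.sim {k : ℕ} (hK : 50 + 11 * k ≤ K) (hP : P.Good T) {A : Prog ListQuery} {t : ℕ}
    (h : Exec (ListQuery.ask (cells T v P)) (ListWords (cells T v P) k) A σ t σ')
    (hA : ∀ i ∈ A.regs, i < m) {s : Store V} (hs : TreeWords T K s)
    (hsim : SimRel T v P m σ s) :
    Runs (TreeQuery.ask T) (TreeWords T K) A.sim (200 * t) s (SimRel T v P m σ') := by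
  induction h generalizing s with
  | skip σ => exact ⟨0, s, .skip s, le_rfl, hsim⟩
  | instr a σ hW =>
    refine (Prog.wp_runs (by omega) hs (Prog.wp_agree a.sim_targets
      (Instr.sim_wp hK hP hsim hA hW))).mono a.sim_size ?_
    rintro s' ⟨h₁, h₂⟩
    exact hsim.of_target h₁ h₂ a.agree_dest
  | seq _ _ ihc ihd =>
    simp only [Prog.regs, List.mem_append] at hA
    rw [mul_add]
    exact Runs.seq (((ihc (fun i hi => hA i (.inl hi)) hs hsim).words hs).mono le_rfl
      fun s' h' => ihd (fun i hi => hA i (.inr hi)) h'.1 h'.2)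
  | iteTrue hb _ ih =>
    simp only [Prog.regs, List.mem_append] at hA
    obtain ⟨t, s', h₁, h₂, h₃⟩ := ih (fun i hi => hA i (.inl (.inr hi))) hs hsim
    exact ⟨_, s', .iteTrue ((Test.sim_holds hP hsim fun i hi => hA i (.inl (.inl hi))).2 hb) h₁,
      by omega, h₃⟩
  | iteFalse hb _ ih =>
    simp only [Prog.regs, List.mem_append] at hA
    obtain ⟨t, s', h₁, h₂, h₃⟩ := ih (fun i hi => hA i (.inr hi)) hs hsim
    exact ⟨_, s', .iteFalse ((Test.sim_holds hP hsim fun i hi => hA i (.inl (.inl hi))).not.2 hb)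
      h₁, by omega, h₃⟩
  | loopFalse hb =>
    simp only [Prog.regs, List.mem_append] at hA
    exact ⟨1, s, .loopFalse ((Test.sim_holds hP hsim fun i hi => hA i (.inl hi)).not.2 hb),
      by omega, hsim⟩
  | loopTrue hb _ _ ih₁ ih₂ =>
    have hA' := hA
    simp only [Prog.regs, List.mem_append] at hA'
    obtain ⟨t, s', h₁, h₂, h₃⟩ := ih₁ (fun i hi => hA' i (.inr hi)) hs hsim
    obtain ⟨t', s'', h₄, h₅, h₆⟩ := ih₂ hA (h₁.words hs) h₃
    exact ⟨_, s'', .loopTrue ((Test.sim_holds hP hsim fun i hi => hA' i (.inl hi)).2 hb) h₁ h₄,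
      by omega, h₆⟩

/-- Initialize the registers of a simulated program. -/
def resetCode : ℕ → Prog TreeQuery
  | 0 => .skip
  | m + 1 => resetCode m ;; .instr (.ctrConst (8 * m + 66) 0) ;;
      .instr (.ctrConst (8 * m + 71) 0) ;; .instr (.valConst (8 * m + 71) 0)

omit [DecidableEq V] [Fintype V] in
theorem resetCode_targets (m : ℕ) : (resetCode m).Targets (SimReg m) := by
  induction m with
  | zero => trivial
  | succ m ih =>
    refine ⟨ih.mono fun r hr => ?_, ?_⟩
    · simp only [SimReg] at *
      omega
    · simp only [Prog.Targets, Instr.target, SimReg]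
      omega

theorem resetCode_size (m : ℕ) : (resetCode m).size = 3 * m := by
  induction m with
  | zero => rfl
  | succ m ih => simp [resetCode, Prog.size, ih, Nat.mul_succ]

theorem resetCode_wp (hE : Env T v P s) (m : ℕ) :
    (resetCode m).wp T K (SimRel T v P m Store.init) s := by
  induction m with
  | zero => exact ⟨hE, fun i hi => by omega⟩
  | succ m ih =>
    refine Prog.wp_seq.2 (Prog.wp_mono ih fun s' h' => ?_)
    have hA : ∀ x : ℝ, Agree (Bundle m) s'
        (((s'.setCtr (8 * m + 66) 0).setCtr (8 * m + 71) 0).setVal (8 * m + 71) x) := by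
      intro x r hr
      simp only [Bundle] at hr
      have h₁ : r ≠ 8 * m + 66 := by omega
      have h₂ : r ≠ 8 * m + 71 := by omega
      simp [h₁, h₂]
    simp only [Prog.wp_seq, Prog.wp_ctrConst, Prog.wp_valConst, Nat.zero_le, true_and]
    refine ⟨by simpa using Fit.zero, h'.env.agree (hA _) (by simp [Bundle])
      fun r h₁ h₂ => by simp only [Bundle]; omega, fun i hi => ?_⟩
    rcases Nat.lt_succ_iff_lt_or_eq.1 hi with h | rfl
    · have hB : ∀ r, 8 * i + 64 ≤ r → r < 8 * i + 72 → ¬ Bundle m r := fun r h₁ h₂ => by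
        simp only [Bundle]
        omega
      have e := hA ((0 : ℕ) : ℝ) (8 * i + 71) (hB _ (by omega) (by omega))
      obtain ⟨h₁, h₂, h₃⟩ := h'.reg i h
      exact ⟨e.1.trans h₁, e.2.2.trans h₂, h₃.agree (hA _) fun r h₁ h₂ => hB r h₁ (by omega)⟩
    · constructor <;> simp [PtrRel, Store.init]

end Sim

/-- There is code that finds the median of the cells of the list, and uses the registers
`SimReg m`. -/
theorem exists_medianCode {M : ℕ → ℕ} (hM : MedianComputableIn M) :
    ∃ (c : Prog TreeQuery) (m k : ℕ), 0 < m ∧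
      ∀ (V : Type*) [Fintype V] [DecidableEq V] (T : TreeNetwork V) (v : V) (P : Par) (K : ℕ)
        (s : Store V), k ≤ K → P.Good T → Env T v P s → TreeWords T K s →
        Runs (TreeQuery.ask T) (TreeWords T K) c (3 * m + 200 * M (Fintype.card V)) s
          fun s' => Agree (SimReg m) s s' ∧ IsMedian (cells T v P) (s'.val 71) := by
  obtain ⟨A, k, hA⟩ := hM
  obtain ⟨m, hm⟩ : ∃ m, ∀ i ∈ A.regs, i < m :=
    ⟨A.regs.toFinset.sup id + 1, fun i hi => Nat.lt_succ_of_le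
      (Finset.le_sup (f := id) (List.mem_toFinset.2 hi))⟩
  -- One more register, so that register `0`, where the median is left, is certainly among the
  -- simulated ones.
  have hm' : ∀ i ∈ A.regs, i < m + 1 := fun i hi => (hm i hi).trans (Nat.lt_succ_self m)
  have ht : (resetCode (m + 1) ;; A.sim).Targets (SimReg (m + 1)) :=
    ⟨resetCode_targets _, Prog.sim_targets hm'⟩
  refine ⟨resetCode (m + 1) ;; A.sim, m + 1, 50 + 11 * k, Nat.succ_pos m, ?_⟩
  intro V _ _ T v P K s hK hP hE hs
  obtain ⟨t, σ, h₁, h₂, h₃⟩ := hA _ T.card_pos (cells T v P)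
  refine Runs.agree (Runs.seq ?_) ht
  rw [← resetCode_size]
  refine ((Prog.wp_runs (by omega) hs (resetCode_wp hE (m + 1))).words hs).mono le_rfl ?_
  rintro s₁ ⟨hs₁, h⟩
  refine (h₁.sim hK hP hm' hs₁ h).mono (Nat.mul_le_mul_left _ h₃) fun s₂ h => ?_
  -- Value register `0` of the list program is register `8 * 0 + 71`.
  exact (h.reg 0 (Nat.succ_pos m)).val ▸ h₂

/-! ## Composition of code -/

section Does

variable {V : Type*} [DecidableEq V] [Fintype V]

/-- From `s` the program `c` halts within `k` steps, modifies only registers in `S`, and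
establishes the postcondition `q`. -/
def Does (T : TreeNetwork V) (K : ℕ) (S : ℕ → Prop) (c : Prog TreeQuery) (k : ℕ) (s : Store V)
    (q : Store V → Prop) : Prop :=
  Runs (TreeQuery.ask T) (TreeWords T K) c k s fun s' => TreeWords T K s' ∧ Agree S s s' ∧ q s'

variable {T : TreeNetwork V} {K k l : ℕ} {S S' : ℕ → Prop} {c d : Prog TreeQuery} {s : Store V}
  {q r : Store V → Prop}

theorem Does.wp (hK : 1 ≤ K) (hc : c.Targets S) (hk : c.size ≤ k) (hs : TreeWords T K s)
    (h : c.wp T K q s) : Does T K S c k s q :=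
  ((Prog.wp_runs hK hs (Prog.wp_agree hc h)).words hs).mono hk fun _ => id

theorem Does.mono (h : Does T K S c k s q) (hk : k ≤ l) (hS : ∀ i, S i → S' i)
    (hq : ∀ s', Agree S s s' → q s' → r s') : Does T K S' c l s r :=
  Runs.mono h hk fun s' ⟨h₁, h₂, h₃⟩ => ⟨h₁, h₂.mono hS, hq s' h₂ h₃⟩

theorem Does.seq (h : Does T K S c k s q)
    (hd : ∀ s', TreeWords T K s' → Agree S s s' → q s' → Does T K S d l s' r) :
    Does T K S (c ;; d) (k + l) s r :=
  Runs.seq (Runs.mono h le_rfl fun s' ⟨h₁, h₂, h₃⟩ => Runs.mono (hd s' h₁ h₂ h₃) le_rfl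
    fun _ ⟨e₁, e₂, e₃⟩ => ⟨e₁, h₂.trans e₂, e₃⟩)

theorem Does.ite {b : Test} (h₁ : b.Holds s → Does T K S c k s q)
    (h₂ : ¬ b.Holds s → Does T K S d k s q) : Does T K S (.ite b c d) (k + 1) s q :=
  Runs.ite h₁ h₂

theorem Does.loop {b : Test} (inv : ℕ → Store V → Prop) {j : ℕ} (hs : TreeWords T K s)
    (h : ∀ j s', TreeWords T K s' → Agree S s s' → inv j s' → b.Holds s' →
      Does T K S c k s' fun s'' => ∃ i, j = i + 1 ∧ inv i s'') (h0 : inv j s) :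
    Does T K S (.loop b c) (j * (k + 1) + 1) s fun s' => (∃ i, inv i s') ∧ ¬ b.Holds s' := by
  refine Runs.mono (Runs.loop (k := k)
    (fun j s' => TreeWords T K s' ∧ Agree S s s' ∧ inv j s') ?_ j s ⟨hs, Agree.refl s, h0⟩) le_rfl ?_
  · rintro j s' ⟨h₁, h₂, h₃⟩ hb
    exact Runs.mono (h j s' h₁ h₂ h₃ hb) le_rfl
      fun _ ⟨e₁, e₂, i, hi, e₃⟩ => ⟨i, hi, e₁, h₂.trans e₂, e₃⟩
  · rintro s' ⟨⟨i, h₁, h₂, h₃⟩, hb⟩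
    exact ⟨h₁, h₂, ⟨i, h₃⟩, hb⟩

end Does

/-! ## Scans -/

/-- Start tours from the vertex in the pointer register `q`. -/
def loadCode (q : ℕ) : Prog TreeQuery :=
  .instr (.ctrCopy 8 17) ;; .instr (.ptrCopy 8 q) ;; .instr (.query (.weight 8 8)) ;;
  .instr (.valConst 1 1) ;; .instr (.valArith .div 8 1 8)

/-- Compare lines in the middle of the interval. -/
def midCode : Prog TreeQuery :=
  .instr (.valArith .add 9 10 11) ;; .instr (.valConst 1 2) ;; .instr (.valArith .div 9 9 1)

/-- Find the best line of the tour from the vertex in the pointer register `q`. -/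
def scanCode (q : ℕ) : Prog TreeQuery :=
  (loadCode q ;; .instr (.ctrCopy 9 16)) ;; startCode 0 ;; .loop (.ctrLt 66 8) (cellCode 0)

/-- Decide on which side of the optimal value the number in the value register `12` lies. -/
def testCode : Prog TreeQuery :=
  .instr (.valCopy 9 12) ;; scanCode 16 ;; scanCode 67 ;;
  .instr (.valArith .add 1 68 8) ;; .instr (.valArith .mul 1 12 1) ;;
  .ite (.valLt 1 67) (.instr (.valCopy 10 12)) (.instr (.valCopy 11 12))

def ScanReg (i : ℕ) : Prop := (1 ≤ i ∧ i < 10) ∨ (64 ≤ i ∧ i < 71)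

def TestReg (i : ℕ) : Prop := (1 ≤ i ∧ i < 12) ∨ (64 ≤ i ∧ i < 71)

/-- The registers used for the search. -/
def SearchReg (m i : ℕ) : Prop := (1 ≤ i ∧ i < 16) ∨ (64 ≤ i ∧ i < 8 * m + 64)

theorem cellCode_size (p : ℕ) : (cellCode p).size ≤ 150 := by
  simp [Prog.size, cellCode, itemCode, pushCode, advCode, goToCode, emitCode]

section Scan

variable {V : Type*} [Fintype V]

/-- The constants are stored in the registers for them. -/
structure Ready (T : TreeNetwork V) (s : Store V) : Prop where
  zero : s.ctr 0 = 0
  two_N : s.ctr 16 = 2 * Fintype.card V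
  N : s.ctr 17 = Fintype.card V
  lo : Fit T 10 (s.val 10)
  hi : Fit T 10 (s.val 11)

/-- The bundle `0` contains the best line `z` of the tour from `v`. -/
structure Scanned (T : TreeNetwork V) (v : V) (lam : ℝ) (z : V) (s : Store V) : Prop where
  pos : 0 < T.weight z
  ptr : s.ptr 67 = some z
  dist : s.val 67 = T.vdist v z
  inv : s.val 68 = 1 / T.weight z
  best : ∀ y, 0 < T.weight y →
    T.vdist v y - lam * (1 / T.weight y) ≤ T.vdist v z - lam * (1 / T.weight z)

variable {T : TreeNetwork V} {K : ℕ} {s s' : Store V} {v : V}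

theorem Ready.agree {S : ℕ → Prop} (h : Ready T s) (hs : Agree S s s') (h0 : ¬ S 0)
    (hS : ∀ i, 16 ≤ i → i < 18 → ¬ S i)
    (hlo : Fit T 10 (s'.val 10)) (hhi : Fit T 10 (s'.val 11)) : Ready T s' :=
  ⟨(hs 0 h0).1.trans h.zero, (hs 16 (hS 16 (by omega) (by omega))).1.trans h.two_N,
    (hs 17 (hS 17 (by omega) (by omega))).1.trans h.N, hlo, hhi⟩

theorem Ready.agree_scan (h : Ready T s) (hs : Agree ScanReg s s') : Ready T s' :=
  h.agree hs (by simp [ScanReg]) (fun i _ _ => by simp only [ScanReg]; omega)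
    ((hs 10 (by simp [ScanReg])).2.2 ▸ h.lo) ((hs 11 (by simp [ScanReg])).2.2 ▸ h.hi)

theorem fit_one (T : TreeNetwork V) {k : ℕ} (hk : 1 ≤ k) : Fit T k 1 := by
  simpa using Fit.natCast (T := T) (m := 1) (by omega) hk

theorem fit_two (T : TreeNetwork V) {k : ℕ} (hk : 1 ≤ k) : Fit T k 2 := by
  simpa using Fit.natCast (T := T) (m := 2) (by omega) hk

variable [DecidableEq V]

theorem loadCode_wp {q : ℕ} (hK : 50 ≤ K) (hs : Ready T s) (hq : s.ptr q = some v) :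
    (loadCode q).wp T K (fun s' => Env T v ⟨Fintype.card V, s'.ctr 9, 1 / T.weight v, s'.val 9,
      s'.val 10, s'.val 11⟩ s') s := by
  have h₁ : Fit T K 1 := fit_one T (by omega)
  have h₂ : Fit T K (T.weight v)⁻¹ := (Fit.weight v (by omega)).inv
  simp only [loadCode, Prog.wp_seq, Prog.wp_ctrCopy, Prog.wp_ptrCopy, Prog.wp_weight,
    Prog.wp_valConst, Prog.wp_valArith]
  refine ⟨by simpa using h₁, by simpa [hq, TreeNetwork.weightOf] using h₂, ?_⟩
  constructor <;> simp [hs.zero, hs.N, hq, getPar, TreeNetwork.weightOf]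

theorem midCode_wp (hK : 50 ≤ K) (hs : Ready T s) :
    midCode.wp T K (fun s' => s'.val 9 = (s.val 10 + s.val 11) / 2) s := by
  have h₁ : Fit T K 2 := fit_two T (by omega)
  have h₂ : Fit T K (s.val 10 + s.val 11) := (hs.lo.add hs.hi).mono (by omega)
  have h₃ : Fit T K ((s.val 10 + s.val 11) / 2) :=
    ((hs.lo.add hs.hi).div (fit_two T le_rfl)).mono (by omega)
  simp [midCode, h₁, h₂, h₃]

omit [DecidableEq V] in
theorem Env.good {P : Par} (hE : Env T v P s) (hs : Ready T s) (hN : P.N = Fintype.card V)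
    (hb : 0 < P.b) (hb' : P.b ≤ 4 * Fintype.card V) (hlam : Fit T 22 P.lam) : P.Good T := by
  have h := hE.par
  refine ⟨hN, hb, hb', hlam, ?_, ?_⟩
  · rw [← h]
    exact hs.lo
  · rw [← h]
    exact hs.hi

/-- With block length `2 * n` the scan never leaves the first block, so its best line is the best of
all. The last clause transfers optimality from the evaluated place to a whole interval on which some
line is known to be best. -/
theorem scanCode_does {q : ℕ} (hK : 50 ≤ K) (hs : Ready T s) (hW : TreeWords T K s)
    (hq : s.ptr q = some v) (hv : 0 < T.weight v) (hlam : Fit T 22 (s.val 9)) :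
    Does T K ScanReg (scanCode q) (30 + 151 * Fintype.card V) s fun s' =>
      s'.val 8 = 1 / T.weight v ∧ s'.val 9 = s.val 9 ∧ ∃ z, Scanned T v (s.val 9) z s' ∧
        ∀ lo hi i, Dom (T.items v) lo hi 0 (2 * Fintype.card V) i → lo < s.val 9 → s.val 9 < hi →
          ∀ lam, lo ≤ lam → lam ≤ hi → Scanned T v lam z s' := by
  have hloc : ∀ i, Local 0 i → ScanReg i := fun i => by simp only [Local, ScanReg]; omega
  have hn := T.card_pos
  set P : Par := ⟨Fintype.card V, 2 * Fintype.card V, 1 / T.weight v, s.val 9, s.val 10,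
    s.val 11⟩ with hP
  have h₁ : Does T K ScanReg (loadCode q ;; .instr (.ctrCopy 9 16)) 6 s (Env T v P) := by
    refine Does.wp (by omega) (by simp [loadCode, Prog.Targets, Instr.target, TreeQuery.target,
      ScanReg]) le_rfl hW ?_
    refine Prog.wp_seq.2 (Prog.wp_mono (Prog.wp_agree (S := fun i => 1 ≤ i ∧ i < 9)
      (by simp [loadCode, Prog.Targets, Instr.target, TreeQuery.target])
      (loadCode_wp hK hs hq)) ?_)
    rintro s₁ ⟨hA, hE⟩
    have a9 := hA 9 (by simp)
    have a10 := hA 10 (by simp)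
    have a11 := hA 11 (by simp)
    have a16 := hA 16 (by simp)
    obtain ⟨e₁, e₂, e₃, e₄⟩ := hE
    simp only [getPar, Par.mk.injEq] at e₂
    refine ⟨trivial, ?_⟩
    constructor
    · simpa [Instr.run] using e₁
    · simp [Instr.run, getPar, hP, e₂, a16.1, hs.two_N, a9.2.2, a10.2.2, a11.2.2]
    · simpa [Instr.run] using e₃
    · rfl
  have hloop : ∀ s₂, TreeWords T K s₂ → Agree ScanReg s s₂ → Env T v P s₂ ∧ AtCell T v P 0 0 s₂ →
      Does T K ScanReg (.loop (.ctrLt 66 8) (cellCode 0)) (Fintype.card V * (150 + 1) + 1) s₂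
        fun s' => Env T v P s' ∧ AtCell T v P 0 (Fintype.card V) s' := by
    rintro s₂ hW₂ hA₂ ⟨hE₂, hC₂⟩
    have hG := hE₂.good (hs.agree_scan hA₂) rfl (Nat.mul_pos two_pos hn) (by simp only [P]; omega) hlam
    refine Does.mono (Does.loop (fun j s' => ∃ i, i + j = Fintype.card V ∧ Env T v P s' ∧
      AtCell T v P 0 i s') hW₂ ?_ ⟨0, by omega, hE₂, hC₂⟩) le_rfl (fun _ => id) ?_
    · rintro j s' hW' - ⟨i, hij, hE', hC'⟩ hb
      have hidx : s'.ctr 66 = i := (congrArg Blk.idx hC'.2).trans (Blk.run_idx hG.b_pos i)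
      have hN : s'.ctr 8 = Fintype.card V := congrArg Par.N hE'.par
      simp only [Test.Holds, hidx, hN] at hb
      refine (Does.wp (by omega) (cellCode_targets 0) (cellCode_size 0) hW'
        (cellCode_wp hK hG hE' hb hC')).mono le_rfl hloc ?_
      rintro s'' hA'' ⟨-, hC''⟩
      exact ⟨j - 1, by omega, i + 1, by omega, hE'.agree_local hA'', hC''⟩
    · rintro s' - ⟨⟨j, i, hij, hE', hC'⟩, hb⟩
      have hidx : s'.ctr 66 = i := (congrArg Blk.idx hC'.2).trans (Blk.run_idx hG.b_pos i)
      have hN : s'.ctr 8 = Fintype.card V := congrArg Par.N hE'.par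
      simp only [Test.Holds, hidx, hN] at hb
      obtain rfl : i = Fintype.card V := by omega
      exact ⟨hE', hC'⟩
  refine Does.mono (Does.seq h₁ (l := 14 + (Fintype.card V * (150 + 1) + 1)) fun s₁ hW₁ hA₁ hE₁ =>
    Does.seq (k := 14) (q := fun s' => Env T v P s' ∧ AtCell T v P 0 0 s') ?_
      fun s₂ hW₂ hA₂ h₂ => hloop s₂ hW₂ (hA₁.trans hA₂) h₂) (by omega) (fun _ => id) ?_
  · exact (Does.wp (by omega) (startCode_targets 0) le_rfl hW₁ (startCode_wp hE₁)).mono le_rfl hloc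
      fun s' hA h => ⟨hE₁.agree_local hA, h.2⟩
  · rintro s' hA ⟨hE, hC⟩
    obtain ⟨z, hz, e₁, e₂, e₃, e₄, e₅⟩ := TreeNetwork.run_items (T := T) hv (P := P) rfl
    have f₁ : s'.ptr 67 = some z := (congrArg Blk.pc hC.2).trans e₁
    have f₂ : s'.val 67 = _ := (congrArg Blk.dc hC.2).trans e₂
    have f₃ : s'.val 68 = _ := (congrArg Blk.kc hC.2).trans e₃
    refine ⟨congrArg Par.k0 hE.par, congrArg Par.lam hE.par, z, ⟨hz, f₁, f₂, f₃, e₄⟩, ?_⟩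
    exact fun lo hi i hD hlo hhi lam hl hh => ⟨hz, f₁, f₂, f₃, e₅ lo hi i hD hlo hhi lam hl hh⟩

-- The double sweep at the median, followed by the comparison of `IsValue.lt_iff`. In case of
-- equality the upper end moves, which preserves `lo < L ≤ hi`.
open TreeNetwork in
theorem testCode_does {L : ℝ} (hL : T.IsValue L) (hK : 50 ≤ K) (hs : Ready T s)
    (hW : TreeWords T K s) (ha : s.ptr 16 = some v) (hv : 0 < T.weight v)
    (hx : Fit T 10 (s.val 12)) :
    Does T K TestReg testCode (70 + 302 * Fintype.card V) s fun s' => Ready T s' ∧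
      (s.val 12 < L ∧ s'.val 10 = s.val 12 ∧ s'.val 11 = s.val 11 ∨
        L ≤ s.val 12 ∧ s'.val 10 = s.val 10 ∧ s'.val 11 = s.val 12) := by
  have hS : ∀ i, ScanReg i → TestReg i := fun i => by simp only [ScanReg, TestReg]; omega
  have h₁ : Does T K (· = 9) (.instr (.valCopy 9 12)) 1 s fun s' => s'.val 9 = s.val 12 :=
    Does.wp (by omega) rfl le_rfl hW (by simp)
  refine Does.mono (Does.seq (S := TestReg) (h₁.mono le_rfl (by rintro i rfl; simp [TestReg])
    fun s' hA h => And.intro h hA)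
    (l := (30 + 151 * Fintype.card V) + ((30 + 151 * Fintype.card V) + 4)) ?_)
    (by omega) (fun _ => id) (fun s' hA h => h)
  rintro s₁ hW₁ - ⟨h9, hA₁⟩
  have hR₁ : Ready T s₁ := hs.agree_scan (hA₁.mono (by rintro i rfl; simp [ScanReg]))
  have a16 := hA₁ 16 (by simp)
  have a12 := hA₁ 12 (by simp)
  have a10 := hA₁ 10 (by simp)
  have a11 := hA₁ 11 (by simp)
  refine Does.seq ((scanCode_does hK hR₁ hW₁ (a16.2.1.trans ha) hv
    (h9 ▸ hx.mono (by omega))).mono le_rfl hS fun s' hA h => And.intro hA h) ?_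
  rintro s₂ hW₂ - ⟨hA₂, -, h9', u, hu, -⟩
  have hR₂ := hR₁.agree_scan hA₂
  rw [h9] at h9' hu
  -- The second sweep starts at the result of the first, which is copied from register `67` before
  -- the scan overwrites it.
  refine Does.seq ((scanCode_does hK hR₂ hW₂ hu.ptr hu.pos
    (h9' ▸ hx.mono (by omega))).mono le_rfl hS fun s' hA h => And.intro hA h) ?_
  rintro s₃ hW₃ - ⟨hA₃, h8, -, z, hz, -⟩
  have hR₃ := hR₂.agree_scan hA₃
  rw [h9'] at hz
  have hA₂₃ := hA₂.trans hA₃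
  have b12 : s₃.val 12 = s.val 12 := (hA₂₃ 12 (by simp [ScanReg])).2.2.trans a12.2.2
  have b10 : s₃.val 10 = s.val 10 := (hA₂₃ 10 (by simp [ScanReg])).2.2.trans a10.2.2
  have b11 : s₃.val 11 = s.val 11 := (hA₂₃ 11 (by simp [ScanReg])).2.2.trans a11.2.2
  have hiff := hL.lt_iff hu.pos hz.pos hu.best hz.best
  have hw : ∀ y, Fit T 1 (1 / T.weight y) := fun y => by
    rw [one_div]
    exact (Fit.weight y le_rfl).inv
  have f₁ : Fit T 3 (1 / T.weight z + 1 / T.weight u) := (hw z).add (hw u)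
  have f₂ : Fit T 13 (s.val 12 * (1 / T.weight z + 1 / T.weight u)) := hx.mul f₁
  have hlo := hR₃.lo
  have hhi := hR₃.hi
  have hkey : ∀ s₄, Agree (fun i => i = 1 ∨ i = 10 ∨ i = 11) s₃ s₄ →
      (s.val 12 < L ∧ s₄.val 10 = s.val 12 ∧ s₄.val 11 = s.val 11 ∨
        L ≤ s.val 12 ∧ s₄.val 10 = s.val 10 ∧ s₄.val 11 = s.val 12) → Ready T s₄ := by
    intro s₄ hA h
    refine hR₃.agree hA (by simp) (fun i _ _ => by omega) ?_ ?_
    · rcases h with ⟨-, h, -⟩ | ⟨-, h, -⟩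
      · exact h ▸ hx
      · exact h ▸ hs.lo
    · rcases h with ⟨-, -, h⟩ | ⟨-, -, h⟩
      · exact h ▸ hs.hi
      · exact h ▸ hx
  refine Does.mono (Does.wp (S := fun i => i = 1 ∨ i = 10 ∨ i = 11)
    (q := fun s₄ => s.val 12 < L ∧ s₄.val 10 = s.val 12 ∧ s₄.val 11 = s.val 11 ∨
        L ≤ s.val 12 ∧ s₄.val 10 = s.val 10 ∧ s₄.val 11 = s.val 12) (by omega)
    (by simp [Prog.Targets, Instr.target]) le_rfl hW₃ ?_) le_rfl
    (fun i => by simp only [TestReg]; omega) fun s₄ hA h => ⟨hkey s₄ hA h, h⟩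
  have c8 := h8
  have c67 := hz.dist
  have c68 := hz.inv
  rw [add_comm] at hiff
  set kz := 1 / T.weight z
  set ku := 1 / T.weight u
  have f₁' : Fit T K (kz + ku) := f₁.mono (by omega)
  have f₂' : Fit T K (s.val 12 * (kz + ku)) := f₂.mono (by omega)
  by_cases hlt : s.val 12 < L
  · simp [c8, c67, c68, b11, b12, hlt, f₁', f₂', hiff.1 hlt]
  · simp [c8, c67, c68, b10, b12, hlt, f₁', f₂', mt hiff.2 hlt, not_lt.1 hlt]

end Scan

/-! ## Search -/

/-- Find the vertex that determines the optimal value, seen from the vertex in the pointer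
register `16`; the code `c` finds medians. -/
def searchCode (c : Prog TreeQuery) : Prog TreeQuery :=
  .instr (.ctrConst 13 1) ;;
  .loop (.ctrLt 13 16)
    ((loadCode 16 ;; midCode ;; .instr (.ctrCopy 9 13)) ;; c ;; .instr (.valCopy 12 71) ;;
      .ite (.and (.valLt 10 12) (.valLt 12 11)) testCode (.instr (.ctrArith .add 13 13 13))) ;;
  midCode ;; scanCode 16

/-- A bound for the number of iterations of the search. -/
def searchCount (n : ℕ) : ℕ := (Nat.log 2 n + 2) * (Nat.log 2 n + 2) + (Nat.log 2 n + 1)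

def searchTime (m M n : ℕ) : ℕ :=
  searchCount n * (3 * m + 200 * M + 302 * n + 90) + 151 * n + 40

section Search

variable {V : Type*} [Fintype V] [DecidableEq V] {T : TreeNetwork V} {K : ℕ} {s s' : Store V}
  {v : V}

theorem prepareCode_does (hK : 50 ≤ K) (hs : Ready T s) (hW : TreeWords T K s)
    (ha : s.ptr 16 = some v) :
    Does T K (fun i => 1 ≤ i ∧ i < 10) (loadCode 16 ;; midCode ;; .instr (.ctrCopy 9 13)) 9 s
      (Env T v (Par.mk' (Fintype.card V) (s.ctr 13) (1 / T.weight v) (s.val 10) (s.val 11))) := by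
  refine Does.wp (by omega) (by simp [loadCode, midCode, Prog.Targets, Instr.target,
    TreeQuery.target]) le_rfl hW ?_
  refine Prog.wp_seq.2 (Prog.wp_mono (Prog.wp_agree (S := fun i => 1 ≤ i ∧ i < 9)
    (by simp [loadCode, Prog.Targets, Instr.target, TreeQuery.target])
    (loadCode_wp hK hs ha)) ?_)
  rintro s₁ ⟨hA, hE⟩
  have hR : Ready T s₁ := hs.agree_scan (hA.mono fun i => by simp only [ScanReg]; omega)
  refine Prog.wp_seq.2 (Prog.wp_mono (Prog.wp_agree (S := fun i => i = 1 ∨ i = 9)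
    (by simp [midCode, Prog.Targets, Instr.target]) (midCode_wp hK hR)) ?_)
  rintro s₂ ⟨hA₂, h9⟩
  have a0 := hA₂ 0 (by simp)
  have a8 := hA₂ 8 (by simp)
  have a10 := hA₂ 10 (by simp)
  have a11 := hA₂ 11 (by simp)
  have a13 := hA₂ 13 (by simp)
  have b13 := hA 13 (by simp)
  have b10 := hA 10 (by simp)
  have b11 := hA 11 (by simp)
  obtain ⟨e₁, e₂, e₃, e₄⟩ := hE
  simp only [getPar, Par.mk.injEq] at e₂
  refine ⟨trivial, ?_⟩
  constructor
  · simpa [Instr.run, a0.1] using e₁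
  · simp [Instr.run, getPar, Par.mk', a8, a10, a11, h9, b10, b11, e₂, a13, b13]
  · simpa [Instr.run, a8.2.1] using e₃
  · rfl

/-- Each round either halves the intersections or doubles the blocks. When one block comprises all
`2 * n` lines, a single line is best on the whole interval, hence at `L`, although `L` itself is not
known. -/
theorem searchCode_does {L : ℝ} (hL : T.IsValue L) (hK : 50 ≤ K) {c : Prog TreeQuery} {m M : ℕ}
    (hm : 0 < m)
    (hc : ∀ (v : V) (P : Par) (s : Store V), P.Good T → Env T v P s → TreeWords T K s →
      Runs (TreeQuery.ask T) (TreeWords T K) c (3 * m + 200 * M) s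
        fun s' => Agree (SimReg m) s s' ∧ IsMedian (cells T v P) (s'.val 71))
    (hs : Ready T s) (hW : TreeWords T K s) (ha : s.ptr 16 = some v) (hv : 0 < T.weight v)
    (hlo : s.val 10 < L) (hhi : L ≤ s.val 11) :
    Does T K (SearchReg m) (searchCode c) (searchTime m M (Fintype.card V)) s fun s' =>
      Ready T s' ∧ s'.val 10 < L ∧ L ≤ s'.val 11 ∧ ∃ z, Scanned T v L z s' := by
  have hn := T.card_pos
  have hS : ∀ i, ScanReg i → SearchReg m i := fun i => by simp only [ScanReg, SearchReg]; omega
  have hST : ∀ i, TestReg i → SearchReg m i := fun i => by simp only [TestReg, SearchReg]; omega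
  have hSS : ∀ i, SimReg m i → SearchReg m i := fun i => by simp only [SimReg, SearchReg]; omega
  have h13 : ∀ i, i = 13 → SearchReg m i := by
    rintro i rfl
    simp [SearchReg]
  set inv : ℕ → Store V → Prop := fun j s' => Ready T s' ∧ s'.val 10 < L ∧ L ≤ s'.val 11 ∧
    s'.ctr 13 ≤ 4 * Fintype.card V ∧ Blk.Progress (T.items v) (Fintype.card V) (s'.ctr 13)
      (1 / T.weight v) (s'.val 10) (s'.val 11) j with hinv
  have hbody : ∀ j s₁, TreeWords T K s₁ → Agree (SearchReg m) s s₁ → inv j s₁ →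
      (Test.ctrLt 13 16).Holds s₁ → Does T K (SearchReg m)
        ((loadCode 16 ;; midCode ;; .instr (.ctrCopy 9 13)) ;; c ;; .instr (.valCopy 12 71) ;;
        .ite (.and (.valLt 10 12) (.valLt 12 11)) testCode (.instr (.ctrArith .add 13 13 13)))
        (9 + ((3 * m + 200 * M) + (1 + ((70 + 302 * Fintype.card V) + 1)))) s₁
        fun s' => ∃ i, j = i + 1 ∧ inv i s' := by
    rintro j s₁ hW₁ hA₁ ⟨hR₁, hlo₁, hhi₁, hb₁, hp₁⟩ hb
    have ha₁ : s₁.ptr 16 = some v := (hA₁ 16 (by simp [SearchReg])).2.1.trans ha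
    simp only [Test.Holds, hR₁.two_N] at hb
    set P := Par.mk' (Fintype.card V) (s₁.ctr 13) (1 / T.weight v) (s₁.val 10) (s₁.val 11) with hP
    have hG : P.Good T := ⟨rfl, hp₁.1, hb₁,
      ((hR₁.lo.add hR₁.hi).div (fit_two T le_rfl)).mono (by omega), hR₁.lo, hR₁.hi⟩
    refine Does.seq ((prepareCode_does hK hR₁ hW₁ ha₁).mono le_rfl
      (fun i => by simp only [SearchReg]; omega) fun s' hA h => And.intro hA h) ?_
    rintro s₂ hW₂ - ⟨hA₂, hE₂⟩
    refine Does.seq (q := fun s' => Agree (SimReg m) s₂ s' ∧ IsMedian (cells T v P) (s'.val 71))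
      ?_ ?_
    · refine ((hc v P s₂ hG hE₂ hW₂).words hW₂).mono le_rfl ?_
      exact fun s' h => ⟨h.1, h.2.1.mono hSS, h.2⟩
    rintro s₃ hW₃ - ⟨hA₃, hx⟩
    refine Does.seq (q := fun s' => Agree (· = 12) s₃ s' ∧ s'.val 12 = s₃.val 71)
      ((Does.wp (S := (· = 12)) (q := fun s' => s'.val 12 = s₃.val 71) (by omega) (by simp [Prog.Targets, Instr.target]) le_rfl hW₃
        (by simp)).mono le_rfl (by rintro i rfl; simp [SearchReg]) fun s' hA h => ⟨hA, h⟩) ?_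
    rintro s₄ hW₄ - ⟨hA₄, hx₄⟩
    set x := s₃.val 71 with hxdef
    -- The median is the content of a cell, so it has the exponent of the cells, whatever the median
    -- program computed on the way.
    have hxfit : Fit T 10 x := by
      obtain ⟨⟨j, hj⟩, -⟩ := hx
      exact hj ▸ fit_cells hG j
    have hA₁₄ : Agree (fun i => i = 12 ∨ (1 ≤ i ∧ i < 10) ∨ SimReg m i) s₁ s₄ :=
      ((hA₂.mono fun i h => .inr (.inl h)).trans (hA₃.mono fun i h => .inr (.inr h))).trans
        (hA₄.mono fun i h => .inl h)
    have a10 := hA₁₄ 10 (by simp [SimReg])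
    have a11 := hA₁₄ 11 (by simp [SimReg])
    have a13 := hA₁₄ 13 (by simp [SimReg])
    have a16 := hA₁₄ 16 (by simp [SimReg])
    have hR₄ : Ready T s₄ := hR₁.agree hA₁₄ (by simp [SimReg])
      (fun i _ _ => by simp only [SimReg]; omega) (a10.2.2 ▸ hR₁.lo) (a11.2.2 ▸ hR₁.hi)
    refine Does.ite (fun hin => ?_) fun hout => ?_
    · simp only [Test.Holds, a10.2.2, a11.2.2, hx₄] at hin
      obtain ⟨i, hij, hp₂, hp₃⟩ := hp₁.shrink hx hin.1 hin.2
      refine (testCode_does hL hK hR₄ hW₄ (a16.2.1.trans ha₁) hv (hx₄ ▸ hxfit)).mono le_rfl hST ?_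
      rintro s₅ hA₅ ⟨hR₅, h₅⟩
      have b13 := (hA₅ 13 (by simp [TestReg])).1.trans a13.1
      rw [hx₄, a10.2.2, a11.2.2] at h₅
      refine ⟨i, hij, hR₅, ?_⟩
      rcases h₅ with ⟨h, e₁, e₂⟩ | ⟨h, e₁, e₂⟩
      · rw [e₁, e₂, b13]
        exact ⟨h, hhi₁, hb₁, hp₃⟩
      · rw [e₁, e₂, b13]
        exact ⟨hlo₁, h, hb₁, hp₂⟩
    · simp only [Test.Holds, a10.2.2, a11.2.2, hx₄] at hout
      -- The guard gives `b < 2 * n`, which keeps the doubled length within `4 * n`.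
      obtain ⟨i, hij, hp₂⟩ := hp₁.pos_and_double (hlo₁.trans_le hhi₁) hb hx hout
      refine (Does.wp (S := (· = 13)) (q := fun s' => s'.ctr 13 = 2 * s₁.ctr 13) (by omega)
        (by simp [Prog.Targets, Instr.target])
        (show _ ≤ _ by simp only [Prog.size]; omega) hW₄ ?_).mono le_rfl h13 ?_
      · rw [Prog.wp_ctrArith]
        simp only [ArithOp.onCtr, a13.1, ← two_mul]
        exact ⟨lt_words (by omega) (by omega), by simp⟩
      · intro s₅ hA₅ h₅
        have b10 := (hA₅ 10 (by simp)).2.2.trans a10.2.2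
        have b11 := (hA₅ 11 (by simp)).2.2.trans a11.2.2
        refine ⟨i, hij, hR₄.agree hA₅ (by simp) (fun i _ _ => by omega)
          (b10 ▸ hR₁.lo) (b11 ▸ hR₁.hi), ?_⟩
        rw [b10, b11, h₅]
        exact ⟨hlo₁, hhi₁, by omega, hp₂⟩
  refine Does.mono (Does.seq (k := 1) (q := inv (searchCount (Fintype.card V))) ?_
    (l := (searchCount (Fintype.card V) * ((9 + ((3 * m + 200 * M) +
      (1 + ((70 + 302 * Fintype.card V) + 1)))) + 1) + 1) + (3 + (30 + 151 * Fintype.card V))) ?_)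
    ?_ (fun _ => id) fun _ _ => id
  · refine (Does.wp (S := (· = 13)) (q := fun s' => s'.ctr 13 = 1) (by omega) (by simp [Prog.Targets, Instr.target]) le_rfl hW
      (by simp)).mono le_rfl h13 fun s₁ hA₁ h₁ => ?_
    have b10 := (hA₁ 10 (by simp)).2.2
    have b11 := (hA₁ 11 (by simp)).2.2
    refine ⟨hs.agree hA₁ (by simp) (fun i _ _ => by omega) (b10 ▸ hs.lo) (b11 ▸ hs.hi), ?_⟩
    rw [b10, b11, h₁]
    exact ⟨hlo, hhi, by omega, Blk.Progress.start _ _ _ _⟩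
  · intro s₁ hW₁ hA₁ h₁
    refine Does.seq (Does.loop inv hW₁ (fun j s' hW' hA' => hbody j s' hW' (hA₁.trans hA')) h₁) ?_
    rintro s₂ hW₂ hA₂ ⟨⟨j, hR₂, hlo₂, hhi₂, hb₂, hp₂⟩, hb⟩
    simp only [Test.Holds, hR₂.two_N, not_lt] at hb
    obtain ⟨i, hD⟩ := hp₂.dom hn hb
    refine Does.seq ((Does.wp (S := fun i => i = 1 ∨ i = 9) (by omega)
      (by simp [midCode, Prog.Targets, Instr.target]) le_rfl hW₂ (midCode_wp hK hR₂)).mono le_rfl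
      (fun i => by simp only [SearchReg]; omega) fun s' hA h => And.intro hA h) ?_
    rintro s₃ hW₃ hA₂₃ ⟨hA₃, h9⟩
    have hR₃ := hR₂.agree_scan (hA₃.mono fun i => by simp only [ScanReg]; omega)
    have a10 := (hA₃ 10 (by simp)).2.2
    have a11 := (hA₃ 11 (by simp)).2.2
    have ha₃ : s₃.ptr 16 = some v :=
      (((hA₁.trans hA₂).trans hA₂₃) 16 (by simp [SearchReg])).2.1.trans ha
    refine (scanCode_does hK hR₃ hW₃ ha₃ hv ?_).mono le_rfl hS ?_
    · rw [h9]
      exact ((hR₂.lo.add hR₂.hi).div (fit_two T le_rfl)).mono (by omega)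
    · rintro s₄ hA₄ ⟨-, -, z, -, hz⟩
      have b10 := (hA₄ 10 (by simp [ScanReg])).2.2.trans a10
      have b11 := (hA₄ 11 (by simp [ScanReg])).2.2.trans a11
      refine ⟨hR₃.agree_scan hA₄, b10 ▸ hlo₂, b11 ▸ hhi₂, z, ?_⟩
      -- The midpoint is interior, while `L` may be the upper end; `Dom` includes the ends.
      exact hz _ _ i hD (by rw [h9]; linarith) (by rw [h9]; linarith) L hlo₂.le hhi₂
  · rw [searchTime]
    have := Nat.mul_le_mul_left (searchCount (Fintype.card V))
      (show (9 + ((3 * m + 200 * M) + (1 + ((70 + 302 * Fintype.card V) + 1)))) + 1 ≤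
        3 * m + 200 * M + 302 * Fintype.card V + 90 by omega)
    omega

end Search

/-! ## The first tour -/

/-- Process one state of the first tour. -/
def countCode : Prog TreeQuery :=
  .instr (.ctrConst 1 1) ;; .instr (.ctrArith .add 16 16 1) ;; .instr (.query (.weight 1 64)) ;;
  .instr (.valConst 2 0) ;; .ite (.valLt 2 1) (.instr (.ptrCopy 17 64)) .skip ;;
  .instr (.valArith .mul 3 1 64) ;; .instr (.valArith .add 11 11 3)

/-- Count the vertices, find a vertex of positive weight, and compute an upper bound for the
optimal value. -/
def initCode : Prog TreeQuery :=
  (.instr (.query (.root 64)) ;; .instr (.ptrCopy 65 64)) ;;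
  .loop (.not (.ptrIsNull 64))
    (countCode ;; advCode 0) ;;
  .instr (.ctrConst 1 2) ;; .instr (.ctrArith .div 17 16 1) ;; .instr (.valConst 1 1) ;;
  .instr (.valConst 2 0) ;; .instr (.valArith .sub 10 2 1)

section Init

variable {V : Type*} [Fintype V] [DecidableEq V] {T : TreeNetwork V} {K : ℕ} {s s' : Store V}

/-- The sum of the weighted distances to the start over the first states of a tour. -/
noncomputable def tourSum (T : TreeNetwork V) (v : V) (i : ℕ) : ℝ :=
  ∑ k ∈ Finset.range i, T.weightOf (Tour.event T v k).x * (Tour.event T v k).D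

-- Adding the terms by `Fit.add` would make the exponent grow with their number. For integral input
-- the sum is a natural number, and its size is bounded directly.
open TreeNetwork in
theorem fit_tourSum (v : V) {i : ℕ} (hi : i ≤ 2 * Fintype.card V) :
    Fit T 5 (tourSum T v i) := by
  rw [fit_def]
  intro B h₁ h₂
  have key : ∃ k : ℕ, k ≤ i * (B * (Fintype.card V * B)) ∧ tourSum T v i = k := by
    induction i with
    | zero => exact ⟨0, by simp, by simp [tourSum]⟩
    | succ i ih =>
      obtain ⟨k, hk, e⟩ := ih (by omega)
      obtain ⟨x, a, hx, -, -, hD, -⟩ := (Tour.event_spec T v).1 i (by omega)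
      obtain ⟨l, hl, e'⟩ := exists_nat_vdist h₂ v x
      obtain ⟨p, hp, e''⟩ := h₁ x
      refine ⟨k + p * l, ?_, ?_⟩
      · rw [Nat.succ_mul]
        exact Nat.add_le_add hk (Nat.mul_le_mul hp hl)
      · rw [tourSum, Finset.sum_range_succ, ← tourSum, e, hx, hD, e']
        simp only [weightOf, Option.elim, e'']
        push_cast
        rfl
  obtain ⟨k, hk, e⟩ := key
  rw [e]
  have := T.card_pos
  refine FitsIn.nat (by positivity) (hk.trans ?_)
  set X := Fintype.card V + B + 1 with hX
  calc i * (B * (Fintype.card V * B)) ≤ (X * X) * (X * (X * X)) := by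
        refine Nat.mul_le_mul ?_ (Nat.mul_le_mul (by omega) (Nat.mul_le_mul (by omega) (by omega)))
        exact hi.trans (Nat.mul_le_mul (by omega) (by omega))
    _ = X ^ 5 := by ring

open TreeNetwork in
theorem vdist_le_tourSum (v z : V) :
    T.weight z * T.vdist v z ≤ tourSum T v (2 * Fintype.card V) := by
  obtain ⟨i, hi, hx, -⟩ := (Tour.event_spec T v).2.2 z 0 (.inl rfl)
  have h : ∀ k ∈ Finset.range (2 * Fintype.card V),
      0 ≤ T.weightOf (Tour.event T v k).x * (Tour.event T v k).D := by
    intro k hk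
    obtain ⟨x, a, hx, -, -, hD, -⟩ := (Tour.event_spec T v).1 k (Finset.mem_range.1 hk)
    rw [hx, hD]
    exact mul_nonneg (T.weight_nonneg x) (vdist_nonneg v x)
  refine le_trans (le_of_eq ?_) (Finset.single_le_sum h (Finset.mem_range.2 hi))
  obtain ⟨x, a, hx', -, -, hD, -⟩ := (Tour.event_spec T v).1 i hi
  rw [hx] at hx'
  obtain rfl : z = x := by simpa using hx'
  rw [hx, hD]
  rfl

/-- The state of the first tour before step `i`. -/
structure FirstTour (T : TreeNetwork V) (i : ℕ) (s : Store V) : Prop where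
  zero : s.ctr 0 = 0
  tour : getTour 0 s = Tour.event T T.root i
  count : s.ctr 16 = i
  sum : s.val 11 = tourSum T T.root i
  all_zero : s.ptr 17 = none → ∀ k < i, ¬ 0 < T.weightOf (Tour.event T T.root k).x
  found : ∀ z, s.ptr 17 = some z → 0 < T.weight z

theorem FirstTour.step_wp (hK : 50 ≤ K) {i : ℕ} (hi : i < 2 * Fintype.card V)
    (h : FirstTour T i s) : (countCode ;; advCode 0).wp T K (FirstTour T (i + 1)) s := by
  obtain ⟨x, a, hx, -, -, hD, -⟩ := (Tour.event_spec T T.root).1 i hi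
  have ht := h.tour
  have e64 : s.ptr 64 = some x := (congrArg Tour.x ht).trans hx
  have f64 : s.val 64 = T.vdist T.root x := (congrArg Tour.D ht).trans hD
  have hs := fit_tourSum (T := T) T.root (i := i + 1) hi
  have es : tourSum T T.root (i + 1) =
      tourSum T T.root i + T.weight x * T.vdist T.root x := by
    rw [tourSum, Finset.sum_range_succ, ← tourSum, hx, hD]
    rfl
  have hw : Fit T K (T.weight x * T.vdist T.root x) :=
    ((Fit.weight x le_rfl).mul (TreeNetwork.fit_vdist _ _)).mono (by omega)
  have hs' : Fit T K (tourSum T T.root i + T.weight x * T.vdist T.root x) := by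
    rw [← es]
    exact hs.mono (by omega)
  have hz : Fit T K 0 := Fit.zero
  have hcnt : countCode.wp T K (fun s₁ => s₁.ctr 0 = 0 ∧ getTour 0 s₁ = getTour 0 s ∧
      s₁.ctr 16 = i + 1 ∧ s₁.val 11 = tourSum T T.root (i + 1) ∧
      s₁.ptr 17 = if 0 < T.weight x then some x else s.ptr 17) s := by
    have h1 : i + 1 ≤ (Fintype.card V + 1) ^ K := lt_words (by omega) (by omega)
    rw [es]
    by_cases hpos : 0 < T.weight x <;>
    simp [countCode, e64, f64, h.zero, h.count, h.sum, hs', hw, hz, h1, hpos, getTour,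
      TreeNetwork.weightOf]
  refine Prog.wp_seq.2 (Prog.wp_mono hcnt ?_)
  rintro s₁ ⟨h0, hT, h16, h11, h17⟩
  have hD' : Fit T 10 (s₁.val (0 + 64)) := by
    have : s₁.val (0 + 64) = T.vdist T.root x := (congrArg Tour.D hT).trans f64
    rw [this]
    exact (TreeNetwork.fit_vdist _ _).mono (by omega)
  refine Prog.wp_mono (Prog.wp_agree (advCode_targets 0) (advCode_wp hK h0 hD')) ?_
  rintro s₂ ⟨hA, hT₂, -⟩
  have a0 := (hA 0 (by simp [Local])).1
  have a11 := (hA 11 (by simp [Local])).2.2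
  have a16 := (hA 16 (by simp [Local])).1
  have a17 := (hA 17 (by simp [Local])).2.1
  rw [h17] at a17
  refine ⟨a0.trans h0, ?_, a16.trans h16, a11.trans h11, ?_, ?_⟩
  · rw [hT₂, hT, ht, Tour.event_succ]
  · rw [a17]
    split_ifs with hpos
    · simp
    · intro hn k hk
      rcases Nat.lt_succ_iff_lt_or_eq.1 hk with hk | rfl
      · exact h.all_zero hn k hk
      · rwa [hx]
  · rw [a17]
    split_ifs with hpos
    · rintro z hz
      obtain rfl : x = z := by simpa using hz
      exact hpos
    · exact h.found

def InitReg (i : ℕ) : Prop := (1 ≤ i ∧ i < 18) ∨ (64 ≤ i ∧ i < 71)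

-- The tour ends after exactly `2 * n` states, so counting them yields `2 * n` and `n`. The interval
-- starts at `-1`, below every possible optimal value, and ends at the sum of the weighted distances
-- to the root over the tour, which dominates each of them.
open TreeNetwork in
theorem initCode_does (hK : 50 ≤ K) :
    Does T K InitReg initCode (102 * Fintype.card V + 10) Store.init fun s' => Ready T s' ∧
      s'.val 10 = -1 ∧ (∀ L, T.IsValue L → L ≤ s'.val 11) ∧
      (s'.ptr 17 = none → ∀ z, T.weight z = 0) ∧ ∀ z, s'.ptr 17 = some z → 0 < T.weight z := by
  have h₁ : Does T K InitReg (.instr (.query (.root 64)) ;; .instr (.ptrCopy 65 64)) 2 Store.init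
      (FirstTour T 0) := by
    refine Does.wp (by omega) (by simp [Prog.Targets, Instr.target, TreeQuery.target, InitReg])
      le_rfl TreeWords.init ?_
    simp only [Prog.wp_seq, Prog.wp_root, Prog.wp_ptrCopy]
    constructor <;> simp [Store.init, getTour, Tour.event, Tour.start, tourSum]
  refine Does.mono (Does.seq h₁ (l := (2 * Fintype.card V * (50 + 1) + 1) + 5)
    fun s₁ hW₁ _ h => Does.seq (q := FirstTour T (2 * Fintype.card V)) ?_ ?_) (by omega)
    (fun _ => id) fun _ _ => id
  · refine Does.mono (Does.loop (fun j s' => ∃ i, i + j = 2 * Fintype.card V ∧ FirstTour T i s')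
      hW₁ ?_ ⟨0, by omega, h⟩) le_rfl (fun _ => id) ?_
    · rintro j s' hW' - ⟨i, hij, h'⟩ hb
      have hi : i < 2 * Fintype.card V := by
        by_contra! hi
        obtain rfl : i = 2 * Fintype.card V := by omega
        exact hb ((congrArg Tour.x h'.tour).trans (Tour.event_spec T T.root).2.1)
      refine (Does.wp (S := InitReg) (by omega) ?_ ?_ hW' (h'.step_wp hK hi)).mono le_rfl
        (fun _ => id) fun s'' _ h'' => ⟨j - 1, by omega, i + 1, by omega, h''⟩
      · refine ⟨by simp [countCode, Prog.Targets, Instr.target, TreeQuery.target, InitReg],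
          (advCode_targets 0).mono fun i => ?_⟩
        simp only [Local, InitReg]
        omega
      · simp [countCode, advCode, goToCode, Prog.size]
    · rintro s' - ⟨⟨j, i, hij, h'⟩, hb⟩
      simp only [Test.Holds, not_not] at hb
      have : i = 2 * Fintype.card V := by
        by_contra hi
        obtain ⟨x, a, hx, -⟩ := (Tour.event_spec T T.root).1 i (by omega)
        have := (congrArg Tour.x h'.tour).symm.trans hb
        rw [hx] at this
        cases this
      exact this ▸ h'
  · rintro s₂ hW₂ - h₂
    have f1 : Fit T K 1 := fit_one T (by omega)
    have f1' : Fit T 3 (0 - 1) := (Fit.zero (k := 1)).sub (fit_one T le_rfl)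
    have f2 : Fit T K (0 - 1) := f1'.mono (by omega)
    have f3 : Fit T K 0 := Fit.zero
    rw [zero_sub] at f2 f1'
    have h1 : 2 ≤ (Fintype.card V + 1) ^ K := lt_words (by omega) (by have := T.card_pos; omega)
    have h3 : Fintype.card V ≤ (Fintype.card V + 1) ^ K := lt_words (by omega) (by omega)
    have hf := fit_tourSum (T := T) T.root le_rfl
    refine (Does.wp (S := InitReg) (q := fun s' => Ready T s' ∧ s'.val 10 = -1 ∧
      s'.val 11 = s₂.val 11 ∧ s'.ptr 17 = s₂.ptr 17) (by omega)
      (by simp [Prog.Targets, Instr.target, InitReg]) le_rfl hW₂ ?_).mono le_rfl (fun _ => id) ?_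
    · simp [h1, h3, f1, f2, f3, h₂.count]
      constructor <;> simp [h₂.zero, h₂.count, h₂.sum, f1'.mono, hf.mono]
    · rintro s' - ⟨hR, h10, h11, h17⟩
      rw [h11, h17, h₂.sum]
      refine ⟨hR, h10, fun L hL => hL.le_of_forall fun z => vdist_le_tourSum T.root z, ?_,
        h₂.found⟩
      intro hnone z
      obtain ⟨i, hi, hx, -⟩ := (Tour.event_spec T T.root).2.2 z 0 (.inl rfl)
      have := h₂.all_zero hnone i hi
      rw [hx] at this
      exact le_antisymm (not_lt.1 this) (T.weight_nonneg z)

end Init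

/-! ## The center -/

/-- Put the distance between the root and the vertex in the pointer register `q` into the value
register `r`. -/
def heightCode (q r : ℕ) : Prog TreeQuery :=
  (.instr (.ptrCopy 2 q) ;; .instr (.valConst r 0)) ;;
  .loop (.not (.ptrIsNull 2))
    (.instr (.query (.parentLength 1 2)) ;; .instr (.valArith .add r r 1) ;;
      .instr (.query (.parent 2 2)))

/-- Report the point whose distance below the vertex in the pointer register `0` is in the value
register `0`. -/
def climbCode : Prog TreeQuery :=
  .instr (.query (.parentLength 1 0)) ;;
  .loop (.valLt 1 0)
    (.instr (.valArith .sub 0 0 1) ;; .instr (.query (.parent 0 0)) ;;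
      .instr (.query (.parentLength 1 0))) ;;
  .instr (.valConst 1 0) ;;
  .ite (.valEq 0 1) (.instr (.ptrNull 1)) (.instr (.query (.parent 1 0)))

/-- Compute the distance of the center from the vertex in the pointer register `18`. -/
def radiusCode : Prog TreeQuery :=
  .instr (.valCopy 20 67) ;; .instr (.valCopy 21 68) ;; .instr (.query (.weight 22 18)) ;;
  .instr (.valConst 1 1) ;; .instr (.valArith .div 22 1 22) ;; .instr (.valArith .add 23 22 21) ;;
  .instr (.valArith .div 24 20 23) ;; .instr (.valArith .mul 25 24 22)

/-- Choose the end of the path from which the center is reached by climbing. -/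
def chooseCode : Prog TreeQuery :=
  .instr (.valArith .add 28 20 26) ;; .instr (.valArith .sub 28 28 27) ;; .instr (.valConst 1 2) ;;
  .instr (.valArith .div 28 28 1) ;;
  .ite (.valLt 28 25) (.instr (.ptrCopy 0 19) ;; .instr (.valArith .sub 0 20 25))
    (.instr (.ptrCopy 0 18) ;; .instr (.valCopy 0 25))

section Center

variable {V : Type*} [Fintype V] [DecidableEq V] {T : TreeNetwork V} {K : ℕ} {s s' : Store V}

open TreeNetwork

theorem heightCode_does (hK : 50 ≤ K) {q r : ℕ} {u : V} (hW : TreeWords T K s) (hr : 3 ≤ r)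
    (hq : s.ptr q = some u) :
    Does T K (fun i => i = 1 ∨ i = 2 ∨ i = r) (heightCode q r) (4 * Fintype.card V + 3) s
      fun s' => s'.val r = T.mass (T.ancs u) := by
  have hr₁ : r ≠ 1 := by omega
  have hz : Fit T K 0 := Fit.zero
  have h₁ : Does T K (fun i => i = 1 ∨ i = 2 ∨ i = r)
      (.instr (.ptrCopy 2 q) ;; .instr (.valConst r 0)) 2 s
      fun s' => s'.ptr 2 = some u ∧ s'.val r = 0 :=
    Does.wp (by omega) (by simp [Prog.Targets, Instr.target]) le_rfl hW (by simp [hq, hz])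
  set inv : ℕ → Store V → Prop := fun j s' =>
    (∃ x, T.Anc x u ∧ s'.ptr 2 = some x ∧ s'.val r + T.mass (T.ancs x) = T.mass (T.ancs u) ∧
      j = (T.ancs x).card) ∨ s'.ptr 2 = none ∧ s'.val r = T.mass (T.ancs u) with hinv
  have hcard := Finset.card_le_univ (T.ancs u)
  refine Does.mono (Does.seq h₁ (l := (T.ancs u).card * (3 + 1) + 1) fun s₁ hW₁ _ h =>
    Does.mono (Does.loop inv hW₁ ?_ (.inl ⟨u, Anc.refl u, h.1, by rw [h.2, zero_add], rfl⟩)) le_rfl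
      (fun _ => id) ?_) (by omega) (fun _ => id) fun _ _ => id
  · rintro j s' hW' - h' hb
    simp only [Test.Holds] at hb
    obtain ⟨x, hxu, hx, hsum, rfl⟩ := h'.resolve_right fun h'' => hb h''.1
    have hf : Fit T K (s'.val r + T.parentLength x) := by
      -- Each partial sum is a distance between two vertices, so its height does not grow with the
      -- number of additions.
      have e : s'.val r = T.vdist u x := by
        rw [vdist_eq_of_anc hxu]
        linarith
      rw [e]
      exact ((fit_vdist u x).add (Fit.parentLength x le_rfl)).mono (by omega)
    refine Does.wp (by omega) (by simp [Prog.Targets, Instr.target, TreeQuery.target]) le_rfl hW' ?_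
    simp only [Prog.wp_seq, Prog.wp_parentLength, Prog.wp_valArith, Prog.wp_parent]
    simp only [Store.setVal_val, hr₁, if_false, if_true, ArithOp.onVal, hx, lengthOf, Option.elim,
      Store.setVal_ptr]
    refine ⟨hf, ?_⟩
    cases hp : T.parent x with
    | none =>
      have hroot := T.parent_eq_none.1 hp
      subst hroot
      rw [mass_ancs_root] at hsum
      have : 0 < (T.ancs T.root).card := Finset.card_pos.2 ⟨_, mem_ancs.2 (Anc.refl _)⟩
      refine ⟨(T.ancs T.root).card - 1, by omega, .inr ⟨by simp [parentOf, hp], ?_⟩⟩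
      simp [T.parentLength_root]
      linarith
    | some p =>
      refine ⟨(T.ancs p).card, card_ancs_of_parent hp, .inl ⟨p, (Anc.of_parent hp).trans hxu, ?_, ?_,
        rfl⟩⟩
      · simp [parentOf, hp]
      · have := mass_ancs_of_parent hp
        simp
        linarith
  · rintro s' - ⟨⟨j, h'⟩, hb⟩
    simp only [Test.Holds, not_not] at hb
    rcases h' with ⟨x, -, hx, -⟩ | h'
    · rw [hb] at hx
      cases hx
    · exact h'.2

/-- By `hle` the point at distance `r` from `u` lies on the ascending part of the path to `v`, so it
is reached through parents only. It is a vertex if nothing remains to be climbed, and otherwise lies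
on the edge above the current vertex. -/
theorem climbCode_does (hK : 50 ≤ K) {u v : V} {r L : ℝ} (hW : TreeWords T K s) (hL : 0 ≤ L)
    (hu : s.ptr 0 = some u) (hr : s.val 0 = r) (hr₀ : 0 ≤ r) (hfit : Fit T 20 r)
    (hle : r ≤ T.mass (T.ancs u) - T.common u v)
    (h₁ : ∀ z, 0 < T.weight z → T.vdist u z ≤ L * (1 / T.weight z) + r)
    (h₂ : ∀ z, 0 < T.weight z → T.vdist v z ≤ L * (1 / T.weight z) + (T.vdist u v - r)) :
    Does T K (fun _ => True) climbCode (4 * Fintype.card V + 5) s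
      fun s' => ∃ p : T.Point, p.IsReportedBy s' ∧ ∀ z, T.weight z * p.distTo z ≤ L := by
  -- Vertices of weight `0` impose no condition, as `0 ≤ L`.
  have hmul : ∀ (z : V) (d : ℝ), (0 < T.weight z → d ≤ L * (1 / T.weight z)) →
      T.weight z * d ≤ L := by
    intro z d hd
    rcases (T.weight_nonneg z).eq_or_lt with h | h
    · rw [← h, zero_mul]
      exact hL
    · have := mul_le_mul_of_nonneg_left (hd h) h.le
      rwa [mul_one_div, mul_div_cancel₀ _ h.ne'] at this
  -- As long as something remains, the meeting point of the root paths of `u` and `v` is not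
  -- reached; in particular the current vertex is not the root.
  have hanc : ∀ x : V, ∀ t, T.Anc x u → T.vdist u x + t = r → 0 < t → ¬ T.Anc x v := by
    intro x t hx e ht hv
    have := mass_ancs_le_common hx hv
    rw [vdist_eq_of_anc hx] at e
    linarith
  set inv : ℕ → Store V → Prop := fun j s' => ∃ x, T.Anc x u ∧ s'.ptr 0 = some x ∧
    0 ≤ s'.val 0 ∧ T.vdist u x + s'.val 0 = r ∧ s'.val 1 = T.parentLength x ∧
    j = (T.ancs x).card with hinv
  have hcard := Finset.card_le_univ (T.ancs u)
  refine Does.mono (Does.seq (q := inv (T.ancs u).card) (k := 1)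
    (l := ((T.ancs u).card * (3 + 1) + 1) + 3) ?_
    fun s₁ hW₁ _ h => Does.seq (Does.loop inv hW₁ ?_ h) ?_) (by omega) (fun _ => id) fun _ _ => id
  · refine Does.wp (by omega) trivial le_rfl hW ?_
    rw [Prog.wp_parentLength]
    exact ⟨u, Anc.refl u, by simpa using hu, by simpa [hr] using hr₀, by simp [hr, vdist_self],
      by simp [hu, lengthOf], rfl⟩
  · rintro j s' hW' - ⟨x, hxu, hx, h0, hsum, hl, rfl⟩ hb
    simp only [Test.Holds, hl] at hb
    have hpos : 0 < s'.val 0 := (T.parentLength_nonneg x).trans_lt hb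
    obtain ⟨p, hp⟩ : ∃ p, T.parent x = some p := by
      by_contra! hn
      have hroot := T.parent_eq_none.1 (Option.eq_none_iff_forall_ne_some.2 hn)
      exact hanc x _ hxu hsum hpos (hroot ▸ T.root_anc v)
    have e := vdist_parent_of_anc hp hxu
    rw [vdist_comm p, vdist_comm x] at e
    have hf : Fit T K (s'.val 0 - T.parentLength x) := by
      have e' : s'.val 0 = r - T.vdist u x := by linarith
      rw [e']
      exact ((hfit.sub (fit_vdist _ _)).sub (Fit.parentLength x le_rfl)).mono (by omega)
    refine Does.wp (by omega) (by simp [Prog.Targets]) le_rfl hW' ?_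
    simp only [Prog.wp_seq, Prog.wp_parentLength, Prog.wp_valArith, Prog.wp_parent]
    refine ⟨by simpa [hl] using hf, (T.ancs p).card, card_ancs_of_parent hp, p,
      (Anc.of_parent hp).trans hxu, by simp [hx, parentOf, hp], ?_, ?_,
      by simp [hx, parentOf, hp, lengthOf], rfl⟩
    · simp [hl]
      exact hb.le
    · simp [hl]
      linarith
  · rintro s₂ hW₂ - ⟨⟨j, x, hxu, hx, h0, hsum, hl, -⟩, hb⟩
    simp only [Test.Holds, hl, not_lt] at hb
    refine Does.wp (by omega) (by simp [Prog.Targets]) le_rfl hW₂ ?_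
    have hz : Fit T K 0 := Fit.zero
    rcases h0.eq_or_lt with h | h
    · have e : T.vdist u x = r := by linarith
      have hpath : T.vdist u v = T.vdist u x + T.vdist x v := by
        by_cases hxv : T.Anc x v
        · have h₃ := mass_ancs_le_common hxu hxv
          rw [vdist_eq_of_anc hxu] at e ⊢
          rw [vdist_comm x v, vdist_eq_of_anc hxv, vdist_eq]
          linarith
        · exact vdist_eq_of_separates hxu hxv
      have : ∃ p : T.Point, (∀ s' : Store V, s'.ptr 0 = some x → s'.ptr 1 = none →
          p.IsReportedBy s') ∧ ∀ z, T.weight z * p.distTo z ≤ L := by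
        refine ⟨.vertex x, fun s' h h' => ⟨h, h'⟩, fun z => hmul z _ fun hz => ?_⟩
        exact vdist_le_of_path hpath (e ▸ h₁ z hz) (e ▸ h₂ z hz)
      obtain ⟨p, hp, hp'⟩ := this
      simp only [Prog.wp_seq, Prog.wp_valConst, Prog.wp_ite, Prog.wp_ptrNull]
      refine ⟨by simpa using hz, fun _ => ⟨p, hp _ (by simpa using hx) (by simp), hp'⟩, fun hne => ?_⟩
      simp [h.symm] at hne
    · have hxv := hanc x _ hxu hsum h
      obtain ⟨p, hp⟩ : ∃ p, T.parent x = some p := by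
        by_contra! hn
        have hroot := T.parent_eq_none.1 (Option.eq_none_iff_forall_ne_some.2 hn)
        exact hxv (hroot ▸ T.root_anc v)
      have hadj := ((T.parent_eq_some_iff x p).1 hp).1
      simp only [Prog.wp_seq, Prog.wp_valConst, Prog.wp_ite, Prog.wp_parent]
      refine ⟨by simpa using hz, fun he => ?_, fun _ => ⟨.onEdge x p hadj (s₂.val 0) h.le
        (by rwa [← T.parentLength_eq hp]), ?_, fun z => hmul z _ fun hz => ?_⟩⟩
      · simp [h.ne'] at he
      · simp [Point.IsReportedBy, hx, parentOf, hp]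
      · refine min_vdist_le_of_path hp hxu hxv ?_ ?_
        · rw [hsum]
          exact h₁ z hz
        · rw [hsum]
          exact h₂ z hz

/-- Find a center from the vertex in the pointer register `17`, where `c` finds medians. -/
def centerCode (c : Prog TreeQuery) : Prog TreeQuery :=
  .instr (.ptrCopy 16 17) ;; searchCode c ;;
  (.instr (.ptrCopy 18 67) ;; .instr (.ptrCopy 16 67)) ;; searchCode c ;;
  (.instr (.ptrCopy 19 67) ;; radiusCode) ;; heightCode 18 26 ;; heightCode 19 27 ;;
  chooseCode ;; climbCode

def mainCode (c : Prog TreeQuery) : Prog TreeQuery :=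
  initCode ;; .ite (.ptrIsNull 17) (.instr (.query (.root 0)) ;; .instr (.ptrNull 1)) (centerCode c)

theorem radiusCode_does (hK : 50 ≤ K) {u v : V} {L : ℝ} (hW : TreeWords T K s)
    (hu : s.ptr 18 = some u) (hwu : 0 < T.weight u) (hv : Scanned T u L v s)
    (hd : T.vdist u v = L * (1 / T.weight u + 1 / T.weight v)) :
    Does T K (fun i => i = 1 ∨ (19 ≤ i ∧ i < 26)) (.instr (.ptrCopy 19 67) ;; radiusCode) 9 s
      fun s' => s'.ptr 19 = some v ∧ s'.val 20 = T.vdist u v ∧ s'.val 25 = L * (1 / T.weight u) ∧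
        Fit T 7 (L * (1 / T.weight u)) := by
  have hw : ∀ y, Fit T 1 (1 / T.weight y) := fun y => by
    rw [one_div]
    exact (Fit.weight y le_rfl).inv
  have f1 : Fit T K 1 := fit_one T (by omega)
  have hk : 0 < 1 / T.weight u + 1 / T.weight v := by
    have := hv.pos
    positivity
  have hL : T.vdist u v / (1 / T.weight u + 1 / T.weight v) = L := by
    rw [hd, mul_div_cancel_right₀ _ hk.ne']
  have f2 : Fit T 3 (1 / T.weight u + 1 / T.weight v) := (hw u).add (hw v)
  have f3 : Fit T 5 L := hL ▸ (fit_vdist u v).div f2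
  have f4 : Fit T 6 (L * (1 / T.weight u)) := f3.mul (hw u)
  have c68 := hv.inv
  have c67 := hv.dist
  have hku : Fit T 1 (1 / T.weight u) := hw u
  refine Does.wp (by omega) (by simp [radiusCode, Prog.Targets, Instr.target, TreeQuery.target])
    le_rfl hW ?_
  have e : T.weightOf (some u) = T.weight u := rfl
  set kv := 1 / T.weight v
  simp only [one_div (T.weight u)] at *
  have g1 : Fit T K (T.weight u)⁻¹ := hku.mono (by omega)
  have g2 : Fit T K ((T.weight u)⁻¹ + kv) := f2.mono (by omega)
  have g3 : Fit T K L := f3.mono (by omega)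
  have g4 : Fit T K (L * (T.weight u)⁻¹) := f4.mono (by omega)
  simp [radiusCode, hu, hv.ptr, c67, c68, e, hL, f1, g1, g2, g3, g4, f4.mono]

/-- Half of `d(u, v)` plus the depth of `u` minus that of `v` is the length of the part of the path
that ascends from `u`. A point beyond it lies on the part that ascends from `v`. -/
theorem chooseCode_does (hK : 50 ≤ K) {u v : V} {r : ℝ} (hW : TreeWords T K s)
    (hu : s.ptr 18 = some u) (hv : s.ptr 19 = some v) (h20 : s.val 20 = T.vdist u v)
    (h25 : s.val 25 = r) (hr : Fit T 7 r) (h26 : s.val 26 = T.mass (T.ancs u))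
    (h27 : s.val 27 = T.mass (T.ancs v)) :
    Does T K (fun _ => True) chooseCode 8 s fun s' =>
      (s'.ptr 0 = some u ∧ s'.val 0 = r ∧ r ≤ T.mass (T.ancs u) - T.common u v) ∨
      (s'.ptr 0 = some v ∧ s'.val 0 = T.vdist u v - r ∧
        T.vdist u v - r ≤ T.mass (T.ancs v) - T.common v u) := by
  have fu : Fit T 2 (T.mass (T.ancs u)) := vdist_root u ▸ fit_vdist T.root u
  have fv : Fit T 2 (T.mass (T.ancs v)) := vdist_root v ▸ fit_vdist T.root v
  have g1 : Fit T K 2 := fit_two T (by omega)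
  have f2 := (fit_vdist u v).add fu
  have f3 := f2.sub fv
  have g2 : Fit T K (T.vdist u v + T.mass (T.ancs u)) := f2.mono (by omega)
  have g3 : Fit T K (T.vdist u v + T.mass (T.ancs u) - T.mass (T.ancs v)) := f3.mono (by omega)
  have g4 : Fit T K ((T.vdist u v + T.mass (T.ancs u) - T.mass (T.ancs v)) / 2) :=
    (f3.div (fit_two T le_rfl)).mono (by omega)
  have g5 : Fit T K (T.vdist u v - r) := ((fit_vdist u v).sub hr).mono (by omega)
  have hmid : (T.vdist u v + T.mass (T.ancs u) - T.mass (T.ancs v)) / 2 =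
      T.mass (T.ancs u) - T.common u v := by
    rw [vdist_eq]
    ring
  have hd := vdist_eq (T := T) u v
  refine Does.wp (by omega) (by simp [chooseCode, Prog.Targets]) (by decide) hW ?_
  rcases lt_or_ge ((T.vdist u v + T.mass (T.ancs u) - T.mass (T.ancs v)) / 2) r with h | h
  · have : T.vdist u v - r ≤ T.mass (T.ancs v) - T.common v u := by
      rw [common_comm v u]
      linarith
    simp [chooseCode, hu, hv, h20, h25, h26, h27, g1, g2, g3, g4, g5, h, this]
  · have : r ≤ T.mass (T.ancs u) - T.common u v := by linarith
    simp [chooseCode, hu, hv, h20, h25, h26, h27, g1, g2, g3, g4, g5, not_lt.2 h, this]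

/-- The double sweep at the unknown place `L`: one search from `a` gives `u`, one from `u` gives
`v`. The second search reuses the interval left by the first, which still encloses `L`. Only then is
`L` computed, as the ratio of `u, v`. -/
theorem centerCode_does {L : ℝ} (hL : T.IsValue L) (hK : 50 ≤ K) {c : Prog TreeQuery} {m M : ℕ}
    (hm : 0 < m)
    (hc : ∀ (v : V) (P : Par) (s : Store V), P.Good T → Env T v P s → TreeWords T K s →
      Runs (TreeQuery.ask T) (TreeWords T K) c (3 * m + 200 * M) s
        fun s' => Agree (SimReg m) s s' ∧ IsMedian (cells T v P) (s'.val 71))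
    (hs : Ready T s) (hW : TreeWords T K s) {a : V} (ha : s.ptr 17 = some a)
    (hwa : 0 < T.weight a) (hlo : s.val 10 < L) (hhi : L ≤ s.val 11) :
    Does T K (fun _ => True) (centerCode c)
      (2 * searchTime m M (Fintype.card V) + 12 * Fintype.card V + 31) s
      fun s' => ∃ p : T.Point, p.IsReportedBy s' ∧ p.IsCenter := by
  have hT : ∀ (S : ℕ → Prop) (i : ℕ), S i → (fun _ : ℕ => True) i := fun _ _ _ => trivial
  have hS₁ : ∀ i, i = 16 ∨ i = 18 → ¬ ScanReg i := by
    rintro i (rfl | rfl) <;> simp [ScanReg]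
  have h₁ : Does T K (· = 16) (.instr (.ptrCopy 16 17)) 1 s fun s' =>
      s'.ptr 16 = some a ∧ Ready T s' ∧ s'.val 10 = s.val 10 ∧ s'.val 11 = s.val 11 :=
    Does.wp (by omega) (by simp [Prog.Targets, Instr.target]) le_rfl hW <| by
      rw [Prog.wp_ptrCopy]
      exact ⟨by simpa using ha, ⟨hs.zero, hs.two_N, hs.N, hs.lo, hs.hi⟩, rfl, rfl⟩
  refine Does.mono (Does.seq (S := fun _ => True) (h₁.mono le_rfl (hT _) fun _ _ => id)
    (l := searchTime m M (Fintype.card V) + (2 + (searchTime m M (Fintype.card V) +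
      (9 + ((4 * Fintype.card V + 3) + ((4 * Fintype.card V + 3) +
        (8 + (4 * Fintype.card V + 5)))))))) ?_) (by omega) (fun _ => id) fun _ _ => id
  rintro s₁ hW₁ - ⟨ha₁, hR₁, h10, h11⟩
  refine Does.seq ((searchCode_does hL hK hm hc hR₁ hW₁ ha₁ hwa (h10 ▸ hlo) (h11 ▸ hhi)).mono
    le_rfl (hT _) fun _ _ => id) ?_
  rintro s₂ hW₂ - ⟨hR₂, hlo₂, hhi₂, u, hu⟩
  have h₃ : Does T K (fun _ => True) (.instr (.ptrCopy 18 67) ;; .instr (.ptrCopy 16 67)) 2 s₂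
      fun s' => s'.ptr 16 = some u ∧ s'.ptr 18 = some u ∧ Ready T s' ∧ s'.val 10 < L ∧
        L ≤ s'.val 11 :=
    Does.wp (by omega) (by simp [Prog.Targets]) le_rfl hW₂ <| by
      rw [Prog.wp_seq, Prog.wp_ptrCopy, Prog.wp_ptrCopy]
      exact ⟨by simpa using hu.ptr, by simpa using hu.ptr,
        ⟨hR₂.zero, hR₂.two_N, hR₂.N, hR₂.lo, hR₂.hi⟩, hlo₂, hhi₂⟩
  refine Does.seq h₃ ?_
  rintro s₃ hW₃ - ⟨hu₁₆, hu₁₈, hR₃, hlo₃, hhi₃⟩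
  refine Does.seq ((searchCode_does hL hK hm hc hR₃ hW₃ hu₁₆ hu.pos hlo₃ hhi₃).mono
    le_rfl (hT _) fun s' hA h => And.intro hA h) ?_
  rintro s₄ hW₄ - ⟨hA₄, -, -, -, v, hv⟩
  have hu₄ : s₄.ptr 18 = some u := (hA₄ 18 (by simp [SearchReg])).2.1.trans hu₁₈
  have hd := hL.eq hu.pos hv.pos hu.best hv.best
  refine Does.seq ((radiusCode_does hK hW₄ hu₄ hu.pos hv hd).mono le_rfl (hT _)
    fun s' hA h => And.intro hA h) ?_
  rintro s₅ hW₅ - ⟨hA₅, hv₅, h20₅, h25₅, hfit⟩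
  have hu₅ : s₅.ptr 18 = some u := (hA₅ 18 (by simp)).2.1.trans hu₄
  refine Does.seq ((heightCode_does hK hW₅ (by omega) hu₅).mono le_rfl (hT _)
    fun s' hA h => And.intro hA h) ?_
  rintro s₆ hW₆ - ⟨hA₆, h26₆⟩
  have hv₆ : s₆.ptr 19 = some v := (hA₆ 19 (by simp)).2.1.trans hv₅
  refine Does.seq ((heightCode_does hK hW₆ (by omega) hv₆).mono le_rfl (hT _)
    fun s' hA h => And.intro hA h) ?_
  rintro s₇ hW₇ - ⟨hA₇, h27₇⟩
  have hu₇ : s₇.ptr 18 = some u :=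
    (hA₇ 18 (by simp)).2.1.trans ((hA₆ 18 (by simp)).2.1.trans hu₅)
  have hv₇ : s₇.ptr 19 = some v := (hA₇ 19 (by simp)).2.1.trans hv₆
  have h20₇ : s₇.val 20 = T.vdist u v :=
    (hA₇ 20 (by simp)).2.2.trans ((hA₆ 20 (by simp)).2.2.trans h20₅)
  have h25₇ : s₇.val 25 = L * (1 / T.weight u) :=
    (hA₇ 25 (by simp)).2.2.trans ((hA₆ 25 (by simp)).2.2.trans h25₅)
  have h26₇ : s₇.val 26 = T.mass (T.ancs u) := (hA₇ 26 (by simp)).2.2.trans h26₆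
  refine Does.seq (chooseCode_does hK hW₇ hu₇ hv₇ h20₇ h25₇ hfit h26₇ h27₇) ?_
  intro s₈ hW₈ _ h₈
  have hL₀ := hL.nonneg
  have hwu := hu.pos
  have hwv := hv.pos
  have hr₀ : 0 ≤ L * (1 / T.weight u) := by positivity
  have hr₁ : T.vdist u v - L * (1 / T.weight u) = L * (1 / T.weight v) := by
    rw [hd]
    ring
  have hr₂ : 0 ≤ L * (1 / T.weight v) := by positivity
  have hu' : ∀ z, 0 < T.weight z → T.vdist u z ≤ L * (1 / T.weight z) + L * (1 / T.weight u) := by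
    intro z hz
    have := hL.le u z hu.pos hz
    linarith
  have hv' : ∀ z, 0 < T.weight z → T.vdist v z ≤ L * (1 / T.weight z) + L * (1 / T.weight v) := by
    intro z hz
    have := hL.le v z hv.pos hz
    linarith
  have hcen : ∀ q : T.Point, (∀ z, T.weight z * q.distTo z ≤ L) → q.IsCenter := fun q hq =>
    Point.isCenter_of_pair hu.pos hv.pos (by rw [hd, one_div, one_div]) hq
  have hfin : ∀ s' : Store V, (∃ p : T.Point, p.IsReportedBy s' ∧
      ∀ z, T.weight z * p.distTo z ≤ L) → ∃ p : T.Point, p.IsReportedBy s' ∧ p.IsCenter :=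
    fun s' ⟨p, h, h'⟩ => ⟨p, h, hcen p h'⟩
  rcases h₈ with ⟨e₁, e₂, e₃⟩ | ⟨e₁, e₂, e₃⟩
  · refine (climbCode_does (v := v) hK hW₈ hL₀ e₁ e₂ hr₀ (hfit.mono (by omega)) e₃ hu' ?_).mono le_rfl
      (hT _) fun s' _ => hfin s'
    rwa [hr₁]
  · refine (climbCode_does (v := u) hK hW₈ hL₀ e₁ e₂ (hr₁ ▸ hr₂)
      (((fit_vdist u v).sub hfit).mono (by omega)) e₃ ?_ ?_).mono le_rfl
      (hT _) fun s' _ => hfin s'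
    · rwa [hr₁]
    · rw [vdist_comm v u, sub_sub_cancel]
      exact hu'

theorem mainCode_does (hK : 50 ≤ K) {c : Prog TreeQuery} {m M : ℕ} (hm : 0 < m)
    (hc : ∀ (v : V) (P : Par) (s : Store V), P.Good T → Env T v P s → TreeWords T K s →
      Runs (TreeQuery.ask T) (TreeWords T K) c (3 * m + 200 * M) s
        fun s' => Agree (SimReg m) s s' ∧ IsMedian (cells T v P) (s'.val 71)) :
    Does T K (fun _ => True) (mainCode c)
      (2 * searchTime m M (Fintype.card V) + 114 * Fintype.card V + 42) Store.init
      fun s' => ∃ p : T.Point, p.IsReportedBy s' ∧ p.IsCenter := by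
  refine Does.mono (Does.seq (S := fun _ => True)
    ((initCode_does hK).mono le_rfl (fun _ _ => trivial) fun _ _ => id)
    (l := (2 * searchTime m M (Fintype.card V) + 12 * Fintype.card V + 31) + 1) ?_) (by omega)
    (fun _ => id) fun _ _ => id
  rintro s hW - ⟨hR, h10, h11, hnone, hsome⟩
  refine Does.ite (fun h => ?_) fun h => ?_
  · refine (Does.wp (K := K) (S := fun _ => True) (by omega) (by simp [Prog.Targets])
      (show _ ≤ _ by simp only [Prog.size]; omega) hW ?_)
    simp only [Prog.wp_seq, Prog.wp_root, Prog.wp_ptrNull]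
    exact ⟨.vertex T.root, ⟨by simp, by simp⟩, Point.isCenter_of_weight_eq_zero (hnone h) _⟩
  · obtain ⟨a, ha⟩ := Option.ne_none_iff_exists'.1 h
    have hwa := hsome a ha
    obtain ⟨L, hL⟩ := exists_isValue hwa
    refine centerCode_does hL hK hm hc hR hW ha hwa ?_ (h11 L hL)
    rw [h10]
    linarith [hL.nonneg]

end Center

/-- The number of steps is `O((n + M) log² n)`. -/
theorem exists_time_bound (m : ℕ) : ∃ C : ℝ, ∀ n M : ℕ, 1 ≤ n →
    ((2 * searchTime m M n + 114 * n + 42 : ℕ) : ℝ) ≤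
      C * ((n : ℝ) + (M : ℝ)) * Real.log ((n : ℝ) + 1) ^ 2 := by
  -- The factor `25` is `5 ^ 2` from `h₂`; the other one is a crude bound for the coefficients in
  -- `searchTime`.
  refine ⟨25 * (12 * m + 3000), fun n M hn => ?_⟩
  set l := Nat.log 2 n with hl
  have h₁ : 2 * searchTime m M n + 114 * n + 42 ≤ (12 * m + 3000) * (n + M) * (l + 2) ^ 2 := by
    have hs : searchCount n ≤ 2 * (l + 2) ^ 2 := by
      rw [searchCount, ← hl]
      nlinarith
    have e₁ : 3 * m + 200 * M + 302 * n + 90 ≤ (3 * m + 392) * (n + M) := by nlinarith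
    have e₂ := Nat.mul_le_mul hs e₁
    have e₃ : 1 ≤ (l + 2) ^ 2 := Nat.one_le_pow _ _ (by omega)
    have e₄ : n ≤ (n + M) * (l + 2) ^ 2 := by nlinarith
    rw [searchTime]
    nlinarith
  -- Both `l * log 2` and `log 2` are at most `log (n + 1)`, so `(l + 2) * log 2 ≤ 3 * log (n + 1)`,
  -- and `3 / log 2 < 5`.
  have h₂ : (l : ℝ) + 2 ≤ 5 * Real.log ((n : ℝ) + 1) := by
    have hlog2 := Real.log_two_gt_d9
    have hn1 : (1 : ℝ) ≤ n := by exact_mod_cast hn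
    have e₁ : Real.log 2 ≤ Real.log ((n : ℝ) + 1) :=
      Real.log_le_log two_pos (by linarith)
    have e₂ : (l : ℝ) * Real.log 2 ≤ Real.log ((n : ℝ) + 1) := by
      rw [← Real.log_pow]
      refine Real.log_le_log (by positivity) ?_
      have : 2 ^ l ≤ n := Nat.pow_log_le_self 2 (by omega)
      have : ((2 ^ l : ℕ) : ℝ) ≤ n := by exact_mod_cast this
      push_cast at this
      linarith
    nlinarith
  have h₃ : ((2 * searchTime m M n + 114 * n + 42 : ℕ) : ℝ) ≤
      (12 * m + 3000) * ((n : ℝ) + M) * ((l : ℝ) + 2) ^ 2 := by exact_mod_cast h₁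
  refine h₃.trans ?_
  have h₄ : ((l : ℝ) + 2) ^ 2 ≤ (5 * Real.log ((n : ℝ) + 1)) ^ 2 :=
    pow_le_pow_left₀ (by positivity) h₂ 2
  have h₅ : (0 : ℝ) ≤ (12 * m + 3000) * ((n : ℝ) + M) := by positivity
  calc _ ≤ (12 * m + 3000) * ((n : ℝ) + M) * (5 * Real.log ((n : ℝ) + 1)) ^ 2 :=
        mul_le_mul_of_nonneg_left h₄ h₅
    _ = _ := by ring

end TreeCenter

theorem mainTheorem3 (M : ℕ → ℕ) (hM : TreeCenter.MedianComputableIn M) :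
    ∃ (A : TreeCenter.Prog TreeCenter.TreeQuery) (C : ℝ) (K : ℕ),
      ∀ (V : Type*) [Fintype V] [DecidableEq V] (T : TreeCenter.TreeNetwork V),
        ∃ (t : ℕ) (s : TreeCenter.Store V) (p : T.Point),
          TreeCenter.Exec (TreeCenter.TreeQuery.ask T) (TreeCenter.TreeWords T K) A
            TreeCenter.Store.init t s ∧
          p.IsReportedBy s ∧
          p.IsCenter ∧
          (t : ℝ) ≤ C * ((Fintype.card V : ℝ) + (M (Fintype.card V) : ℝ)) *
            Real.log ((Fintype.card V : ℝ) + 1) ^ 2 := by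
  obtain ⟨c, m, k, hm, hc⟩ := TreeCenter.exists_medianCode hM
  obtain ⟨C, hC⟩ := TreeCenter.exists_time_bound m
  refine ⟨TreeCenter.mainCode c, C, 50 + k, fun V _ _ T => ?_⟩
  obtain ⟨t, s, h₁, h₂, -, -, p, h₃, h₄⟩ := TreeCenter.mainCode_does (T := T) (K := 50 + k)
    (by omega) hm (M := M (Fintype.card V))
    fun v P s => hc V T v P (50 + k) s (by omega)
  exact ⟨t, s, p, h₁, h₃, h₄, (Nat.cast_le.2 h₂).trans (hC _ _ T.card_pos)⟩
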